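/- Let $0<p<n$. Write $dd^c=\frac{i}{2\pi}\partial\bar\partial$, $\beta=dd^c|z|^2$ on $\mathbb C^n$, $B(r)=\{|z|<r\}$, and for a current $S$ of bidimension $(m,m)$ on $\mathbb C^n$ such that $S$ or $-S$ is positive put $\nu_S(r)=r^{-2m}\int_{B(r)}S\wedge\beta^m$ ($r>0$). Let $\pi:\mathbb C^n[0]=\{(z,L)\in\mathbb C^n\times\mathbb P^{n-1}:z\in L\}\to\mathbb C^n$ be the blow-up of $\mathbb C^n$ at $0$, with the Kähler form $\omega=\pi^*\beta+\omega_{FS}$, where $\omega_{FS}$ is the pull-back of the Fubini–Study form of $\mathbb P^{n-1}$ (equal to $\pi^*dd^c\log|z|^2$ off $\pi^{-1}(0)$), and for a positive current $S$ of bidimension $(p,p)$ on $\mathbb C^n[0]$ put $\|S\|(A)=\int_A S\wedge\omega^p$. Let $T$ be a positive current of bidimension $(p,p)$ on $\mathbb C^n$, and set $C_r=\sum_{k=1}^p\binom pk r^{2k}$, $C'_r=\sum_{k=1}^p\frac1{2k}\binom pk r^{2k}$. (1) If $T$ is plurisubharmonic, i.e. $dd^cT\ge 0$, then $\nu_T(0)=\lim_{r\to0^+}\nu_T(r)$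 exists, and $T$ admits a blow-up: there is a positive current $\widehat T$ of bidimension $(p,p)$ on $\mathbb C^n[0]$ with $\pi_*\widehat T=T$. It can be chosen such that, for every $r>0$, $$\|\widehat T\|(\pi^{-1}(B(r)))\le\nu_T(r)-\nu_T(0)+C_r\,\nu_T(r).$$ (2) If $T$ is plurisuperharmonic, i.e. $dd^cT\le 0$, and satisfies condition $(C)_0$: $\int_0^{r_0}\frac{\nu_{dd^cT}(t)}t\,dt>-\infty$ for some $r_0>0$, then $\nu_T(0)=\lim_{r\to0^+}\nu_T(r)$ exists, and $T$ admits a blow-up $\widehat T$, i.e. a positive current of bidimension $(p,p)$ on $\mathbb C^n[0]$ with $\pi_*\widehat T=T$, which can be chosen such that, for every $r>0$, $$\|\widehat T\|(\pi^{-1}(B(r)))\le|\nu_T(r)-\nu_T(0)|+C_r\,\nu_T(r)-2C'_r\,\nu_{dd^cT}(r)+2\int_0^r\Big(\frac{t^{2p}}{r^{2p}}-1\Big)\frac{\nu_{dd^cT}(t)}t\,dt.$$ -/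

import Mathlib

open Set Filter Topology MeasureTheory
open scoped ContDiff Distributions

noncomputable section

namespace PshCurrent

/-! ### Differential forms on `ℂⁿ` -/

/-- `ℂⁿ` with its Hermitian norm, regarded as a real normed space where needed. -/
abbrev Cn (n : ℕ) : Type := EuclideanSpace ℂ (Fin n)

/-- Complex-valued real-alternating `k`-forms on `ℂⁿ` (constant coefficients). -/
abbrev Alt (n k : ℕ) : Type := Cn n [⋀^Fin k]→L[ℝ] ℂ

/-- Smooth compactly supported complex-valued `k`-forms on `ℂⁿ`, with the LF topology. -/
abbrev TestForm (n k : ℕ) : Type := 𝓓((⊤ : TopologicalSpace.Opens (Cn n)), Alt n k)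

/-- The complex structure of `ℂⁿ`, as a real linear map. -/
def cplxJ (n : ℕ) : Cn n →L[ℝ] Cn n :=
  (Complex.I • ContinuousLinearMap.id ℂ (Cn n)).restrictScalars ℝ

/-- The pull back `J^* η`, `(J^* η)(v₁, …, v_k) = η(i v₁, …, i v_k)`. -/
def pullJ {n k : ℕ} : Alt n k →L[ℝ] Alt n k :=
  ContinuousAlternatingMap.compContinuousLinearMapCLM (cplxJ n)

/-- The operator `dd^c = (i / 2π) ∂∂̄` on forms of type `(m, m)`. On such a form
`d^c η = (i / 4π) (∂̄ - ∂) η = - (1 / 4π) J^* (d η)`. -/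
def ddcForm {n k : ℕ} (η : Cn n → Alt n k) (x : Cn n) : Alt n (k + 2) :=
  ((-(1 / (4 * Real.pi)) : ℝ) : ℂ) • extDeriv (fun y => pullJ (extDeriv η y)) x

/-- `dd^c f` for a real function `f`. -/
def ddcFun {n : ℕ} (f : Cn n → ℝ) : Cn n → Alt n 2 :=
  ddcForm (k := 0) (fun x =>
    ContinuousAlternatingMap.constOfIsEmpty ℝ (Cn n) (Fin 0) ((f x : ℝ) : ℂ))

/-- The Kähler form `β = dd^c |z|²` of `ℂⁿ`. -/
def beta (n : ℕ) : Cn n → Alt n 2 := ddcFun (fun z => ‖z‖ ^ 2)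

theorem contDiff_extDeriv {n k : ℕ} {η : Cn n → Alt n k} (h : ContDiff ℝ ∞ η) :
    ContDiff ℝ ∞ (extDeriv η) := by
  have : extDeriv η = fun x =>
      ContinuousAlternatingMap.alternatizeUncurryFinCLM ℝ (Cn n) ℂ (fderiv ℝ η x) := by
    funext x; simp [extDeriv]
  rw [this]
  exact (ContinuousLinearMap.contDiff _).comp (h.fderiv_right (by simp))

theorem hasCompactSupport_extDeriv {n k : ℕ} {η : Cn n → Alt n k} (h : HasCompactSupport η) :
    HasCompactSupport (extDeriv η) := by
  have : extDeriv η = fun x =>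
      ContinuousAlternatingMap.alternatizeUncurryFinCLM ℝ (Cn n) ℂ (fderiv ℝ η x) := by
    funext x; simp [extDeriv]
  rw [this]
  exact (h.fderiv (𝕜 := ℝ)).comp_left (map_zero _)

theorem extDeriv_complex_smul {n k : ℕ} (c : ℂ) (η : Cn n → Alt n k) :
    extDeriv (fun x => c • η x) = fun x => c • extDeriv η x := by
  funext x
  have h : fderiv ℝ (fun x => c • η x) x = c • fderiv ℝ η x := by
    exact congrFun (fderiv_const_smul_field (𝕜 := ℝ) (R := ℂ) (f := η) c) x
  simp only [extDeriv, h, ContinuousAlternatingMap.alternatizeUncurryFin_smul]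

theorem pullJ_smul {n k : ℕ} (c : ℂ) (η : Alt n k) : pullJ (c • η) = c • pullJ η := by
  ext v; simp [pullJ]

/-- `dd^c` on test forms. -/
def ddcTest (n k : ℕ) : TestForm n k →ₗ[ℂ] TestForm n (k + 2) where
  toFun η :=
    { toFun := ddcForm η
      contDiff' := (contDiff_extDeriv
        (pullJ.contDiff.comp (contDiff_extDeriv η.contDiff))).const_smul _
      hasCompactSupport' := by
        have h := hasCompactSupport_extDeriv (n := n) (η := fun y => pullJ (extDeriv η y))
          ((hasCompactSupport_extDeriv η.hasCompactSupport).comp_left (map_zero _))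
        refine h.comp_left (g := fun w : Alt n (k + 2) =>
          ((-(1 / (4 * Real.pi)) : ℝ) : ℂ) • w) ?_
        ext v
        simp
      tsupport_subset' := fun _ _ => trivial }
  map_add' η ξ := by
    ext1 x
    have e1 : extDeriv (⇑(η + ξ)) = fun y => extDeriv η y + extDeriv ξ y := by
      funext y
      exact extDeriv_add (η.contDiff.differentiable (by simp) y)
        (ξ.contDiff.differentiable (by simp) y)
    have e2 : extDeriv (fun y => pullJ (extDeriv η y) + pullJ (extDeriv ξ y)) x =
        extDeriv (fun y => pullJ (extDeriv η y)) x + extDeriv (fun y => pullJ (extDeriv ξ y)) x :=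
      extDeriv_fun_add
        ((pullJ.contDiff.comp (contDiff_extDeriv η.contDiff)).differentiable (by simp) x)
        ((pullJ.contDiff.comp (contDiff_extDeriv ξ.contDiff)).differentiable (by simp) x)
    change ddcForm (⇑(η + ξ)) x = ddcForm η x + ddcForm ξ x
    simp only [ddcForm, e1, map_add, e2, smul_add]
  map_smul' c η := by
    ext1 x
    have e1 : extDeriv (⇑(c • η)) = fun y => c • extDeriv η y := extDeriv_complex_smul c η
    change ddcForm (⇑(c • η)) x = c • ddcForm η x
    simp only [ddcForm, e1, pullJ_smul, extDeriv_complex_smul, smul_comm _ c]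

/-- The index `2 a + s` in `{0, …, 2 m - 1}`, for `a < m` and `s ∈ {0, 1}`. -/
def pairIdx {m : ℕ} (a : Fin m) (s : Fin 2) : Fin (2 * m) :=
  ⟨2 * (a : ℕ) + s, by have := a.2; have := s.2; omega⟩

theorem pairProd_update {n : ℕ} (κ : Alt n 2) (m : ℕ) (v : Fin (2 * m) → Cn n)
    (i : Fin (2 * m)) : ∃ (a₀ : Fin m) (s₀ : Fin 2) (c : ℂ), ∀ z : Cn n,
      (∏ a : Fin m, κ (fun s => Function.update v i z (pairIdx a s))) =
        κ (Function.update (fun s => v (pairIdx a₀ s)) s₀ z) * c := by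
  let a₀ : Fin m := ⟨(i : ℕ) / 2, by have := i.2; omega⟩
  let s₀ : Fin 2 := ⟨(i : ℕ) % 2, by omega⟩
  refine ⟨a₀, s₀, ∏ a ∈ Finset.univ.erase a₀, κ (fun s => v (pairIdx a s)), fun z => ?_⟩
  rw [← Finset.mul_prod_erase Finset.univ _ (Finset.mem_univ a₀)]
  congr 1
  · congr 1
    funext s
    by_cases hs : s = s₀
    · have : pairIdx a₀ s = i := by
        subst hs; apply Fin.ext; simp only [pairIdx, a₀, s₀]; omega
      rw [this, hs]; simp
    · have : pairIdx a₀ s ≠ i := by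
        intro h
        apply hs
        have h1 := congrArg Fin.val h
        have h2 := s.2
        simp only [pairIdx, a₀] at h1
        apply Fin.ext
        simp only [s₀]; omega
      rw [Function.update_of_ne this, Function.update_of_ne hs]
  · refine Finset.prod_congr rfl fun a ha => ?_
    congr 1
    funext s
    have : pairIdx a s ≠ i := by
      intro h
      apply (Finset.mem_erase.1 ha).1
      have h1 := congrArg Fin.val h
      have h2 := s.2
      simp only [pairIdx] at h1
      apply Fin.ext
      simp only [a₀]; omega
    rw [Function.update_of_ne this]

/-- The multilinear map `(v₀, …, v_{2m-1}) ↦ ∏_a κ(v_{2a}, v_{2a+1})`. -/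
def pairProd {n : ℕ} (κ : Alt n 2) (m : ℕ) :
    ContinuousMultilinearMap ℝ (fun _ : Fin (2 * m) => Cn n) ℂ where
  toFun v := ∏ a : Fin m, κ (fun s => v (pairIdx a s))
  map_update_add' := by
    intro hdec v i x y
    obtain rfl : hdec = instDecidableEqFin (2 * m) := Subsingleton.elim _ _
    obtain ⟨a₀, s₀, c, h⟩ := pairProd_update κ m v i
    rw [h, h, h, κ.map_update_add, add_mul]
  map_update_smul' := by
    intro hdec v i r x
    obtain rfl : hdec = instDecidableEqFin (2 * m) := Subsingleton.elim _ _
    obtain ⟨a₀, s₀, c, h⟩ := pairProd_update κ m v i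
    rw [h, h, κ.map_update_smul, smul_mul_assoc]
  cont := by fun_prop

/-- The exterior power `κ^m = κ ∧ ⋯ ∧ κ` of a `2`-form:
`κ^m (v₀, …, v_{2m-1}) = 2⁻ᵐ ∑_σ sgn σ ∏_a κ(v_{σ(2a)}, v_{σ(2a+1)})`. -/
def wedgePow {n : ℕ} (κ : Alt n 2) (m : ℕ) : Alt n (2 * m) :=
  ((2 : ℂ) ^ m)⁻¹ • ContinuousMultilinearMap.alternatization (pairProd κ m)

/-- The exterior product `θ₀ ∧ ⋯ ∧ θ_{k-1}` of one-forms: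
`(v₀, …, v_{k-1}) ↦ det (θ_a (v_b))`. -/
def wedgeOne {n k : ℕ} (θ : Fin k → (Cn n →L[ℝ] ℂ)) : Alt n k :=
  ContinuousMultilinearMap.alternatization
    ((ContinuousMultilinearMap.mkPiAlgebra ℝ (Fin k) ℂ).compContinuousLinearMap θ)

/-- The form `(i α₀ ∧ ᾱ₀) ∧ ⋯ ∧ (i α_{m-1} ∧ ᾱ_{m-1})` for `ℂ`-linear one-forms `α_a`. -/
def strongGen {n m : ℕ} (α : Fin m → (Cn n →L[ℂ] ℂ)) : Alt n (2 * m) :=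
  Complex.I ^ m • wedgeOne (fun b : Fin (2 * m) =>
    let α' : Cn n →L[ℝ] ℂ :=
      (α ⟨(b : ℕ) / 2, by have := b.2; omega⟩).restrictScalars ℝ
    if (b : ℕ) % 2 = 0 then α' else (Complex.conjCLE : ℂ →L[ℝ] ℂ).comp α')

/-- The convex cone of strongly positive `(m, m)`-forms: finite sums with nonnegative
coefficients of the forms `(i α₀ ∧ ᾱ₀) ∧ ⋯ ∧ (i α_{m-1} ∧ ᾱ_{m-1})`. -/
def StronglyPositive {n m : ℕ} (η : Alt n (2 * m)) : Prop :=
  ∃ (N : ℕ) (c : Fin N → ℝ) (α : Fin N → Fin m → (Cn n →L[ℂ] ℂ)),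
    (∀ l, 0 ≤ c l) ∧ η = ∑ l, ((c l : ℝ) : ℂ) • strongGen (α l)

/-- A form of degree `k = a + b` is of type `(a, b)` iff multiplying all its arguments by a
complex number `t` multiplies its value by `t ^ a * t̄ ^ b`. -/
def IsOfType {n k : ℕ} (a b : ℕ) (η : Alt n k) : Prop :=
  ∀ (t : ℂ) (v : Fin k → Cn n),
    η (fun j => t • v j) = t ^ a * (starRingEnd ℂ) t ^ b * η v

/-! ### Currents on `ℂⁿ` -/

/-- `T` is a positive current of bidimension `(m, m)`: it vanishes on test forms of degree `2 m`
of type `(a, b) ≠ (m, m)`, and it is real and nonnegative on test forms that are strongly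
positive at every point. -/
def IsPositive {n m : ℕ} (T : TestForm n (2 * m) →ₗ[ℂ] ℂ) : Prop :=
  (∀ a b : ℕ, a + b = 2 * m → a ≠ m →
    ∀ η : TestForm n (2 * m), (∀ z, IsOfType a b (η z)) → T η = 0) ∧
  ∀ η : TestForm n (2 * m), (∀ z, StronglyPositive (η z)) → 0 ≤ (T η).re ∧ (T η).im = 0

/-- `⟨dd^c T, η⟩ = ⟨T, dd^c η⟩`. -/
def ddc {n q : ℕ} (T : TestForm n (2 * (q + 1)) →ₗ[ℂ] ℂ) : TestForm n (2 * q) →ₗ[ℂ] ℂ :=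
  T.comp (ddcTest n (2 * q))

/-- The test forms `φ β^m` with `0 ≤ φ ≤ 1` and `φ` supported in a compact subset of `U`. -/
def traceTests (n m : ℕ) (U : Set (Cn n)) : Set (TestForm n (2 * m)) :=
  {η | ∃ φ : Cn n → ℝ, (∀ z, 0 ≤ φ z ∧ φ z ≤ 1) ∧
    (∃ K : Set (Cn n), IsCompact K ∧ K ⊆ U ∧ ∀ z, z ∉ K → φ z = 0) ∧
    ∀ z, η z = ((φ z : ℝ) : ℂ) • wedgePow (beta n z) m}

/-- `sup { Re ⟨T, φ β^m⟩ }` over the cut-off functions `φ` of `U`: the mass on the open set `U` of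
the positive part of the real measure `T ∧ β^m`. -/
def posTrace {n m : ℕ} (T : TestForm n (2 * m) →ₗ[ℂ] ℂ) (U : Set (Cn n)) : ENNReal :=
  ⨆ η ∈ traceTests n m U, ENNReal.ofReal (T η).re

/-- `∫_U T ∧ β^m` for an open set `U`: the mass on `U` of the positive part of the real measure
`T ∧ β^m` minus that of its negative part. -/
def traceIntegral {n m : ℕ} (T : TestForm n (2 * m) →ₗ[ℂ] ℂ) (U : Set (Cn n)) : ℝ :=
  (posTrace T U).toReal - (posTrace (-T) U).toReal

/-- `ν_T(r) = r^{-2m} ∫_{B(r)} T ∧ β^m` for a current of bidimension `(m, m)`. -/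
def nu {n m : ℕ} (T : TestForm n (2 * m) →ₗ[ℂ] ℂ) (r : ℝ) : ℝ :=
  traceIntegral T (Metric.ball 0 r) / r ^ (2 * m)

/-! ### The blow-up of `ℂⁿ` at the origin -/

/-- `ℂⁿ[0] = {(z, L) ∈ ℂⁿ × ℙ^{n-1} : z ∈ L}`. -/
def Blowup (n : ℕ) : Type :=
  {x : Cn n × Projectivization ℂ (Cn n) // x.1 ∈ x.2.submodule}

/-- The projection `π : ℂⁿ[0] → ℂⁿ`. -/
def Blowup.proj {n : ℕ} (x : Blowup n) : Cn n := x.1.1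

/-- The vector `(w_0, …, 1, …, w_{n-1})` with `1` at the place `j`. -/
def dir {n : ℕ} (j : Fin n) (w : Cn n) : Cn n :=
  WithLp.toLp 2 (fun l => if l = j then 1 else w l)

/-- `π` in the `j`-th chart: `w ↦ w_j (w_0, …, 1, …, w_{n-1})`. -/
def chartProj {n : ℕ} (j : Fin n) (w : Cn n) : Cn n := w j • dir j w

theorem dir_self {n : ℕ} (j : Fin n) (w : Cn n) : dir j w j = 1 := by simp [dir]

theorem dir_ne_zero {n : ℕ} (j : Fin n) (w : Cn n) : dir j w ≠ 0 := by
  intro h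
  have := dir_self j w
  rw [h] at this
  simp at this

/-- The inverse of the `j`-th standard chart of the blow-up (all of `ℂⁿ` onto the open set of the
`(z, L)` such that `L` is not contained in `{z_j = 0}`). -/
def chart {n : ℕ} (j : Fin n) (w : Cn n) : Blowup n :=
  ⟨(chartProj j w, Projectivization.mk ℂ (dir j w) (dir_ne_zero j w)), by
    rw [Projectivization.submodule_mk]
    exact Submodule.smul_mem _ _ (Submodule.mem_span_singleton_self _)⟩

/-- The change of coordinates from the `i`-th to the `j`-th chart, defined where
`dir i w j ≠ 0`. -/
def trans {n : ℕ} (i j : Fin n) (w : Cn n) : Cn n :=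
  WithLp.toLp 2 (fun l => if l = j then chartProj i w j else dir i w l / dir i w j)

theorem dir_trans {n : ℕ} (i j : Fin n) (w : Cn n) (h : dir i w j ≠ 0) :
    dir j (trans i j w) = (dir i w j)⁻¹ • dir i w := by
  ext l
  by_cases hl : l = j
  · subst hl; simp [dir_self, h]
  · simp only [dir, trans, PiLp.toLp_apply, PiLp.smul_apply, smul_eq_mul, hl, if_false] at h ⊢
    field_simp

theorem chartProj_trans {n : ℕ} (i j : Fin n) (w : Cn n) (h : dir i w j ≠ 0) :
    chartProj j (trans i j w) = chartProj i w := by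
  have h1 : trans i j w j = w i * dir i w j := by simp [trans, chartProj]
  rw [chartProj, dir_trans i j w h, h1, smul_smul, mul_assoc, mul_inv_cancel₀ h, mul_one, chartProj]

theorem chart_trans {n : ℕ} (i j : Fin n) (w : Cn n) (h : dir i w j ≠ 0) :
    chart j (trans i j w) = chart i w := by
  apply Subtype.ext
  refine Prod.ext (chartProj_trans i j w h) ?_
  refine (Projectivization.mk_eq_mk_iff' ℂ _ _ _ _).2 ⟨(dir i w j)⁻¹, ?_⟩
  exact (dir_trans i j w h).symm

/-- The charts cover the blow-up. -/
theorem exists_chart {n : ℕ} (x : Blowup n) : ∃ j w, chart j w = x := by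
  obtain ⟨⟨z, L⟩, hx⟩ := x
  induction L using Projectivization.ind with
  | h u hu =>
    change z ∈ (Projectivization.mk ℂ u hu).submodule at hx
    rw [Projectivization.submodule_mk] at hx
    obtain ⟨c, rfl⟩ := Submodule.mem_span_singleton.1 hx
    obtain ⟨j, hj⟩ : ∃ j, u j ≠ 0 := by
      by_contra! hcon
      exact hu (by ext l; simpa using hcon l)
    let w : Cn n := WithLp.toLp 2 (fun l => if l = j then c * u j else u l / u j)
    have hd : dir j w = (u j)⁻¹ • u := by
      ext l
      by_cases hl : l = j
      · subst hl; simp [dir_self, hj]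
      · simp only [dir, w, PiLp.toLp_apply, PiLp.smul_apply, smul_eq_mul, hl, if_false]
        field_simp
    refine ⟨j, w, Subtype.ext (Prod.ext ?_ ?_)⟩
    · change w j • dir j w = c • u
      have hw : w j = c * u j := by simp [w]
      rw [hd, hw, smul_smul, mul_assoc, mul_inv_cancel₀ hj, mul_one]
    · exact (Projectivization.mk_eq_mk_iff' ℂ _ _ _ _).2 ⟨(u j)⁻¹, hd.symm⟩

/-! ### Forms and currents on the blow-up -/

/-- Smooth compactly supported `k`-forms on `ℂⁿ[0]`: families `(η_j)_j` of smooth forms on `ℂⁿ`,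
`η_j` being the expression of the form in the `j`-th chart, that agree under the changes of
coordinates. As `π` is proper, a compact support means a support over a compact set of `ℂⁿ`. -/
def BlowupTestForm (n k : ℕ) : Submodule ℂ (Fin n → Cn n → Alt n k) where
  carrier := {η | (∀ j, ContDiff ℝ ∞ (η j)) ∧
    (∀ i j w, dir i w j ≠ 0 → η i w =
      (η j (trans i j w)).compContinuousLinearMap (fderiv ℝ (trans i j) w)) ∧
    ∃ K : Set (Cn n), IsCompact K ∧ ∀ j w, chartProj j w ∉ K → η j w = 0}
  add_mem' := by
    rintro η ξ ⟨h1, h2, K, hK, h3⟩ ⟨g1, g2, L, hL, g3⟩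
    refine ⟨fun j => (h1 j).add (g1 j), fun i j w h => ?_, K ∪ L, hK.union hL, fun j w h => ?_⟩
    · ext v
      simp [h2 i j w h, g2 i j w h]
    · rw [mem_union, not_or] at h
      simp [h3 j w h.1, g3 j w h.2]
  zero_mem' := by
    refine ⟨fun j => contDiff_const, fun i j w h => ?_, ∅, isCompact_empty, fun j w h => rfl⟩
    ext v
    simp
  smul_mem' := by
    rintro c η ⟨h1, h2, K, hK, h3⟩
    refine ⟨fun j => (h1 j).const_smul c, fun i j w h => ?_, K, hK, fun j w h => ?_⟩
    · ext v
      simp [h2 i j w h]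
    · simp [h3 j w h]

/-- Continuity of a linear form on the test forms of the blow-up: on the forms with support over
a given compact set it is bounded by finitely many derivatives on a compact set of the charts. -/
def IsBlowupCurrent {n k : ℕ} (S : BlowupTestForm n k →ₗ[ℂ] ℂ) : Prop :=
  ∀ K : Set (Cn n), IsCompact K → ∃ (L : Set (Cn n)) (N : ℕ) (C : ℝ), IsCompact L ∧
    ∀ η : BlowupTestForm n k, (∀ j w, chartProj j w ∉ K → η.1 j w = 0) →
      ∀ b : ℝ, (∀ j, ∀ w ∈ L, ∀ l ≤ N, ‖iteratedFDeriv ℝ l (η.1 j) w‖ ≤ b) → ‖S η‖ ≤ C * b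

/-- Positive currents of bidimension `(m, m)` on the blow-up. -/
def IsPositiveBlowup {n m : ℕ} (S : BlowupTestForm n (2 * m) →ₗ[ℂ] ℂ) : Prop :=
  (∀ a b : ℕ, a + b = 2 * m → a ≠ m →
    ∀ η : BlowupTestForm n (2 * m), (∀ j w, IsOfType a b (η.1 j w)) → S η = 0) ∧
  ∀ η : BlowupTestForm n (2 * m), (∀ j w, StronglyPositive (η.1 j w)) →
    0 ≤ (S η).re ∧ (S η).im = 0

/-- The Kähler form `π^* β + dd^c log |·|²` of the blow-up (the second term being the pull back of
the Fubini–Study form of `ℙ^{n-1}`), in the `j`-th chart. -/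
def kahler {n : ℕ} (j : Fin n) : Cn n → Alt n 2 :=
  ddcFun (fun w => ‖chartProj j w‖ ^ 2 + Real.log (‖dir j w‖ ^ 2))

/-- The test forms `Φ κ^m`, `κ` the Kähler form of the blow-up, with `0 ≤ Φ ≤ 1` and `Φ` supported
over a compact subset of `U`. -/
def massTests (n m : ℕ) (U : Set (Cn n)) : Set (BlowupTestForm n (2 * m)) :=
  {η | ∃ Φ : Blowup n → ℝ, (∀ x, 0 ≤ Φ x ∧ Φ x ≤ 1) ∧
    (∃ K : Set (Cn n), IsCompact K ∧ K ⊆ U ∧ ∀ x : Blowup n, x.proj ∉ K → Φ x = 0) ∧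
    ∀ j w, η.1 j w = ((Φ (chart j w) : ℝ) : ℂ) • wedgePow (kahler j w) m}

/-- The mass `‖S‖(π⁻¹(U)) = ∫_{π⁻¹(U)} S ∧ κ^m`, for `S` positive of bidimension `(m, m)`, `U` open
in `ℂⁿ` and `κ` the Kähler form of the blow-up. -/
def massOver {n m : ℕ} (S : BlowupTestForm n (2 * m) →ₗ[ℂ] ℂ) (U : Set (Cn n)) : ENNReal :=
  ⨆ η ∈ massTests n m U, ENNReal.ofReal (S η).re

/-! ### Push forward by `π` -/

theorem contDiff_alt_of_toMultilinear {n k : ℕ} {η : Cn n → Alt n k}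
    (h : ContDiff ℝ ∞ (fun x => (η x).toContinuousMultilinearMap)) : ContDiff ℝ ∞ η := by
  let A : ContinuousMultilinearMap ℝ (fun _ : Fin k => Cn n) ℂ →ₗ[ℝ] Cn n [⋀^Fin k]→ₗ[ℝ] ℂ :=
    { toFun := fun f => MultilinearMap.alternatization f.toMultilinearMap
      map_add' := fun f g => by ext v; simp [MultilinearMap.alternatization_apply]
      map_smul' := fun c f => by
        ext v
        simp only [MultilinearMap.alternatization_apply, RingHom.id_apply, AlternatingMap.smul_apply,
          Finset.smul_sum]
        exact Finset.sum_congr rfl fun σ _ => smul_comm (Equiv.Perm.sign σ) c _ }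
  let B : ContinuousMultilinearMap ℝ (fun _ : Fin k => Cn n) ℂ →L[ℝ] Alt n k :=
    AlternatingMap.mkContinuousLinear A (Fintype.card (Equiv.Perm (Fin k))) (fun f v => by
      have hσ : ∀ σ ∈ (Finset.univ : Finset (Equiv.Perm (Fin k))),
          ‖Equiv.Perm.sign σ • f.toMultilinearMap (fun i => v (σ i))‖ ≤ ‖f‖ * ∏ i, ‖v i‖ := by
        intro σ _
        have h1 := f.le_opNorm (fun i => v (σ i))
        rw [Equiv.prod_comp σ (fun i => ‖v i‖)] at h1
        rcases Int.units_eq_one_or (Equiv.Perm.sign σ) with hs | hs <;> simpa [hs] using h1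
      have h2 := Finset.sum_le_card_nsmul _ _ _ hσ
      have h3 : A f v = ∑ σ : Equiv.Perm (Fin k),
          Equiv.Perm.sign σ • f.toMultilinearMap (fun i => v (σ i)) :=
        MultilinearMap.alternatization_apply _ _
      rw [h3]
      refine (norm_sum_le _ _).trans (h2.trans_eq ?_)
      rw [Finset.card_univ, nsmul_eq_mul, mul_assoc])
  have h2 : η = fun x => ((Nat.factorial k : ℝ)⁻¹) • B (η x).toContinuousMultilinearMap := by
    funext x
    ext v
    have h3 := congrArg (fun f => f v) (AlternatingMap.coe_alternatization (η x).toAlternatingMap)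
    have h4 : B (η x).toContinuousMultilinearMap v = (Nat.factorial k) • η x v := by
      rw [Fintype.card_fin] at h3
      exact h3
    have hk : (Nat.factorial k : ℂ) ≠ 0 := by exact_mod_cast Nat.factorial_ne_zero k
    simp [h4, hk]
  rw [h2]
  exact (B.contDiff.comp h).const_smul _

theorem contDiff_toLp {n : ℕ} {f : Cn n → Fin n → ℂ} (h : ∀ l, ContDiff ℝ ∞ (fun w => f w l)) :
    ContDiff ℝ ∞ (fun w => (WithLp.toLp 2 (f w) : Cn n)) :=
  (PiLp.continuousLinearEquiv 2 ℝ (fun _ : Fin n => ℂ)).symm.contDiff.comp (contDiff_pi.2 h)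

theorem contDiff_coord {n : ℕ} (l : Fin n) : ContDiff ℝ ∞ (fun w : Cn n => w l) :=
  ((EuclideanSpace.proj (𝕜 := ℂ) l).restrictScalars ℝ).contDiff

theorem contDiff_pullback {n k : ℕ} {η : Cn n → Alt n k} {f : Cn n → Cn n}
    (hη : ContDiff ℝ ∞ η) (hf : ContDiff ℝ ∞ f) :
    ContDiff ℝ ∞ (fun x => (η (f x)).compContinuousLinearMap (fderiv ℝ f x)) := by
  apply contDiff_alt_of_toMultilinear
  have h1 : ContDiff ℝ ∞ (fun x =>
      ContinuousMultilinearMap.compContinuousLinearMapContinuousMultilinear ℝ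
        (fun _ : Fin k => Cn n) (fun _ => Cn n) ℂ (fun _ => fderiv ℝ f x)) :=
    (ContinuousMultilinearMap.contDiff _).comp
      (contDiff_pi.2 fun _ => hf.fderiv_right (by simp))
  have h2 : ContDiff ℝ ∞ (fun x => (η (f x)).toContinuousMultilinearMap) :=
    (ContinuousAlternatingMap.toContinuousMultilinearMapCLM (𝕜 := ℝ) (E := Cn n) (ι := Fin k)
      (F := ℂ) ℝ).contDiff.comp (hη.comp hf)
  exact h1.clm_apply h2

theorem contDiff_dir {n : ℕ} (j : Fin n) : ContDiff ℝ ∞ (dir (n := n) j) := by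
  refine contDiff_toLp fun l => ?_
  by_cases h : l = j
  · simp only [h, if_true]
    exact contDiff_const
  · simp only [h, if_false]
    exact contDiff_coord l

theorem contDiff_chartProj {n : ℕ} (j : Fin n) : ContDiff ℝ ∞ (chartProj (n := n) j) :=
  (contDiff_coord j).smul (contDiff_dir j)

theorem differentiableAt_trans {n : ℕ} (i j : Fin n) (w : Cn n) (h : dir i w j ≠ 0) :
    DifferentiableAt ℝ (trans (n := n) i j) w := by
  have hd : ∀ m, DifferentiableAt ℝ (fun w : Cn n => dir i w m) w := fun m =>
    ((contDiff_coord m).comp (contDiff_dir i)).differentiable (by simp) w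
  have hp : ∀ m, DifferentiableAt ℝ (fun w : Cn n => chartProj i w m) w := fun m =>
    ((contDiff_coord m).comp (contDiff_chartProj i)).differentiable (by simp) w
  refine (PiLp.continuousLinearEquiv 2 ℝ (fun _ : Fin n => ℂ)).symm.differentiableAt.comp w
    (differentiableAt_pi.2 fun l => ?_)
  by_cases hl : l = j
  · simp only [hl, if_true]
    exact hp j
  · simp only [hl, if_false]
    simp only [div_eq_mul_inv]
    exact (hd l).fun_mul ((hd j).fun_inv h)

/-- The pull back `π^*` of test forms: `η ↦ (chartProj_j^* η)_j`. -/
def pullBlowup (n k : ℕ) : TestForm n k →ₗ[ℂ] BlowupTestForm n k where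
  toFun η :=
    ⟨fun j w => (η (chartProj j w)).compContinuousLinearMap (fderiv ℝ (chartProj j) w),
      fun j => contDiff_pullback η.contDiff (contDiff_chartProj j),
      fun i j w h => by
        have hev : (fun y => chartProj j (trans i j y)) =ᶠ[𝓝 w] chartProj i := by
          have hc : Continuous fun y : Cn n => dir i y j :=
            (EuclideanSpace.proj (𝕜 := ℂ) j).continuous.comp (contDiff_dir i).continuous
          filter_upwards [hc.continuousAt.eventually_ne h] with y hy
          exact chartProj_trans i j y hy
        have hfd : fderiv ℝ (chartProj i) w =
            (fderiv ℝ (chartProj j) (trans i j w)).comp (fderiv ℝ (trans i j) w) := by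
          rw [← hev.fderiv_eq]
          exact fderiv_comp w ((contDiff_chartProj j).differentiable (by simp) _)
            (differentiableAt_trans i j w h)
        ext v
        simp [hfd, chartProj_trans i j w h, Function.comp_def],
      ⟨tsupport η, η.hasCompactSupport, fun j w h => by
        ext v
        simp [image_eq_zero_of_notMem_tsupport h]⟩⟩
  map_add' η ξ := by
    apply Subtype.ext
    funext j w
    ext v
    simp
  map_smul' c η := by
    apply Subtype.ext
    funext j w
    ext v
    simp

/-- The push forward `π_* S`, `⟨π_* S, η⟩ = ⟨S, π^* η⟩`. -/
def pushBlowup {n k : ℕ} (S : BlowupTestForm n k →ₗ[ℂ] ℂ) : TestForm n k →ₗ[ℂ] ℂ :=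
  S.comp (pullBlowup n k)

/-- `S` is a blow-up of `T`: a positive current on `ℂⁿ[0]` such that `π_* S = T`. -/
def IsBlowupOf {n m : ℕ} (S : BlowupTestForm n (2 * m) →ₗ[ℂ] ℂ)
    (T : TestForm n (2 * m) →ₗ[ℂ] ℂ) : Prop :=
  IsBlowupCurrent S ∧ IsPositiveBlowup S ∧ pushBlowup S = T

end PshCurrent

end

/-! Put u = |z|², p = q + 1, and let G be the form i∂u ∧ ∂̄u ∧ β^q, with the power of 2π that makes
dd^c (g(u) β^q) = g'(u) β^p + g''(u) G (`ddcTest_betaTest`). The whole theorem is reduced to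
one-variable analysis in u.

Let M(v) be the T ∧ β^p-mass of {u < v}. Suppose dd^c T = ε S with S positive, ε = ±1, let N(v) be
the trace mass of S on {u < v}, and let N₁ be the primitive of N that vanishes at 0. Testing dd^c T
= ε S on g(u) β^q and integrating by parts twice gives ⟨T, h(u) G⟩ = ∫ h (M + ε N₁) (`tau_eq`), a
form of the Lelong–Jensen formula.

Away from 0, the Kähler form of the blow-up is (1 + 1/u) β minus a multiple of u⁻² i∂u ∧ ∂̄u. The
last term has square zero, so the p-th power is ∑_k C(p,k) (u^{-k} β^p - k u^{-k-1} G)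
(`omegaTest_apply`). By the Cauchy–Schwarz inequality each summand with k ≤ p is strongly positive
(`stronglyPositive_sub_gradForm`). Hence X_k(ψ) = Re ⟨T, ψ(u) (u^{-k} β^p - k u^{-k-1} G)⟩ is a
positive functional, and `XFun_eq` computes it: X_k(ψ) = -∫ ψ' v^{-k} M - ε k ∫ ψ v^{-k-1} N₁.

If ε = 1, the last term has a favourable sign. So v^{-k} M has a distributional derivative that
dominates X_k; it is increasing, and its oscillation bounds X_k. For k = p the function is ν_T(√v):
the Lelong number exists, and the term ν_T(r) - ν_T(0) appears. The terms k < p, bounded without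
subtracting a limit, add up to C_r ν_T(r).

If ε = -1, X_k is exactly the derivative of v^{-k} M + Q_k - v^{-k} N₁, where Q_k is the primitive
of v^{-k} N. Condition (C)₀ makes Q_k finite for all k ≤ p. For k = p the correction Q_p - v^{-p} N₁
tends to 0 at 0 and becomes the integral term after v = t². For k < p it is bounded by Q_k; as S =
-dd^c T is itself dd^c-closed, ν_S is increasing, and this produces the term with C'_r.

The blow-up is a limit of cut-offs. A test form on the blow-up is read on ℂⁿ ∖ {0} and multiplied by
a function of u that vanishes near 0 and increases to 1. Its coefficients are bounded in the charts,
so it is dominated by a multiple of the p-th power of the Kähler form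
(`exists_dominating_downForm`). The T-masses of the cut-off powers are increasing and bounded by the
estimates above, so the pairings converge (`exists_lim_cutForm`). Positivity, continuity and the
mass bound pass to the limit. The push-forward is T because T puts no mass at 0: M(v) = O(v^p).

The pointwise algebra is carried out in the exterior algebra of covectors, where powers of
(1,1)-forms are ring powers and strong positivity is membership in powers of one convex cone.
Domination uses that strongly positive forms and forms of the other bidegrees span everything,
together with averaging over roots of unity to project on bidegree (m, m). -/

noncomputable section

namespace PshCurrent


open scoped NNReal

/-! ### Exterior algebra of real covectors -/

/-- Complex-valued real covectors on `ℂⁿ`. -/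
abbrev Cov (n : ℕ) : Type := Cn n →L[ℝ] ℂ

/-- The exterior algebra of the complex-valued real covectors. -/
abbrev Ext (n : ℕ) : Type := ExteriorAlgebra ℂ (Cov n)

theorem wedgeOne_apply {n k : ℕ} (θ : Fin k → Cov n) (v : Fin k → Cn n) :
    wedgeOne θ v = Matrix.detRowAlternating (fun a b => θ a (v b)) := by
  have h : Matrix.detRowAlternating (fun a b => θ a (v b)) =
      (Matrix.of fun a b => θ a (v b)).det := rfl
  rw [h, ← Matrix.det_transpose, Matrix.det_apply, wedgeOne,
    ContinuousMultilinearMap.alternatization_apply_apply]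
  rfl

/-- `wedgeOne` as an alternating map of the covectors. -/
def wedgeAlt (n k : ℕ) : Cov n [⋀^Fin k]→ₗ[ℂ] Alt n k where
  toFun := wedgeOne
  map_update_add' := by
    intro hdec θ i x y
    obtain rfl : hdec = instDecidableEqFin k := Subsingleton.elim _ _
    ext v
    simp only [ContinuousAlternatingMap.add_apply, wedgeOne_apply]
    have key : ∀ z : Cov n, (fun a b => Function.update θ i z a (v b)) =
        Function.update (fun a b => θ a (v b)) i (fun b => z (v b)) := by
      intro z
      funext a
      by_cases h : a = i
      · subst h; simp
      · simp [h]
    rw [key, key, key, ← AlternatingMap.map_update_add]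
    rfl
  map_update_smul' := by
    intro hdec θ i c x
    obtain rfl : hdec = instDecidableEqFin k := Subsingleton.elim _ _
    ext v
    simp only [ContinuousAlternatingMap.smul_apply, wedgeOne_apply]
    have key : ∀ z : Cov n, (fun a b => Function.update θ i z a (v b)) =
        Function.update (fun a b => θ a (v b)) i (fun b => z (v b)) := by
      intro z
      funext a
      by_cases h : a = i
      · subst h; simp
      · simp [h]
    rw [key, key, ← AlternatingMap.map_update_smul]
    rfl
  map_eq_zero_of_eq' := by
    intro θ i j hij hne
    ext v
    rw [wedgeOne_apply]
    exact AlternatingMap.map_eq_zero_of_eq _ _ (by simp [hij]) hne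

/-- The realization of the degree `k` part of the exterior algebra as alternating forms. -/
def toAlt (n k : ℕ) : Ext n →ₗ[ℂ] Alt n k :=
  ExteriorAlgebra.liftAlternating (Pi.single k (wedgeAlt n k))

theorem toAlt_ιMulti {n k : ℕ} (θ : Fin k → Cov n) :
    toAlt n k (ExteriorAlgebra.ιMulti ℂ k θ) = wedgeOne θ := by
  rw [toAlt, ExteriorAlgebra.liftAlternating_apply_ιMulti, Pi.single_eq_same]
  rfl

theorem toAlt_ιMulti_of_ne {n k l : ℕ} (h : l ≠ k) (θ : Fin l → Cov n) :
    toAlt n k (ExteriorAlgebra.ιMulti ℂ l θ) = 0 := by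
  rw [toAlt, ExteriorAlgebra.liftAlternating_apply_ιMulti, Pi.single_eq_of_ne h]
  rfl

/-- The exterior product of a covector and a form. -/
def wedgeCov {n k : ℕ} (θ : Cov n) (c : Alt n k) : Alt n (k + 1) :=
  ContinuousAlternatingMap.alternatizeUncurryFin (θ.smulRight c)

theorem wedgeCov_apply {n k : ℕ} (θ : Cov n) (c : Alt n k) (v : Fin (k + 1) → Cn n) :
    wedgeCov θ c v = ∑ i : Fin (k + 1), (-1 : ℂ) ^ (i : ℕ) * θ (v i) * c (i.removeNth v) := by
  rw [wedgeCov, ContinuousAlternatingMap.alternatizeUncurryFin_apply]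
  refine Finset.sum_congr rfl fun i _ => ?_
  simp [mul_assoc, Int.cast_pow]

/-- Laplace expansion of the determinant along its first row. -/
theorem wedgeCov_wedgeOne {n k : ℕ} (θ : Cov n) (θ' : Fin k → Cov n) :
    wedgeCov θ (wedgeOne θ') = wedgeOne (Matrix.vecCons θ θ' : Fin (k + 1) → Cov n) := by
  ext v
  have h : Matrix.detRowAlternating
      (fun a b => (Matrix.vecCons θ θ' : Fin (k + 1) → Cov n) a (v b)) =
      (Matrix.of fun a b => (Matrix.vecCons θ θ' : Fin (k + 1) → Cov n) a (v b)).det := rfl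
  rw [wedgeCov_apply, wedgeOne_apply, h, Matrix.det_succ_row_zero]
  refine Finset.sum_congr rfl fun i _ => ?_
  rw [wedgeOne_apply]
  rfl

/-- Left exterior multiplication by a covector, as a linear map. -/
def wedgeCovL {n : ℕ} (k : ℕ) (θ : Cov n) : Alt n k →ₗ[ℂ] Alt n (k + 1) where
  toFun := wedgeCov θ
  map_add' x y := by
    ext v
    simp [wedgeCov_apply, mul_add, Finset.sum_add_distrib]
  map_smul' c x := by
    ext v
    simp only [wedgeCov_apply, ContinuousAlternatingMap.smul_apply, RingHom.id_apply, smul_eq_mul,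
      Finset.mul_sum]
    exact Finset.sum_congr rfl fun i _ => by ring

/-- Linear maps on the exterior algebra are determined by their values on all `ιMulti`, and in the
wrong degrees both sides vanish. Thus the exterior derivative of a function times a constant form
becomes a left multiplication in the algebra. -/
theorem wedgeCov_toAlt {n k : ℕ} (θ : Cov n) (x : Ext n) :
    wedgeCov θ (toAlt n k x) = toAlt n (k + 1) (ExteriorAlgebra.ι ℂ θ * x) := by
  have : (wedgeCovL k θ).comp (toAlt n k) =
      (toAlt n (k + 1)).comp (LinearMap.mulLeft ℂ (ExteriorAlgebra.ι ℂ θ)) := by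
    apply ExteriorAlgebra.lhom_ext
    intro i
    ext1 θ'
    change wedgeCov θ (toAlt n k (ExteriorAlgebra.ιMulti ℂ i θ')) =
      toAlt n (k + 1) (ExteriorAlgebra.ι ℂ θ * ExteriorAlgebra.ιMulti ℂ i θ')
    have h : ExteriorAlgebra.ι ℂ θ * ExteriorAlgebra.ιMulti ℂ i θ' =
        ExteriorAlgebra.ιMulti ℂ (i + 1) (Matrix.vecCons θ θ' : Fin (i + 1) → Cov n) := by
      rw [ExteriorAlgebra.ιMulti_succ_apply]; rfl
    rw [h]
    by_cases hik : i = k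
    · subst hik
      rw [toAlt_ιMulti, toAlt_ιMulti, wedgeCov_wedgeOne]
    · rw [toAlt_ιMulti_of_ne hik, toAlt_ιMulti_of_ne (by omega)]
      exact (wedgeCovL k θ).map_zero
  exact LinearMap.congr_fun this x

/-- The pull back of covectors by a real linear map. -/
def covPull {n : ℕ} (A : Cn n →L[ℝ] Cn n) : Cov n →ₗ[ℂ] Cov n where
  toFun θ := θ.comp A
  map_add' _ _ := rfl
  map_smul' _ _ := rfl

theorem wedgeOne_comp {n k : ℕ} (θ : Fin k → Cov n) (A : Cn n →L[ℝ] Cn n) :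
    (wedgeOne θ).compContinuousLinearMap A = wedgeOne (fun a => (θ a).comp A) := by
  ext v
  rw [ContinuousAlternatingMap.compContinuousLinearMap_apply, wedgeOne_apply, wedgeOne_apply]
  rfl

theorem toAlt_comp {n k : ℕ} (A : Cn n →L[ℝ] Cn n) (x : Ext n) :
    (toAlt n k x).compContinuousLinearMap A = toAlt n k (ExteriorAlgebra.map (covPull A) x) := by
  let L : Alt n k →ₗ[ℂ] Alt n k :=
    { toFun := fun η => η.compContinuousLinearMap A
      map_add' := fun _ _ => rfl
      map_smul' := fun _ _ => rfl }
  have : L.comp (toAlt n k) =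
      (toAlt n k).comp (ExteriorAlgebra.map (covPull A)).toLinearMap := by
    apply ExteriorAlgebra.lhom_ext
    intro i
    ext1 θ
    change (toAlt n k (ExteriorAlgebra.ιMulti ℂ i θ)).compContinuousLinearMap A =
      toAlt n k (ExteriorAlgebra.map (covPull A) (ExteriorAlgebra.ιMulti ℂ i θ))
    rw [ExteriorAlgebra.map_apply_ιMulti]
    by_cases hik : i = k
    · subst hik
      rw [toAlt_ιMulti, toAlt_ιMulti, wedgeOne_comp]
      rfl
    · rw [toAlt_ιMulti_of_ne hik, toAlt_ιMulti_of_ne hik]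
      rfl
  exact LinearMap.congr_fun this x

/-- A complex covector regarded as a real one. -/
abbrev lin {n : ℕ} (α : Cn n →L[ℂ] ℂ) : Cov n := α.restrictScalars ℝ

/-- The conjugate of a complex covector. -/
abbrev antilin {n : ℕ} (α : Cn n →L[ℂ] ℂ) : Cov n :=
  (Complex.conjCLE : ℂ →L[ℝ] ℂ).comp (α.restrictScalars ℝ)

/-- The element `i α ∧ γ̄` of the exterior algebra. -/
def hPair {n : ℕ} (α γ : Cn n →L[ℂ] ℂ) : Ext n :=
  Complex.I • (ExteriorAlgebra.ι ℂ (lin α) * ExteriorAlgebra.ι ℂ (antilin γ))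

theorem antilin_smul {n : ℕ} (c : ℂ) (α : Cn n →L[ℂ] ℂ) :
    antilin (c • α) = (starRingEnd ℂ c) • antilin α := by
  ext v; simp

theorem antilin_add {n : ℕ} (α γ : Cn n →L[ℂ] ℂ) :
    antilin (α + γ) = antilin α + antilin γ := by
  ext v; simp

theorem hPair_add_left {n : ℕ} (α α' γ : Cn n →L[ℂ] ℂ) :
    hPair (α + α') γ = hPair α γ + hPair α' γ := by
  have : lin (α + α') = lin α + lin α' := rfl
  simp only [hPair, this, map_add, add_mul, smul_add]

theorem hPair_add_right {n : ℕ} (α γ γ' : Cn n →L[ℂ] ℂ) :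
    hPair α (γ + γ') = hPair α γ + hPair α γ' := by
  simp only [hPair, antilin_add, map_add, mul_add, smul_add]

theorem hPair_smul_left {n : ℕ} (c : ℂ) (α γ : Cn n →L[ℂ] ℂ) :
    hPair (c • α) γ = c • hPair α γ := by
  have : lin (c • α) = c • lin α := rfl
  simp only [hPair, this, map_smul, smul_mul_assoc]
  rw [smul_comm]

theorem hPair_smul_right {n : ℕ} (c : ℂ) (α γ : Cn n →L[ℂ] ℂ) :
    hPair α (c • γ) = (starRingEnd ℂ c) • hPair α γ := by
  simp only [hPair, antilin_smul, map_smul, mul_smul_comm]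
  rw [smul_comm]

/-- `hPair` as a sesquilinear map. -/
def hPairL (n : ℕ) : (Cn n →L[ℂ] ℂ) →ₗ[ℂ] (Cn n →L[ℂ] ℂ) →ₛₗ[starRingEnd ℂ] Ext n :=
  LinearMap.mk₂'ₛₗ _ _ hPair hPair_add_left hPair_smul_left hPair_add_right hPair_smul_right

theorem mul_comm_of_anticomm {R : Type*} [Ring R] {A B C D : R} (h1 : B * C = -(C * B))
    (h2 : A * C = -(C * A)) (h3 : B * D = -(D * B)) (h4 : A * D = -(D * A)) :
    A * B * (C * D) = C * D * (A * B) := by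
  calc A * B * (C * D) = A * (B * C) * D := by noncomm_ring
    _ = -((A * C) * (B * D)) := by rw [h1]; noncomm_ring
    _ = -(C * (A * D) * B) := by rw [h2, h3]; noncomm_ring
    _ = C * D * (A * B) := by rw [h4]; noncomm_ring

theorem mul_self_of_anticomm {R : Type*} [Ring R] {A B : R} (h1 : A * A = 0)
    (h2 : B * A = -(A * B)) : A * B * (A * B) = 0 := by
  calc A * B * (A * B) = A * (B * A) * B := by noncomm_ring
    _ = -(A * A * B * B) := by rw [h2]; noncomm_ring
    _ = 0 := by rw [h1]; simp

theorem ι_mul_swap {n : ℕ} (x y : Cov n) : ExteriorAlgebra.ι ℂ x * ExteriorAlgebra.ι ℂ y =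
    -(ExteriorAlgebra.ι ℂ y * ExteriorAlgebra.ι ℂ x) :=
  eq_neg_of_add_eq_zero_left (ExteriorAlgebra.ι_add_mul_swap x y)

theorem hPair_comm_mul {n : ℕ} (α γ α' γ' : Cn n →L[ℂ] ℂ) :
    hPair α γ * hPair α' γ' = hPair α' γ' * hPair α γ := by
  rw [hPair, hPair, smul_mul_smul_comm, smul_mul_smul_comm,
    mul_comm_of_anticomm (ι_mul_swap _ _) (ι_mul_swap _ _) (ι_mul_swap _ _) (ι_mul_swap _ _)]

theorem hPair_self_sq {n : ℕ} (α γ : Cn n →L[ℂ] ℂ) : hPair α γ * hPair α γ = 0 := by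
  rw [hPair, smul_mul_smul_comm,
    mul_self_of_anticomm (ExteriorAlgebra.ι_sq_zero _) (ι_mul_swap _ _), smul_zero]

/-- The element `i α ∧ ᾱ` of the exterior algebra. -/
abbrev ePos {n : ℕ} (α : Cn n →L[ℂ] ℂ) : Ext n := hPair α α

/-- The product interleaves the α's and the conjugates of the γ's in the order used by `strongGen`;
only the m factors `I` have to be collected. -/
theorem prod_hPair {n m : ℕ} (α γ : Fin m → (Cn n →L[ℂ] ℂ)) :
    toAlt n (2 * m) (List.ofFn fun a => hPair (α a) (γ a)).prod =
      Complex.I ^ m • wedgeOne (fun b : Fin (2 * m) =>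
        if (b : ℕ) % 2 = 0 then lin (α ⟨(b : ℕ) / 2, by have := b.2; omega⟩)
        else antilin (γ ⟨(b : ℕ) / 2, by have := b.2; omega⟩)) := by
  rw [← toAlt_ιMulti, ← map_smul, ExteriorAlgebra.ιMulti_apply, List.ofFn_mul',
    List.prod_flatten]
  congr 1
  have h : ∀ (k : ℕ) (f g : Fin k → Ext n), (∀ i, f i = Complex.I • g i) →
      (List.ofFn f).prod = Complex.I ^ k • (List.ofFn g).prod := by
    intro k
    induction k with
    | zero => intro f g _; simp
    | succ k ih =>
      intro f g hfg
      rw [List.ofFn_succ, List.ofFn_succ, List.prod_cons, List.prod_cons, hfg,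
        ih _ (fun i => g i.succ) (fun i => hfg _), smul_mul_smul_comm, pow_succ']
  rw [List.map_ofFn]
  refine h m _ _ fun i => ?_
  have h1 : (2 * (i : ℕ) + 1) / 2 = i := by omega
  have h2 : (2 * (i : ℕ) + 1) % 2 = 1 := by omega
  simp [List.ofFn_succ, hPair, h1]

theorem prod_ePos {n m : ℕ} (α : Fin m → (Cn n →L[ℂ] ℂ)) :
    toAlt n (2 * m) (List.ofFn fun a => ePos (α a)).prod = strongGen α :=
  prod_hPair α α

/-! ### Powers of two-forms -/

theorem pairIdx_eq_iff {m : ℕ} (a b : Fin m) (s t : Fin 2) :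
    pairIdx a s = pairIdx b t ↔ a = b ∧ s = t := by
  constructor
  · intro h
    have h1 := congrArg Fin.val h
    have := s.2; have := t.2
    simp only [pairIdx] at h1
    exact ⟨Fin.ext (by omega), Fin.ext (by omega)⟩
  · rintro ⟨rfl, rfl⟩; rfl

/-- Exchanging the two places of a pair changes the sign of the permutation, so the two terms of
each antisymmetrised factor contribute equally after alternation: a factor 2 for each pair. -/
theorem alternate_antisymm {n m : ℕ} (B : Cn n → Cn n → ℂ) (v : Fin (2 * m) → Cn n) :
    ∑ σ : Equiv.Perm (Fin (2 * m)), Equiv.Perm.sign σ •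
      ∏ a : Fin m, (B (v (σ (pairIdx a 0))) (v (σ (pairIdx a 1))) -
        B (v (σ (pairIdx a 1))) (v (σ (pairIdx a 0)))) =
    (2 : ℂ) ^ m * ∑ σ : Equiv.Perm (Fin (2 * m)), Equiv.Perm.sign σ •
      ∏ a : Fin m, B (v (σ (pairIdx a 0))) (v (σ (pairIdx a 1))) := by
  -- Induction on the set `S` of the pairs that are already antisymmetrised; composing σ with the
  -- transposition of the pair `c` shows that adding `c` doubles the sum.
  have main : ∀ S : Finset (Fin m),
      ∑ σ : Equiv.Perm (Fin (2 * m)), Equiv.Perm.sign σ •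
      ∏ a : Fin m, (B (v (σ (pairIdx a 0))) (v (σ (pairIdx a 1))) -
        if a ∈ S then B (v (σ (pairIdx a 1))) (v (σ (pairIdx a 0))) else 0) =
    (2 : ℂ) ^ S.card * ∑ σ : Equiv.Perm (Fin (2 * m)), Equiv.Perm.sign σ •
      ∏ a : Fin m, B (v (σ (pairIdx a 0))) (v (σ (pairIdx a 1))) := by
    intro S
    induction S using Finset.induction_on with
    | empty => simp
    | insert c S hc ih =>
      rw [Finset.card_insert_of_notMem hc, pow_succ, mul_comm _ (2 : ℂ), mul_assoc, ← ih]
      let F : Equiv.Perm (Fin (2 * m)) → Fin m → ℂ := fun σ a =>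
        B (v (σ (pairIdx a 0))) (v (σ (pairIdx a 1))) -
          if a ∈ S then B (v (σ (pairIdx a 1))) (v (σ (pairIdx a 0))) else 0
      let τ : Equiv.Perm (Fin (2 * m)) := Equiv.swap (pairIdx c 0) (pairIdx c 1)
      have hne : (pairIdx c 0 : Fin (2 * m)) ≠ pairIdx c 1 := by
        rw [Ne, pairIdx_eq_iff]; simp
      have hτ0 : τ (pairIdx c 0) = pairIdx c 1 := Equiv.swap_apply_left _ _
      have hτ1 : τ (pairIdx c 1) = pairIdx c 0 := Equiv.swap_apply_right _ _
      have hτ : ∀ a, a ≠ c → ∀ s, τ (pairIdx a s) = pairIdx a s := by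
        intro a ha s
        apply Equiv.swap_apply_of_ne_of_ne <;> rw [Ne, pairIdx_eq_iff] <;> tauto
      have hsplit : ∀ σ : Equiv.Perm (Fin (2 * m)),
          ∏ a : Fin m, (B (v (σ (pairIdx a 0))) (v (σ (pairIdx a 1))) -
            if a ∈ insert c S then B (v (σ (pairIdx a 1))) (v (σ (pairIdx a 0))) else 0) =
          ∏ a, F σ a - ∏ a, F (σ * τ) a := by
        intro σ
        rw [← Finset.mul_prod_erase Finset.univ _ (Finset.mem_univ c),
          ← Finset.mul_prod_erase Finset.univ (F σ) (Finset.mem_univ c),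
          ← Finset.mul_prod_erase Finset.univ (F (σ * τ)) (Finset.mem_univ c)]
        have e1 : ∏ a ∈ Finset.univ.erase c, (B (v (σ (pairIdx a 0))) (v (σ (pairIdx a 1))) -
            if a ∈ insert c S then B (v (σ (pairIdx a 1))) (v (σ (pairIdx a 0))) else 0) =
            ∏ a ∈ Finset.univ.erase c, F σ a := by
          refine Finset.prod_congr rfl fun a ha => ?_
          have hac := (Finset.mem_erase.1 ha).1
          simp [F, Finset.mem_insert, hac]
        have e2 : ∏ a ∈ Finset.univ.erase c, F (σ * τ) a =
            ∏ a ∈ Finset.univ.erase c, F σ a := by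
          refine Finset.prod_congr rfl fun a ha => ?_
          have hac := (Finset.mem_erase.1 ha).1
          simp [F, hτ a hac]
        rw [e1, e2, ← sub_mul]
        congr 1
        simp [F, hc, hτ0, hτ1]
      simp only [hsplit, smul_sub, Finset.sum_sub_distrib]
      have hre : ∑ σ : Equiv.Perm (Fin (2 * m)), Equiv.Perm.sign σ • ∏ a, F (σ * τ) a =
          -∑ σ : Equiv.Perm (Fin (2 * m)), Equiv.Perm.sign σ • ∏ a, F σ a := by
        rw [← Equiv.sum_comp (Equiv.mulRight τ) (fun σ : Equiv.Perm (Fin (2 * m)) =>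
          Equiv.Perm.sign σ • ∏ a, F σ a), ← Finset.sum_neg_distrib]
        refine Finset.sum_congr rfl fun σ _ => ?_
        simp [τ, Equiv.Perm.sign_swap hne]
      exact (congrArg (_ - ·) hre).trans 
        ((sub_neg_eq_add _ _).trans (two_mul _).symm)
  have := main Finset.univ
  simpa using this

/-- The normalisation 2⁻ᵐ of `wedgePow` is cancelled by the antisymmetrisation of the m factors. -/
theorem wedgePow_eq_sum {n : ℕ} (κ : Alt n 2) (B : Cn n → Cn n → ℂ)
    (h : ∀ v : Fin 2 → Cn n, κ v = B (v 0) (v 1) - B (v 1) (v 0)) (m : ℕ)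
    (v : Fin (2 * m) → Cn n) :
    wedgePow κ m v = ∑ σ : Equiv.Perm (Fin (2 * m)), Equiv.Perm.sign σ •
      ∏ a : Fin m, B (v (σ (pairIdx a 0))) (v (σ (pairIdx a 1))) := by
  rw [wedgePow, ContinuousAlternatingMap.smul_apply,
    ContinuousMultilinearMap.alternatization_apply_apply]
  have h1 : ∀ σ : Equiv.Perm (Fin (2 * m)), pairProd κ m (v ∘ σ) =
      ∏ a : Fin m, (B (v (σ (pairIdx a 0))) (v (σ (pairIdx a 1))) -
        B (v (σ (pairIdx a 1))) (v (σ (pairIdx a 0)))) := by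
    intro σ
    change ∏ a : Fin m, κ (fun s => (v ∘ σ) (pairIdx a s)) = _
    exact Finset.prod_congr rfl fun a _ => h _
  simp only [h1, alternate_antisymm, smul_eq_mul]
  rw [← mul_assoc, inv_mul_cancel₀ (pow_ne_zero _ two_ne_zero), one_mul]

theorem toAlt_two_apply {n : ℕ} (α γ : Cn n →L[ℂ] ℂ) (v : Fin 2 → Cn n) :
    toAlt n 2 (hPair α γ) v = Complex.I * (α (v 0) * starRingEnd ℂ (γ (v 1))) -
      Complex.I * (α (v 1) * starRingEnd ℂ (γ (v 0))) := by
  have h := prod_hPair (m := 1) (fun _ => α) (fun _ => γ)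
  simp only [List.ofFn_succ, List.ofFn_zero, List.prod_cons, List.prod_nil, mul_one] at h
  rw [h, ContinuousAlternatingMap.smul_apply, wedgeOne_apply]
  have h3 : ∀ M : Matrix (Fin (2 * 1)) (Fin (2 * 1)) ℂ,
      Matrix.detRowAlternating M = M 0 0 * M 1 1 - M 0 1 * M 1 0 := fun M => Matrix.det_fin_two M
  refine (congrArg (Complex.I ^ 1 • ·) (h3 _)).trans ?_
  simp
  ring

/-- Both sides expand over the maps `L : Fin m → Fin N` and over the permutations, and they agree
term by term. This carries the powers of (1,1)-forms over to ring powers in the exterior algebra. -/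
theorem wedgePow_toAlt {n N : ℕ} (c : Fin N → ℂ) (α γ : Fin N → (Cn n →L[ℂ] ℂ)) (m : ℕ) :
    wedgePow (toAlt n 2 (∑ l, c l • hPair (α l) (γ l))) m =
      toAlt n (2 * m) ((∑ l, c l • hPair (α l) (γ l)) ^ m) := by
  have hpow : (∑ l, c l • hPair (α l) (γ l)) ^ m =
      ∑ L : Fin m → Fin N, (∏ a, c (L a)) •
        (List.ofFn fun a => hPair (α (L a)) (γ (L a))).prod := by
    rw [← MultilinearMap.mkPiAlgebraFin_apply_const (R := ℂ), MultilinearMap.map_sum]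
    refine Finset.sum_congr rfl fun L _ => ?_
    rw [MultilinearMap.map_smul_univ, MultilinearMap.mkPiAlgebraFin_apply]
  rw [hpow]
  conv_rhs => rw [map_sum]
  ext v
  rw [wedgePow_eq_sum _ (fun x y => ∑ l, c l * (Complex.I * (α l x * starRingEnd ℂ (γ l y)))),
    ContinuousAlternatingMap.sum_apply]
  · simp only [map_smul, prod_hPair, ContinuousAlternatingMap.smul_apply, smul_eq_mul]
    simp only [wedgeOne, ContinuousMultilinearMap.alternatization_apply_apply]
    simp only [Finset.prod_univ_sum, Finset.smul_sum, Fintype.piFinset_univ, Finset.mul_sum]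
    rw [Finset.sum_comm]
    refine Finset.sum_congr rfl fun L _ => Finset.sum_congr rfl fun σ _ => ?_
    rw [mul_smul_comm, mul_smul_comm]
    congr 1
    rw [Finset.prod_mul_distrib, Finset.prod_mul_distrib, Finset.prod_const, Finset.card_univ,
      Fintype.card_fin]
    congr 2
    simp only [ContinuousMultilinearMap.compContinuousLinearMap_apply,
      ContinuousMultilinearMap.mkPiAlgebra_apply]
    -- The bijection (a, s) ↦ 2a + s from `Fin m × Fin 2` regroups the 2m factors in pairs.
    have e := Equiv.prod_comp (finProdFinEquiv.trans (finCongr (mul_comm m 2)))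
      (fun b : Fin (2 * m) => (if (b : ℕ) % 2 = 0 then
          lin (α (L ⟨(b : ℕ) / 2, by have := b.2; omega⟩))
        else antilin (γ (L ⟨(b : ℕ) / 2, by have := b.2; omega⟩))) ((v ∘ σ) b))
    rw [← e, Fintype.prod_prod_type]
    refine Finset.prod_congr rfl fun a _ => ?_
    rw [Fin.prod_univ_two]
    have i0 : (finProdFinEquiv.trans (finCongr (mul_comm m 2))) (a, 0) = pairIdx a 0 := by
      apply Fin.ext; simp [pairIdx, finProdFinEquiv]
    have i1 : (finProdFinEquiv.trans (finCongr (mul_comm m 2))) (a, 1) = pairIdx a 1 := by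
      apply Fin.ext; simp [pairIdx, finProdFinEquiv]; omega
    rw [i0, i1]
    have h1 : (2 * (a : ℕ) + 1) / 2 = a := by omega
    have h2 : (2 * (a : ℕ) + 1) % 2 = 1 := by omega
    simp [pairIdx, h1, h2]
  · intro w
    simp only [map_sum, map_smul, ContinuousAlternatingMap.sum_apply,
      ContinuousAlternatingMap.smul_apply, toAlt_two_apply, smul_eq_mul, mul_sub,
      Finset.sum_sub_distrib]



/-! ### The cone of strongly positive elements -/

/-- The convex cone generated by the `i α ∧ ᾱ`. -/
def posCone (n : ℕ) : Submodule ℝ≥0 (Ext n) := Submodule.span ℝ≥0 (range (ePos (n := n)))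

theorem smul_mem_cone {n : ℕ} {M : Submodule ℝ≥0 (Ext n)} {x : Ext n} (hx : x ∈ M) {c : ℝ}
    (hc : 0 ≤ c) : (c : ℂ) • x ∈ M := by
  exact M.smul_mem ⟨c, hc⟩ hx

theorem ePos_mem {n : ℕ} (α : Cn n →L[ℂ] ℂ) : ePos α ∈ posCone n :=
  Submodule.subset_span ⟨α, rfl⟩

/-- A power of a span is the span of the products of generators, and `prod_ePos` identifies these
products with `strongGen`. Products and sums of positive (1,1)-elements are thereby seen to be
strongly positive without further computation. -/
theorem stronglyPositive_of_mem {n m : ℕ} {y : Ext n} (hy : y ∈ posCone n ^ m) :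
    StronglyPositive (toAlt n (2 * m) y) := by
  rw [posCone, Submodule.span_pow] at hy
  obtain ⟨N, c, g, rfl⟩ := Submodule.mem_span_set'.1 hy
  have hg : ∀ l, ∃ α : Fin m → (Cn n →L[ℂ] ℂ), (List.ofFn fun a => ePos (α a)).prod = (g l : Ext n) := by
    intro l
    obtain ⟨f, hf⟩ := Set.mem_pow.1 (g l).2
    choose α hα using fun i => (f i).2
    exact ⟨α, by simp only [hα, hf]⟩
  choose α hα using hg
  refine ⟨N, fun l => c l, α, fun l => (c l).2, ?_⟩
  rw [map_sum]
  refine Finset.sum_congr rfl fun l _ => ?_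
  rw [← prod_ePos, hα]
  exact (toAlt n (2 * m)).map_smul ((c l : ℝ) : ℂ) (g l : Ext n)

theorem StronglyPositive.add {n m : ℕ} {η ξ : Alt n (2 * m)} (h : StronglyPositive η)
    (h' : StronglyPositive ξ) : StronglyPositive (η + ξ) := by
  obtain ⟨N, c, α, hc, rfl⟩ := h
  obtain ⟨N', c', α', hc', rfl⟩ := h'
  refine ⟨N + N', Fin.addCases c c', Fin.addCases α α', ?_, ?_⟩
  · intro l
    induction l using Fin.addCases <;> simp [hc, hc']
  · simp [Fin.sum_univ_add]

theorem StronglyPositive.smul {n m : ℕ} {η : Alt n (2 * m)} (h : StronglyPositive η) {c : ℝ}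
    (hc : 0 ≤ c) : StronglyPositive ((c : ℂ) • η) := by
  obtain ⟨N, d, α, hd, rfl⟩ := h
  refine ⟨N, fun l => c * d l, α, fun l => mul_nonneg hc (hd l), ?_⟩
  rw [Finset.smul_sum]
  exact Finset.sum_congr rfl fun l _ => by rw [smul_smul, Complex.ofReal_mul]

theorem StronglyPositive.zero {n m : ℕ} : StronglyPositive (0 : Alt n (2 * m)) :=
  ⟨0, fun _ => 0, fun _ _ => 0, fun _ => le_rfl, by simp⟩

theorem StronglyPositive.sum {n m : ℕ} {ι : Type*} (s : Finset ι) {η : ι → Alt n (2 * m)}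
    (h : ∀ i ∈ s, StronglyPositive (η i)) : StronglyPositive (∑ i ∈ s, η i) :=
  Finset.sum_induction _ _ (fun _ _ => StronglyPositive.add) StronglyPositive.zero h

theorem strongGen_comp {n m : ℕ} (α : Fin m → (Cn n →L[ℂ] ℂ)) (A : Cn n →L[ℂ] Cn n) :
    (strongGen α).compContinuousLinearMap (A.restrictScalars ℝ) =
      strongGen (fun a => (α a).comp A) := by
  rw [strongGen, strongGen]
  have : ∀ (c : ℂ) (η : Alt n (2 * m)), (c • η).compContinuousLinearMap (A.restrictScalars ℝ) =
    c • η.compContinuousLinearMap (A.restrictScalars ℝ) := fun _ _ => rfl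
  rw [this, wedgeOne_comp]
  congr 2
  funext b
  by_cases hb : (b : ℕ) % 2 = 0
  · simp only [hb, if_true]; rfl
  · simp only [hb, if_false]; rfl

theorem StronglyPositive.comp {n m : ℕ} {η : Alt n (2 * m)} (h : StronglyPositive η)
    (A : Cn n →L[ℂ] Cn n) :
    StronglyPositive (η.compContinuousLinearMap (A.restrictScalars ℝ)) := by
  obtain ⟨N, d, α, hd, rfl⟩ := h
  refine ⟨N, d, fun l a => (α l a).comp A, hd, ?_⟩
  let L : Alt n (2 * m) →ₗ[ℂ] Alt n (2 * m) :=
    { toFun := fun η => η.compContinuousLinearMap (A.restrictScalars ℝ)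
      map_add' := fun _ _ => rfl
      map_smul' := fun _ _ => rfl }
  change L _ = _
  rw [map_sum]
  refine Finset.sum_congr rfl fun l _ => ?_
  rw [map_smul, ← strongGen_comp]
  rfl

/-! ### Elementary positivity -/

/-- The coordinate covectors. -/
abbrev dz {n : ℕ} (j : Fin n) : Cn n →L[ℂ] ℂ := EuclideanSpace.proj j

/-- The element `∑ i dz_j ∧ dz̄_j`. -/
def bExt (n : ℕ) : Ext n := ∑ j, ePos (dz (n := n) j)

/-- The covector `⟨z, ·⟩ = ∑ z̄_j dz_j`. -/
abbrev ell {n : ℕ} (z : Cn n) : Cn n →L[ℂ] ℂ := innerSL ℂ z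

theorem ell_eq {n : ℕ} (z : Cn n) : ell z = ∑ j, (starRingEnd ℂ (z j)) • dz j := by
  ext v
  simp [PiLp.inner_apply, mul_comm]

theorem hPair_sum {n : ℕ} {ι : Type*} (s : Finset ι) (c d : ι → ℂ)
    (l l' : ι → (Cn n →L[ℂ] ℂ)) :
    hPair (∑ j ∈ s, c j • l j) (∑ k ∈ s, d k • l' k) =
      ∑ j ∈ s, ∑ k ∈ s, (c j * starRingEnd ℂ (d k)) • hPair (l j) (l' k) := by
  change hPairL n _ _ = _
  rw [map_sum (hPairL n), LinearMap.sum_apply]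
  refine Finset.sum_congr rfl fun j _ => ?_
  rw [map_sum]
  refine Finset.sum_congr rfl fun k _ => ?_
  change hPair _ _ = _
  rw [hPair_smul_left, hPair_smul_right, smul_smul]

/-- The Cauchy–Schwarz inequality for `(1, 1)`-forms. -/
theorem cauchySchwarz_mem {n : ℕ} {ι : Type*} (s : Finset ι) (c : ι → ℂ)
    (l : ι → (Cn n →L[ℂ] ℂ)) :
    ((∑ k ∈ s, ‖c k‖ ^ 2 : ℝ) : ℂ) • (∑ k ∈ s, ePos (l k)) -
      ePos (∑ k ∈ s, starRingEnd ℂ (c k) • l k) ∈ posCone n := by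
  -- Lagrange's identity: the defect in the Cauchy–Schwarz inequality is half the sum of the squares
  -- of all the 2 × 2 minors.
  have key : ((∑ k ∈ s, ‖c k‖ ^ 2 : ℝ) : ℂ) • (∑ k ∈ s, ePos (l k)) -
      ePos (∑ k ∈ s, starRingEnd ℂ (c k) • l k) =
      ((1 / 2 : ℝ) : ℂ) • ∑ j ∈ s, ∑ k ∈ s, ePos (c j • l k - c k • l j) := by
    have h1 : ∀ j k, ePos (c j • l k - c k • l j) =
        ((‖c j‖ ^ 2 : ℝ) : ℂ) • ePos (l k) + ((‖c k‖ ^ 2 : ℝ) : ℂ) • ePos (l j) -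
        (c j * starRingEnd ℂ (c k)) • hPair (l k) (l j) -
        (c k * starRingEnd ℂ (c j)) • hPair (l j) (l k) := by
      intro j k
      have e0 : c j • l k - c k • l j = c j • l k + (-c k) • l j := by module
      rw [e0, ePos, hPair_add_left, hPair_add_right, hPair_add_right]
      simp only [hPair_smul_left, hPair_smul_right, smul_smul, map_neg]
      have e : ∀ z : ℂ, ((‖z‖ ^ 2 : ℝ) : ℂ) = z * starRingEnd ℂ z := by
        intro z; rw [Complex.mul_conj, Complex.normSq_eq_norm_sq]
      rw [e, e]
      module
    simp only [h1, Finset.sum_sub_distrib, Finset.sum_add_distrib]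
    rw [ePos, hPair_sum]
    have h2 : ∑ j ∈ s, ∑ k ∈ s, ((‖c j‖ ^ 2 : ℝ) : ℂ) • ePos (l k) =
        ((∑ k ∈ s, ‖c k‖ ^ 2 : ℝ) : ℂ) • (∑ k ∈ s, ePos (l k)) := by
      rw [Complex.ofReal_sum, Finset.sum_smul]
      exact Finset.sum_congr rfl fun j _ => (Finset.smul_sum).symm
    have h3 : ∑ j ∈ s, ∑ k ∈ s, ((‖c k‖ ^ 2 : ℝ) : ℂ) • ePos (l j) =
        ((∑ k ∈ s, ‖c k‖ ^ 2 : ℝ) : ℂ) • (∑ k ∈ s, ePos (l k)) := by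
      rw [Finset.sum_comm, h2]
    have h4 : ∑ j ∈ s, ∑ k ∈ s, (c j * starRingEnd ℂ (c k)) • hPair (l k) (l j) =
        ∑ j ∈ s, ∑ k ∈ s, (starRingEnd ℂ (c j) * starRingEnd ℂ (starRingEnd ℂ (c k))) •
          hPair (l j) (l k) := by
      rw [Finset.sum_comm]
      refine Finset.sum_congr rfl fun j _ => Finset.sum_congr rfl fun k _ => ?_
      rw [Complex.conj_conj, mul_comm]
    have h5 : ∑ j ∈ s, ∑ k ∈ s, (c k * starRingEnd ℂ (c j)) • hPair (l j) (l k) =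
        ∑ j ∈ s, ∑ k ∈ s, (starRingEnd ℂ (c j) * starRingEnd ℂ (starRingEnd ℂ (c k))) •
          hPair (l j) (l k) := by
      refine Finset.sum_congr rfl fun j _ => Finset.sum_congr rfl fun k _ => ?_
      rw [Complex.conj_conj, mul_comm]
    rw [h2, h3, h4, h5]
    push_cast
    module
  rw [key]
  exact smul_mem_cone (Submodule.sum_mem _ fun j _ => Submodule.sum_mem _ fun k _ => ePos_mem _)
    (by norm_num)

/-- The Cauchy–Schwarz inequality for the coordinate covectors. It is the source of the positivity
of dd^c log |z|² and of the forms u^{-k} β^p - k u^{-k-1} G. -/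
theorem norm_sq_smul_bExt_sub_mem {n : ℕ} (z : Cn n) :
    ((‖z‖ ^ 2 : ℝ) : ℂ) • bExt n - ePos (ell z) ∈ posCone n := by
  have := cauchySchwarz_mem Finset.univ (fun k => z k) (fun k => dz (n := n) k)
  rwa [← ell_eq, ← EuclideanSpace.norm_sq_eq] at this

theorem bExt_mem (n : ℕ) : bExt n ∈ posCone n := Submodule.sum_mem _ fun _ _ => ePos_mem _

/-- Telescoping: f₀F - g₀G = f₀(F - G) + (f₀ - g₀)G, where f₀ = (f₀ - g₀) + g₀ lies in the cone. -/
theorem prod_sub_prod_mem {n : ℕ} : ∀ (m : ℕ) (f g : Fin m → Ext n),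
    (∀ i, g i ∈ posCone n) → (∀ i, f i - g i ∈ posCone n) →
      (List.ofFn f).prod - (List.ofFn g).prod ∈ posCone n ^ m := by
  intro m
  induction m with
  | zero => intro f g _ _; simp
  | succ m ih =>
    intro f g hg hfg
    have hgm : ∀ k (g : Fin k → Ext n), (∀ i, g i ∈ posCone n) →
        (List.ofFn g).prod ∈ posCone n ^ k := by
      intro k
      induction k with
      | zero => intro g _; simpa using ⟨1, map_one _⟩
      | succ k ihk =>
        intro g hg
        rw [List.ofFn_succ, List.prod_cons, pow_succ']
        exact Submodule.mul_mem_mul (hg 0) (ihk _ fun i => hg _)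
    rw [List.ofFn_succ, List.ofFn_succ, List.prod_cons, List.prod_cons, pow_succ']
    have e : f 0 * (List.ofFn fun i => f i.succ).prod - g 0 * (List.ofFn fun i => g i.succ).prod =
        f 0 * ((List.ofFn fun i => f i.succ).prod - (List.ofFn fun i => g i.succ).prod) +
        (f 0 - g 0) * (List.ofFn fun i => g i.succ).prod := by
      rw [mul_sub, sub_mul]; abel
    rw [e]
    refine Submodule.add_mem _ (Submodule.mul_mem_mul ?_ (ih _ _ (fun i => hg _) fun i => hfg _))
      (Submodule.mul_mem_mul (hfg 0) (hgm _ _ fun i => hg _))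
    simpa using Submodule.add_mem _ (hfg 0) (hg 0)

/-- A power of a `(1, 1)`-form that is bounded below dominates the generators of the cone. -/
theorem pow_dominates {n m : ℕ} {x : Ext n} {c : ℝ} (hc : 0 < c)
    (hx : x - (c : ℂ) • bExt n ∈ posCone n) (z : Fin m → Cn n) :
    ((∏ a, (‖z a‖ ^ 2 / c) : ℝ) : ℂ) • x ^ m - (List.ofFn fun a => ePos (ell (z a))).prod ∈
      posCone n ^ m := by
  have h1 : ((∏ a, (‖z a‖ ^ 2 / c) : ℝ) : ℂ) • x ^ m =
      (List.ofFn fun a => ((‖z a‖ ^ 2 / c : ℝ) : ℂ) • x).prod := by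
    rw [← MultilinearMap.mkPiAlgebraFin_apply (R := ℂ), MultilinearMap.map_smul_univ,
      MultilinearMap.mkPiAlgebraFin_apply_const, Complex.ofReal_prod]
  rw [h1]
  refine prod_sub_prod_mem m _ _ (fun _ => ePos_mem _) fun a => ?_
  -- One factor at a time: a multiple of x dominates ‖z a‖² `bExt`, which dominates `ePos (ell (z
  -- a))` by Cauchy–Schwarz.
  have h2 := smul_mem_cone hx (c := ‖z a‖ ^ 2 / c) (by positivity)
  have h3 := norm_sq_smul_bExt_sub_mem (z a)
  have h4 := Submodule.add_mem _ h2 h3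
  have e : ((‖z a‖ ^ 2 / c : ℝ) : ℂ) • (x - (c : ℂ) • bExt n) + (((‖z a‖ ^ 2 : ℝ) : ℂ) • bExt n -
      ePos (ell (z a))) = ((‖z a‖ ^ 2 / c : ℝ) : ℂ) • x - ePos (ell (z a)) := by
    rw [smul_sub, smul_smul, ← Complex.ofReal_mul, div_mul_cancel₀ _ hc.ne']
    abel
  rwa [e] at h4

theorem bExt_commute {n : ℕ} (α : Cn n →L[ℂ] ℂ) : Commute (bExt n) (ePos α) := by
  refine (Commute.sum_left _ _ _ fun j _ => ?_)
  exact hPair_comm_mul _ _ _ _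

/-- The binomial formula for a perturbation of square zero. -/
theorem pow_sub_of_sq_zero {A : Type*} [Ring A] [Algebra ℂ A] {b g : A} (hbg : Commute b g)
    (hg : g * g = 0) (x y : ℂ) (q : ℕ) :
    (x • b - y • g) ^ (q + 1) =
      x ^ (q + 1) • b ^ (q + 1) - (((q + 1 : ℕ) : ℂ) * x ^ q * y) • (g * b ^ q) := by
  induction q with
  | zero => simp
  | succ q ih =>
    have h1 : b ^ (q + 1) * g = g * b ^ (q + 1) := hbg.pow_left _
    have h2 : g * b ^ q * g = 0 := by
      rw [mul_assoc, (hbg.pow_left q : b ^ q * g = g * b ^ q), ← mul_assoc, hg, zero_mul]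
    rw [pow_succ, ih, sub_mul, mul_sub, mul_sub]
    simp only [smul_mul_smul_comm, h1, h2, ← pow_succ, mul_assoc]
    push_cast
    module



/-! ### The operator `dd^c` on functions of `|z|²` with values in constant forms -/

theorem lin_comp_cplxJ {n : ℕ} (α : Cn n →L[ℂ] ℂ) :
    (lin α).comp (cplxJ n) = Complex.I • lin α := by
  ext v; simp [cplxJ]

theorem antilin_comp_cplxJ {n : ℕ} (α : Cn n →L[ℂ] ℂ) :
    (antilin α).comp (cplxJ n) = (-Complex.I) • antilin α := by
  ext v; simp [cplxJ]

theorem map_covPull_hPair {n : ℕ} (A : Cn n →L[ℂ] Cn n) (α γ : Cn n →L[ℂ] ℂ) :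
    ExteriorAlgebra.map (covPull (A.restrictScalars ℝ)) (hPair α γ) =
      hPair (α.comp A) (γ.comp A) := by
  rw [hPair, map_smul, map_mul, ExteriorAlgebra.map_apply_ι, ExteriorAlgebra.map_apply_ι]
  rfl

theorem map_cplxJ_hPair {n : ℕ} (α γ : Cn n →L[ℂ] ℂ) :
    ExteriorAlgebra.map (covPull (cplxJ n)) (hPair α γ) = hPair α γ := by
  rw [cplxJ, map_covPull_hPair]
  have h : ∀ α : Cn n →L[ℂ] ℂ, α.comp (Complex.I • ContinuousLinearMap.id ℂ (Cn n)) =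
      Complex.I • α := fun α => by ext v; simp
  rw [h, h, hPair_smul_left, hPair_smul_right, smul_smul]
  simp

/-- The differential of `|z|²`, as a linear function of `z`. -/
def normSqD (n : ℕ) : Cn n →L[ℝ] Cov n :=
  (2 : ℝ) • (ContinuousLinearMap.compL ℝ (Cn n) ℝ ℂ Complex.ofRealCLM).comp (innerSL ℝ)

theorem normSqD_apply {n : ℕ} (z v : Cn n) :
    normSqD n z v = ∑ j, (starRingEnd ℂ (z j) * v j + z j * starRingEnd ℂ (v j)) := by
  have h : normSqD n z v = 2 * ((inner ℝ z v : ℝ) : ℂ) := by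
    simp [normSqD]
  rw [h, PiLp.inner_apply, Complex.ofReal_sum, Finset.mul_sum]
  refine Finset.sum_congr rfl fun j _ => ?_
  have := Complex.add_conj (starRingEnd ℂ (z j) * v j)
  rw [map_mul, Complex.conj_conj] at this
  rw [this, Complex.inner, mul_comm (v j)]
  push_cast
  rfl

theorem normSqD_eq {n : ℕ} (z : Cn n) : normSqD n z = lin (ell z) + antilin (ell z) := by
  ext v
  rw [normSqD_apply, ell_eq]
  simp [Finset.sum_add_distrib]

theorem normSqD_eq_sum {n : ℕ} : normSqD n = ∑ j : Fin n,
    ((antilin (dz j)).smulRight (lin (dz j)) + (lin (dz j)).smulRight (antilin (dz j))) := by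
  ext z v
  rw [normSqD_apply]
  simp

/-- The map `θ ↦ (θ ∘ J) ∧ c`. -/
def wedgeJ {n k : ℕ} (c : Alt n k) : Cov n →ₗ[ℂ] Alt n (k + 1) where
  toFun θ := wedgeCov (θ.comp (cplxJ n)) c
  map_add' x y := by
    ext v
    simp [wedgeCov_apply, mul_add, add_mul, Finset.sum_add_distrib]
  map_smul' a x := by
    ext v
    simp only [wedgeCov_apply, ContinuousAlternatingMap.smul_apply, RingHom.id_apply, smul_eq_mul,
      Finset.mul_sum]
    exact Finset.sum_congr rfl fun i _ => by simp; ring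

/-- As J^* fixes X, J^*(dF ∧ X) = (dF ∘ J) ∧ X, so the outer derivative sees only the derivative of
dF. The hypotheses are local because F may be singular elsewhere, as log |z|² is at 0. -/
theorem ddcForm_smul_const {n k : ℕ} {F : Cn n → ℂ} {D : Cn n → Cov n} {D2 : Cn n →L[ℝ] Cov n}
    {x : Cn n} (h1 : ∀ᶠ y in 𝓝 x, HasFDerivAt F (D y) y) (h2 : HasFDerivAt D D2 x) (X : Ext n)
    (hX : ExteriorAlgebra.map (covPull (cplxJ n)) X = X) :
    ddcForm (fun z => F z • toAlt n k X) x = ((-(1 / (4 * Real.pi)) : ℝ) : ℂ) •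
      ContinuousAlternatingMap.alternatizeUncurryFin
        ((LinearMap.toContinuousLinearMap ((wedgeJ (toAlt n k X)).restrictScalars ℝ)).comp D2) := by
  rw [ddcForm]
  congr 1
  have e : (fun y => pullJ (extDeriv (fun z => F z • toAlt n k X) y)) =ᶠ[𝓝 x]
      fun y => LinearMap.toContinuousLinearMap ((wedgeJ (toAlt n k X)).restrictScalars ℝ) (D y) := by
    filter_upwards [h1] with y hy
    have h3 : extDeriv (fun z => F z • toAlt n k X) y = wedgeCov (D y) (toAlt n k X) := by
      rw [extDeriv, (hy.smul_const (toAlt n k X)).fderiv]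
      rfl
    rw [h3, wedgeCov_toAlt]
    change (toAlt n (k + 1) _).compContinuousLinearMap (cplxJ n) = wedgeCov ((D y).comp (cplxJ n)) _
    rw [toAlt_comp, map_mul, hX, wedgeCov_toAlt, ExteriorAlgebra.map_apply_ι]
    rfl
  rw [e.extDeriv_eq, extDeriv]
  congr 1
  exact ((ContinuousLinearMap.hasFDerivAt _).comp x h2).fderiv

theorem ι_mul_ι_comp_cplxJ {n : ℕ} (α : Cn n →L[ℂ] ℂ) :
    ExteriorAlgebra.ι ℂ (antilin α) * ExteriorAlgebra.ι ℂ ((lin α).comp (cplxJ n)) +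
      ExteriorAlgebra.ι ℂ (lin α) * ExteriorAlgebra.ι ℂ ((antilin α).comp (cplxJ n)) =
    (-2 : ℂ) • ePos α := by
  rw [lin_comp_cplxJ, antilin_comp_cplxJ, map_smul, map_smul, mul_smul_comm, mul_smul_comm,
    ι_mul_swap (antilin α) (lin α), ePos, hPair]
  module

theorem ι_mul_ι_comp_cplxJ_self {n : ℕ} (α : Cn n →L[ℂ] ℂ) :
    ExteriorAlgebra.ι ℂ (lin α + antilin α) *
      ExteriorAlgebra.ι ℂ ((lin α + antilin α).comp (cplxJ n)) = (-2 : ℂ) • ePos α := by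
  rw [← ι_mul_ι_comp_cplxJ, ContinuousLinearMap.add_comp, map_add, map_add, add_mul, mul_add,
    mul_add, lin_comp_cplxJ, antilin_comp_cplxJ, map_smul, map_smul]
  simp only [mul_smul_comm, ExteriorAlgebra.ι_sq_zero, smul_zero]
  abel

-- The second derivative of f(u) is f' D²u + f'' du ⊗ du, with du = `ell x` plus its conjugate.
-- Wedging a real covector α + ᾱ with its composition with J gives -2 i α ∧ ᾱ, and likewise for the
-- polarised Hessian of u; the constant is (-1/4π)(-2) = 1/2π.
set_option synthInstance.maxHeartbeats 200000 in
theorem ddcForm_radial {n k : ℕ} {f f1 : ℝ → ℝ} {f2 : ℝ} {x : Cn n}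
    (h1 : ∀ᶠ t in 𝓝 (‖x‖ ^ 2), HasDerivAt f (f1 t) t) (h2 : HasDerivAt f1 f2 (‖x‖ ^ 2)) (X : Ext n)
    (hX : ExteriorAlgebra.map (covPull (cplxJ n)) X = X) :
    ddcForm (fun z => ((f (‖z‖ ^ 2) : ℝ) : ℂ) • toAlt n k X) x =
      toAlt n (k + 2) (((1 / (2 * Real.pi) : ℝ) : ℂ) •
        ((((f1 (‖x‖ ^ 2) : ℝ) : ℂ) • bExt n + ((f2 : ℝ) : ℂ) • ePos (ell x)) * X)) := by
  have hn : ∀ y : Cn n, HasFDerivAt (fun z : Cn n => ‖z‖ ^ 2) (2 • innerSL ℝ y) y := fun y =>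
    (hasStrictFDerivAt_norm_sq y).hasFDerivAt
  have hD : ∀ᶠ y in 𝓝 x, HasFDerivAt (fun z : Cn n => ((f (‖z‖ ^ 2) : ℝ) : ℂ))
      (f1 (‖y‖ ^ 2) • normSqD n y) y := by
    have hc : ContinuousAt (fun z : Cn n => ‖z‖ ^ 2) x := by fun_prop
    filter_upwards [hc.eventually h1] with y hy
    have := (Complex.ofRealCLM.hasFDerivAt).comp y (hy.comp_hasFDerivAt y (hn y))
    refine this.congr_fderiv ?_
    ext v
    simp [normSqD]
  have hD2 : HasFDerivAt (fun y : Cn n => f1 (‖y‖ ^ 2) • normSqD n y)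
      (f1 (‖x‖ ^ 2) • normSqD n + (f2 • normSqD n x).smulRight (normSqD n x)) x := by
    have := (h2.comp_hasFDerivAt x (hn x)).smul (normSqD n).hasFDerivAt
    refine this.congr_fderiv ?_
    ext v w
    simp [normSqD]
  rw [ddcForm_smul_const hD hD2 X hX]
  set M := LinearMap.toContinuousLinearMap ((wedgeJ (toAlt n k X)).restrictScalars ℝ) with hM
  have hMs : ∀ a b : Cov n, M.comp (a.smulRight b) =
      a.smulRight (wedgeCov (b.comp (cplxJ n)) (toAlt n k X)) := by
    intro a b
    ext1 v
    exact (wedgeJ (toAlt n k X)).map_smul (a v) b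
  have hw : ∀ a b : Cov n, ContinuousAlternatingMap.alternatizeUncurryFin (M.comp (a.smulRight b)) =
      toAlt n (k + 2) (ExteriorAlgebra.ι ℂ a * ExteriorAlgebra.ι ℂ (b.comp (cplxJ n)) * X) := by
    intro a b
    rw [hMs, mul_assoc, ← wedgeCov_toAlt, ← wedgeCov_toAlt]
    rfl
  have hadd : ∀ P Q : Cn n →L[ℝ] Cov n,
      ContinuousAlternatingMap.alternatizeUncurryFin (M.comp (P + Q)) =
      ContinuousAlternatingMap.alternatizeUncurryFin (M.comp P) +
      ContinuousAlternatingMap.alternatizeUncurryFin (M.comp Q) := by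
    intro P Q
    rw [ContinuousLinearMap.comp_add, ContinuousAlternatingMap.alternatizeUncurryFin_add]
  have hsm : ∀ (c : ℝ) (P : Cn n →L[ℝ] Cov n),
      ContinuousAlternatingMap.alternatizeUncurryFin (M.comp (c • P)) =
      c • ContinuousAlternatingMap.alternatizeUncurryFin (M.comp P) := by
    intro c P
    rw [ContinuousLinearMap.comp_smul, ContinuousAlternatingMap.alternatizeUncurryFin_smul]
  have hsum : ∀ P : Fin n → (Cn n →L[ℝ] Cov n),
      ContinuousAlternatingMap.alternatizeUncurryFin (M.comp (∑ j, P j)) =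
      ∑ j, ContinuousAlternatingMap.alternatizeUncurryFin (M.comp (P j)) := by
    intro P
    let L : (Cn n →L[ℝ] Cov n) →+ Alt n (k + 2) :=
      { toFun := fun P => ContinuousAlternatingMap.alternatizeUncurryFin (M.comp P)
        map_zero' := by
          ext v
          rw [ContinuousAlternatingMap.alternatizeUncurryFin_apply]
          refine Finset.sum_eq_zero fun i _ => ?_
          change (-1 : ℤ) ^ (i : ℕ) • (M 0) _ = 0
          rw [map_zero]
          exact smul_zero _
        map_add' := hadd }
    exact map_sum L _ _
  have hs2 : (f2 • normSqD n x).smulRight (normSqD n x) =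
      f2 • (normSqD n x).smulRight (normSqD n x) := by
    ext v w; simp [mul_assoc]
  rw [hadd, hsm, hs2, hsm, hw, normSqD_eq_sum, hsum]
  simp only [hadd, hw]
  have e1 : ∀ j : Fin n, toAlt n (k + 2) (ExteriorAlgebra.ι ℂ (antilin (dz j)) *
      ExteriorAlgebra.ι ℂ ((lin (dz j)).comp (cplxJ n)) * X) +
      toAlt n (k + 2) (ExteriorAlgebra.ι ℂ (lin (dz j)) *
      ExteriorAlgebra.ι ℂ ((antilin (dz j)).comp (cplxJ n)) * X) =
      toAlt n (k + 2) ((-2 : ℂ) • (ePos (dz j) * X)) := by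
    intro j
    rw [← map_add, ← add_mul, ι_mul_ι_comp_cplxJ, smul_mul_assoc]
  simp only [e1, ← normSqD_eq_sum]
  rw [← map_sum, normSqD_eq, ι_mul_ι_comp_cplxJ_self]
  have hr : ∀ (c : ℝ) (η : Alt n (k + 2)), c • η = (c : ℂ) • η := fun c η => by
    ext v; simp
  rw [hr, hr, ← map_smul, ← map_smul, ← map_add, ← map_smul]
  congr 1
  rw [← Finset.smul_sum, ← Finset.sum_mul, bExt]
  simp only [smul_mul_assoc, add_mul, smul_add, smul_smul, ← Complex.ofReal_mul]
  have hc : ∀ c : ℝ, ((-(1 / (4 * Real.pi)) : ℝ) : ℂ) * ((c : ℂ) * (-2 : ℂ)) =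
      ((1 / (2 * Real.pi) * c : ℝ) : ℂ) := by
    intro c
    push_cast
    have : (Real.pi : ℂ) ≠ 0 := by exact_mod_cast Real.pi_ne_zero
    field_simp
    ring
  rw [hc, hc]

theorem constOfIsEmpty_eq {n : ℕ} (c : ℂ) :
    ContinuousAlternatingMap.constOfIsEmpty ℝ (Cn n) (Fin 0) c = c • toAlt n 0 1 := by
  rw [← ExteriorAlgebra.ιMulti_zero_apply (R := ℂ) (M := Cov n) (fun i => i.elim0), toAlt_ιMulti]
  ext v
  rw [ContinuousAlternatingMap.smul_apply, wedgeOne_apply]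
  have : Matrix.detRowAlternating (fun (a b : Fin 0) => (Fin.elim0 a : Cov n) (v b)) = (1 : ℂ) :=
    Matrix.det_fin_zero
  simp [this]

theorem ddcFun_radial {n : ℕ} {f f1 : ℝ → ℝ} {f2 : ℝ} {x : Cn n}
    (h1 : ∀ᶠ t in 𝓝 (‖x‖ ^ 2), HasDerivAt f (f1 t) t) (h2 : HasDerivAt f1 f2 (‖x‖ ^ 2)) :
    ddcFun (fun z => f (‖z‖ ^ 2)) x = toAlt n 2 (((1 / (2 * Real.pi) : ℝ) : ℂ) •
        (((f1 (‖x‖ ^ 2) : ℝ) : ℂ) • bExt n + ((f2 : ℝ) : ℂ) • ePos (ell x))) := by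
  have := ddcForm_radial (k := 0) h1 h2 1 (map_one _)
  rw [mul_one] at this
  rw [ddcFun, ← this]
  simp only [constOfIsEmpty_eq]

theorem beta_eq {n : ℕ} (x : Cn n) :
    beta n x = toAlt n 2 (((1 / (2 * Real.pi) : ℝ) : ℂ) • bExt n) := by
  have := ddcFun_radial (x := x) (f := fun t => t) (f1 := fun _ => 1) (f2 := 0)
    (Eventually.of_forall fun t => hasDerivAt_id t) (hasDerivAt_const _ _)
  rw [beta]
  simpa using this

theorem ddcFun_log {n : ℕ} {x : Cn n} (hx : x ≠ 0) :
    ddcFun (fun z : Cn n => Real.log (‖z‖ ^ 2)) x = toAlt n 2 (((1 / (2 * Real.pi) : ℝ) : ℂ) •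
      (((1 / ‖x‖ ^ 2 : ℝ) : ℂ) • bExt n - ((1 / (‖x‖ ^ 2) ^ 2 : ℝ) : ℂ) • ePos (ell x))) := by
  have hx' : ‖x‖ ^ 2 ≠ 0 := by simpa using hx
  have := ddcFun_radial (x := x) (f := Real.log) (f1 := fun t => t⁻¹) (f2 := -((‖x‖ ^ 2) ^ 2)⁻¹)
    ((isOpen_ne.eventually_mem hx').mono fun t ht => Real.hasDerivAt_log ht) (hasDerivAt_inv hx')
  rw [this]
  simp [sub_eq_add_neg]

theorem wedgePow_toAlt_of_mem {n : ℕ} {X : Ext n}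
    (hX : X ∈ Submodule.span ℂ (range fun a : (Cn n →L[ℂ] ℂ) × (Cn n →L[ℂ] ℂ) => hPair a.1 a.2))
    (m : ℕ) : wedgePow (toAlt n 2 X) m = toAlt n (2 * m) (X ^ m) := by
  obtain ⟨N, c, g, rfl⟩ := Submodule.mem_span_set'.1 hX
  choose a ha using fun i => (g i).2
  have := wedgePow_toAlt c (fun i => (a i).1) (fun i => (a i).2) m
  simpa only [ha] using this

theorem hPair_mem_span {n : ℕ} (α γ : Cn n →L[ℂ] ℂ) :
    hPair α γ ∈ Submodule.span ℂ
      (range fun a : (Cn n →L[ℂ] ℂ) × (Cn n →L[ℂ] ℂ) => hPair a.1 a.2) :=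
  Submodule.subset_span ⟨(α, γ), rfl⟩

theorem wedgePow_beta {n : ℕ} (x : Cn n) (m : ℕ) :
    wedgePow (beta n x) m = toAlt n (2 * m) ((((1 / (2 * Real.pi)) ^ m : ℝ) : ℂ) • bExt n ^ m) := by
  rw [beta_eq, wedgePow_toAlt_of_mem, smul_pow, Complex.ofReal_pow]
  exact Submodule.smul_mem _ _ (Submodule.sum_mem _ fun j _ => hPair_mem_span _ _)


/-! ### Naturality under holomorphic maps -/

theorem contDiffAt_extDeriv {n k : ℕ} {η : Cn n → Alt n k} {x : Cn n} (h : ContDiffAt ℝ ∞ η x) :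
    ContDiffAt ℝ ∞ (extDeriv η) x := by
  have : extDeriv η = fun x =>
      ContinuousAlternatingMap.alternatizeUncurryFinCLM ℝ (Cn n) ℂ (fderiv ℝ η x) := by
    funext x; simp [extDeriv]
  rw [this]
  exact (ContinuousLinearMap.contDiff _).contDiffAt.comp x (h.fderiv_right (by simp))

theorem contDiffAt_constForm {n : ℕ} {f : Cn n → ℝ} {x : Cn n} (h : ContDiffAt ℝ ∞ f x) :
    ContDiffAt ℝ ∞ (fun x => ContinuousAlternatingMap.constOfIsEmpty ℝ (Cn n) (Fin 0)
      ((f x : ℝ) : ℂ)) x := by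
  simp only [constOfIsEmpty_eq]
  exact (Complex.ofRealCLM.contDiff.contDiffAt.comp x h).smul contDiffAt_const

theorem eventually_contDiffAt {E F : Type*} [NormedAddCommGroup E] [NormedSpace ℝ E]
    [NormedAddCommGroup F] [NormedSpace ℝ F] {f : E → F} {x : E} (h : ContDiffAt ℝ ∞ f x) :
    ∀ᶠ y in 𝓝 x, DifferentiableAt ℝ f y := by
  have : ContDiffAt ℝ 1 f x := h.of_le (by simp)
  filter_upwards [this.eventually (by simp)] with y hy
  exact hy.differentiableAt (by simp)

theorem ddcFun_add {n : ℕ} {f g : Cn n → ℝ} {x : Cn n} (hf : ContDiffAt ℝ ∞ f x)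
    (hg : ContDiffAt ℝ ∞ g x) :
    ddcFun (fun y => f y + g y) x = ddcFun f x + ddcFun g x := by
  have hf' := contDiffAt_constForm hf
  have hg' := contDiffAt_constForm hg
  simp only [ddcFun, ddcForm]
  refine Eq.trans ?_ (smul_add _ _ _)
  congr 1
  have e : (fun y => pullJ (extDeriv (fun x => ContinuousAlternatingMap.constOfIsEmpty ℝ (Cn n)
      (Fin 0) ((f x + g x : ℝ) : ℂ)) y)) =ᶠ[𝓝 x] fun y =>
      pullJ (extDeriv (fun x => ContinuousAlternatingMap.constOfIsEmpty ℝ (Cn n) (Fin 0)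
        ((f x : ℝ) : ℂ)) y) +
      pullJ (extDeriv (fun x => ContinuousAlternatingMap.constOfIsEmpty ℝ (Cn n) (Fin 0)
        ((g x : ℝ) : ℂ)) y) := by
    filter_upwards [eventually_contDiffAt hf', eventually_contDiffAt hg'] with y h1 h2
    rw [← map_add, ← extDeriv_fun_add h1 h2]
    congr 2
    funext z
    rw [constOfIsEmpty_eq, constOfIsEmpty_eq, constOfIsEmpty_eq, Complex.ofReal_add]
    exact add_smul _ _ _
  rw [e.extDeriv_eq]
  exact extDeriv_fun_add
    ((pullJ.contDiff.contDiffAt.comp x (contDiffAt_extDeriv hf')).differentiableAt (by simp))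
    ((pullJ.contDiff.contDiffAt.comp x (contDiffAt_extDeriv hg')).differentiableAt (by simp))

theorem ddcFun_congr {n : ℕ} {f g : Cn n → ℝ} {x : Cn n} (h : f =ᶠ[𝓝 x] g) :
    ddcFun f x = ddcFun g x := by
  have h1 : (fun x => ContinuousAlternatingMap.constOfIsEmpty ℝ (Cn n) (Fin 0) ((f x : ℝ) : ℂ))
      =ᶠ[𝓝 x] fun x => ContinuousAlternatingMap.constOfIsEmpty ℝ (Cn n) (Fin 0)
        ((g x : ℝ) : ℂ) := by
    filter_upwards [h] with y hy
    rw [hy]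
  simp only [ddcFun, ddcForm]
  congr 1
  refine Filter.EventuallyEq.extDeriv_eq ?_
  filter_upwards [h1.extDeriv] with y hy
  rw [hy]

theorem restrictScalars_comp_cplxJ {n : ℕ} (A : Cn n →L[ℂ] Cn n) :
    (A.restrictScalars ℝ).comp (cplxJ n) = (cplxJ n).comp (A.restrictScalars ℝ) := by
  ext v; simp [cplxJ]

theorem pullJ_comp {n k : ℕ} (η : Alt n k) (A : Cn n →L[ℂ] Cn n) :
    pullJ (η.compContinuousLinearMap (A.restrictScalars ℝ)) =
      (pullJ η).compContinuousLinearMap (A.restrictScalars ℝ) := by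
  ext v
  change η (fun i => (A.restrictScalars ℝ).comp (cplxJ n) (v i)) =
    η (fun i => (cplxJ n).comp (A.restrictScalars ℝ) (v i))
  rw [restrictScalars_comp_cplxJ]

/-- `dd^c (f ∘ h) = h^* dd^c f` for holomorphic `h`. -/
theorem ddcFun_comp {n : ℕ} {f : Cn n → ℝ} {h : Cn n → Cn n} {x : Cn n}
    (hf : ContDiffAt ℝ ∞ f (h x)) (hh : ContDiffAt ℝ ∞ h x)
    (hhol : ∀ᶠ y in 𝓝 x, DifferentiableAt ℂ h y) :
    ddcFun (f ∘ h) x = (ddcFun f (h x)).compContinuousLinearMap (fderiv ℝ h x) := by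
  set η : Cn n → Alt n 0 := fun x =>
    ContinuousAlternatingMap.constOfIsEmpty ℝ (Cn n) (Fin 0) ((f x : ℝ) : ℂ) with hη
  have hη1 : ContDiffAt ℝ ∞ η (h x) := contDiffAt_constForm hf
  have e0 : (fun x => ContinuousAlternatingMap.constOfIsEmpty ℝ (Cn n) (Fin 0)
      (((f ∘ h) x : ℝ) : ℂ)) = fun y => (η (h y)).compContinuousLinearMap (fderiv ℝ h y) := by
    funext y
    ext v
    rfl
  have hhd : ∀ᶠ y in 𝓝 x, ContDiffAt ℝ 2 h y :=
    (hh.of_le (m := 2) (WithTop.coe_le_coe.2 (le_top : (2 : ℕ∞) ≤ ⊤))).eventually (by simp)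
  have e1 : (fun y => pullJ (extDeriv (fun x => ContinuousAlternatingMap.constOfIsEmpty ℝ (Cn n)
      (Fin 0) (((f ∘ h) x : ℝ) : ℂ)) y)) =ᶠ[𝓝 x]
      fun y => (pullJ (extDeriv η (h y))).compContinuousLinearMap (fderiv ℝ h y) := by
    filter_upwards [hh.continuousAt.eventually (eventually_contDiffAt hη1), hhd, hhol]
      with y h1 h2 h3
    -- Holomorphy enters here: the real derivative of h is the restriction of a complex linear map,
    -- so pulling back by it commutes with J^*.
    rw [e0, extDeriv_pullback h1 h2 (by simp), h3.fderiv_restrictScalars ℝ, pullJ_comp]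
  simp only [ddcFun, ddcForm]
  rw [e1.extDeriv_eq]
  have h5 : DifferentiableAt ℝ (fun y => pullJ (extDeriv η y)) (h x) :=
    (pullJ.contDiff.contDiffAt.comp _ (contDiffAt_extDeriv hη1)).differentiableAt (by simp)
  rw [extDeriv_pullback h5 hhd.self_of_nhds (by simp)]
  rfl

theorem wedgePow_comp {n : ℕ} (κ : Alt n 2) (A : Cn n →L[ℝ] Cn n) (m : ℕ) :
    wedgePow (κ.compContinuousLinearMap A) m = (wedgePow κ m).compContinuousLinearMap A := by
  ext v
  rw [ContinuousAlternatingMap.compContinuousLinearMap_apply]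
  simp only [wedgePow, ContinuousAlternatingMap.smul_apply,
    ContinuousMultilinearMap.alternatization_apply_apply]
  rfl

/-! ### The Kähler form of the blow-up -/

/-- The linear part of `dir j`, which sets the `j`-th coordinate to zero. -/
def dirD {n : ℕ} (j : Fin n) : Cn n →L[ℂ] Cn n :=
  ContinuousLinearMap.id ℂ (Cn n) - (dz j).smulRight (EuclideanSpace.single j (1 : ℂ))

theorem dir_eq {n : ℕ} (j : Fin n) (w : Cn n) :
    dir j w = dirD j w + EuclideanSpace.single j (1 : ℂ) := by
  ext l
  by_cases h : l = j
  · subst h; simp [dir, dirD]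
  · simp [dir, dirD, h]

theorem hasFDerivAt_dir {n : ℕ} (j : Fin n) (w : Cn n) : HasFDerivAt (dir j) (dirD j) w := by
  have : dir j = fun w : Cn n => dirD j w + EuclideanSpace.single j (1 : ℂ) :=
    funext fun w => dir_eq j w
  rw [this]
  exact (dirD j).hasFDerivAt.add_const _

/-- The differential of `chartProj j`. -/
def chartProjD {n : ℕ} (j : Fin n) (w : Cn n) : Cn n →L[ℂ] Cn n :=
  w j • dirD j + (dz j).smulRight (dir j w)

theorem hasFDerivAt_chartProj {n : ℕ} (j : Fin n) (w : Cn n) :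
    HasFDerivAt (chartProj j) (chartProjD j w) w :=
  (dz j).hasFDerivAt.smul (hasFDerivAt_dir j w)

/-- The Kähler form of the blow-up in the `j`-th chart, up to the factor `2π`, in the exterior
algebra. -/
def kahlerExt {n : ℕ} (j : Fin n) (w : Cn n) : Ext n :=
  (∑ k, ePos ((dz k).comp (chartProjD j w))) +
    (((1 / ‖dir j w‖ ^ 2 : ℝ) : ℂ) • (∑ k, ePos ((dz k).comp (dirD j))) -
      ((1 / (‖dir j w‖ ^ 2) ^ 2 : ℝ) : ℂ) • ePos ((ell (dir j w)).comp (dirD j)))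

theorem map_covPull_bExt {n : ℕ} (A : Cn n →L[ℂ] Cn n) :
    ExteriorAlgebra.map (covPull (A.restrictScalars ℝ)) (bExt n) =
      ∑ k, ePos ((dz k).comp A) := by
  rw [bExt, map_sum]
  exact Finset.sum_congr rfl fun k _ => map_covPull_hPair A _ _

theorem contDiffAt_log_normSq {n : ℕ} {x : Cn n} (hx : x ≠ 0) :
    ContDiffAt ℝ ∞ (fun z : Cn n => Real.log (‖z‖ ^ 2)) x :=
  ((contDiff_norm_sq ℝ).contDiffAt).log (by simpa using hx)

/-- Both potentials are radial functions composed with holomorphic maps, namely `chartProj j` and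
`dir j`, so the radial formulas are pulled back. -/
theorem kahler_eq {n : ℕ} (j : Fin n) (w : Cn n) :
    kahler j w = toAlt n 2 (((1 / (2 * Real.pi) : ℝ) : ℂ) • kahlerExt j w) := by
  have h1 := ddcFun_comp (f := fun z : Cn n => ‖z‖ ^ 2) (h := chartProj j) (x := w)
    (contDiff_norm_sq ℝ).contDiffAt (contDiff_chartProj j).contDiffAt
    (Eventually.of_forall fun y => (hasFDerivAt_chartProj j y).differentiableAt)
  have h2 := ddcFun_comp (f := fun z : Cn n => Real.log (‖z‖ ^ 2)) (h := dir j) (x := w)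
    (contDiffAt_log_normSq (dir_ne_zero j w)) (contDiff_dir j).contDiffAt
    (Eventually.of_forall fun y => (hasFDerivAt_dir j y).differentiableAt)
  have e : kahler j w = ddcFun ((fun z : Cn n => ‖z‖ ^ 2) ∘ chartProj j) w +
      ddcFun ((fun z : Cn n => Real.log (‖z‖ ^ 2)) ∘ dir j) w :=
    ddcFun_add ((contDiff_norm_sq ℝ).contDiffAt.comp w (contDiff_chartProj j).contDiffAt)
      ((contDiffAt_log_normSq (dir_ne_zero j w)).comp w (contDiff_dir j).contDiffAt)
  have hb : ddcFun (fun z : Cn n => ‖z‖ ^ 2) (chartProj j w) = beta n (chartProj j w) := rfl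
  rw [e, h1, h2, hb, beta_eq, ddcFun_log (dir_ne_zero j w),
    ((hasFDerivAt_chartProj j w).restrictScalars ℝ).fderiv,
    ((hasFDerivAt_dir j w).restrictScalars ℝ).fderiv, toAlt_comp, toAlt_comp, ← map_add]
  congr 1
  rw [map_smul, map_smul, ← smul_add, map_sub, map_smul, map_smul, map_covPull_bExt,
    map_covPull_bExt, map_covPull_hPair, kahlerExt]

theorem wedgePow_kahler {n : ℕ} (j : Fin n) (w : Cn n) (m : ℕ) :
    wedgePow (kahler j w) m =
      toAlt n (2 * m) ((((1 / (2 * Real.pi) : ℝ) : ℂ) • kahlerExt j w) ^ m) := by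
  rw [kahler_eq, wedgePow_toAlt_of_mem]
  refine Submodule.smul_mem _ _ (Submodule.add_mem _ (Submodule.sum_mem _ fun k _ =>
    hPair_mem_span _ _) (Submodule.sub_mem _ (Submodule.smul_mem _ _ (Submodule.sum_mem _ fun k _ =>
    hPair_mem_span _ _)) (Submodule.smul_mem _ _ (hPair_mem_span _ _))))

/-- Let u = |dir|². In the directions k ≠ j the Fubini–Study part is u⁻² ∑ i dz_k ∧ dz̄_k plus u⁻²
times a Cauchy–Schwarz defect, since ∑_{k≠j} |dir_k|² = u - 1. The direction j, where the
Fubini–Study part degenerates, is supplied by π^*β: the j-th component of `chartProj` is w_j, which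
gives i dz_j ∧ dz̄_j with coefficient 1 ≥ u⁻². -/
theorem kahlerExt_sub_mem {n : ℕ} (j : Fin n) (w : Cn n) :
    kahlerExt j w - ((1 / (‖dir j w‖ ^ 2) ^ 2 : ℝ) : ℂ) • bExt n ∈ posCone n := by
  classical
  set u : ℝ := ‖dir j w‖ ^ 2 with hu
  have hsplit : u = 1 + ∑ k ∈ Finset.univ.erase j, ‖dir j w k‖ ^ 2 := by
    rw [hu, EuclideanSpace.norm_sq_eq, ← Finset.add_sum_erase _ _ (Finset.mem_univ j), dir_self]
    simp
  have hu1 : 1 ≤ u := by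
    rw [hsplit]
    have : 0 ≤ ∑ k ∈ Finset.univ.erase j, ‖dir j w k‖ ^ 2 :=
      Finset.sum_nonneg fun _ _ => by positivity
    linarith
  have hDj : (dz j).comp (dirD j) = (0 : Cn n →L[ℂ] ℂ) := by
    ext v; simp [dirD]
  have hDk : ∀ k ∈ Finset.univ.erase j, (dz k).comp (dirD j) = dz k := by
    intro k hk
    have := (Finset.mem_erase.1 hk).1
    ext v; simp [dirD, this]
  have hPj : (dz j).comp (chartProjD j w) = dz j := by
    ext v; simp [chartProjD, dirD, dir_self]
  have hS : ∑ k, ePos ((dz k).comp (dirD j)) = ∑ k ∈ Finset.univ.erase j, ePos (dz (n := n) k) := by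
    rw [← Finset.add_sum_erase _ _ (Finset.mem_univ j), hDj]
    have h0 : ePos (0 : Cn n →L[ℂ] ℂ) = 0 := by
      show hPairL n 0 0 = 0
      rw [map_zero]
    rw [h0, zero_add]
    exact Finset.sum_congr rfl fun k hk => by rw [hDk k hk]
  have hL : (ell (dir j w)).comp (dirD j) =
      ∑ k ∈ Finset.univ.erase j, starRingEnd ℂ (dir j w k) • dz (n := n) k := by
    rw [ell_eq, ← Finset.add_sum_erase _ _ (Finset.mem_univ j)]
    ext v
    simp only [ContinuousLinearMap.comp_apply, add_apply,
      smul_apply, sum_apply]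
    have h1 := congrArg (fun L : Cn n →L[ℂ] ℂ => L v) hDj
    simp only [ContinuousLinearMap.comp_apply] at h1
    rw [h1]
    simp only [zero_apply, smul_zero, zero_add]
    refine Finset.sum_congr rfl fun k hk => ?_
    have h2 := congrArg (fun L : Cn n →L[ℂ] ℂ => L v) (hDk k hk)
    simp only [ContinuousLinearMap.comp_apply] at h2
    rw [h2]
  have hCS := cauchySchwarz_mem (Finset.univ.erase j) (fun k => dir j w k) (fun k => dz (n := n) k)
  rw [← hL, show ∑ k ∈ Finset.univ.erase j, ‖dir j w k‖ ^ 2 = u - 1 by rw [hsplit]; ring] at hCS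
  have hP : (∑ k, ePos ((dz k).comp (chartProjD j w))) - ePos (dz j) ∈ posCone n := by
    rw [← Finset.add_sum_erase _ _ (Finset.mem_univ j), hPj, add_sub_cancel_left]
    exact Submodule.sum_mem _ fun k _ => ePos_mem _
  have hupos : 0 < u := by linarith
  have h3 : 0 ≤ 1 - 1 / u ^ 2 := by
    rw [sub_nonneg, div_le_one (by positivity)]
    nlinarith
  have h4 : 0 ≤ 1 / u ^ 2 := by positivity
  have := Submodule.add_mem _ (Submodule.add_mem _ hP (smul_mem_cone (ePos_mem (dz j)) h3))
    (smul_mem_cone hCS h4)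
  convert this using 1
  rw [kahlerExt, ← hu, hS, bExt, ← Finset.add_sum_erase Finset.univ (fun k => ePos (dz (n := n) k))
    (Finset.mem_univ j)]
  generalize ∑ k ∈ Finset.univ.erase j, ePos (dz (n := n) k) = S
  have hu' : (u : ℂ) ≠ 0 := by exact_mod_cast hupos.ne'
  have e1 : ((1 / u : ℝ) : ℂ) = ((1 / u ^ 2 : ℝ) : ℂ) * (((u - 1 : ℝ) : ℂ) + 1) := by
    push_cast
    field_simp
    ring
  rw [e1]
  push_cast
  module

/-! ### The Kähler form of the blow-up in the coordinates of ℂⁿ. -/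

/-- The coordinates of the `j`-th chart, as functions on `ℂⁿ`, defined where `z_j ≠ 0`. -/
def chartCoord {n : ℕ} (j : Fin n) (z : Cn n) : Cn n :=
  WithLp.toLp 2 (fun l => if l = j then z j else z l / z j)

theorem chartCoord_self {n : ℕ} (j : Fin n) (z : Cn n) : chartCoord j z j = z j := by
  simp [chartCoord]

theorem dir_chartCoord {n : ℕ} (j : Fin n) {z : Cn n} (h : z j ≠ 0) :
    dir j (chartCoord j z) = (z j)⁻¹ • z := by
  ext l
  by_cases hl : l = j
  · subst hl; simp [dir_self, h]
  · simp [dir, chartCoord, hl, div_eq_inv_mul]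

theorem chartProj_chartCoord {n : ℕ} (j : Fin n) {z : Cn n} (h : z j ≠ 0) :
    chartProj j (chartCoord j z) = z := by
  rw [chartProj, dir_chartCoord j h, chartCoord_self, smul_smul, mul_inv_cancel₀ h, one_smul]

theorem isOpen_coord_ne {n : ℕ} (j : Fin n) : IsOpen {z : Cn n | z j ≠ 0} :=
  isOpen_ne.preimage (EuclideanSpace.proj (𝕜 := ℂ) j).continuous

theorem differentiableAt_chartCoord {n : ℕ} (j : Fin n) {z : Cn n} (h : z j ≠ 0) :
    DifferentiableAt ℂ (chartCoord j) z := by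
  have hd : ∀ m, DifferentiableAt ℂ (fun w : Cn n => w m) z := fun m =>
    (dz m).differentiableAt
  refine (PiLp.continuousLinearEquiv 2 ℂ (fun _ : Fin n => ℂ)).symm.differentiableAt.comp z
    (differentiableAt_pi.2 fun l => ?_)
  by_cases hl : l = j
  · simp only [hl, if_true]
    exact hd j
  · simp only [hl, if_false]
    simp only [div_eq_mul_inv]
    exact (hd l).fun_mul ((hd j).fun_inv h)

theorem contDiffAt_chartCoord {n : ℕ} (j : Fin n) {z : Cn n} (h : z j ≠ 0) :
    ContDiffAt ℝ ∞ (chartCoord j) z := by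
  refine (PiLp.continuousLinearEquiv 2 ℝ (fun _ : Fin n => ℂ)).symm.contDiff.contDiffAt.comp z
    (contDiffAt_pi.2 fun l => ?_)
  by_cases hl : l = j
  · simp only [hl, if_true]
    exact (contDiff_coord j).contDiffAt
  · simp only [hl, if_false]
    simp only [div_eq_mul_inv]
    exact (contDiff_coord l).contDiffAt.mul ((contDiff_coord j).contDiffAt.inv h)

/-- `|z_j|²` has a pluriharmonic logarithm. -/
theorem ddcFun_log_coord {n : ℕ} (j : Fin n) {z : Cn n} (h : z j ≠ 0) :
    ddcFun (fun z : Cn n => Real.log (‖z j‖ ^ 2)) z = 0 := by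
  -- With P the projection on the j-th axis, log |z_j|² = log |P z|². On a line the Cauchy–Schwarz
  -- inequality is an equality, so the two terms of dd^c log |·|² cancel after pull-back by P.
  let P : Cn n →L[ℂ] Cn n := (dz j).smulRight (EuclideanSpace.single j (1 : ℂ))
  have hPz : ∀ z : Cn n, P z = EuclideanSpace.single j (z j) := by
    intro z
    ext l
    by_cases hl : l = j
    · subst hl; simp [P]
    · simp [P, hl]
  have hn : ∀ z : Cn n, ‖P z‖ = ‖z j‖ := fun z => by rw [hPz]; simp
  have h0 : P z ≠ 0 := by
    rw [← norm_ne_zero_iff, hn]; simpa using h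
  have h1 := ddcFun_comp (f := fun z : Cn n => Real.log (‖z‖ ^ 2)) (h := P) (x := z)
    (contDiffAt_log_normSq h0) (P.restrictScalars ℝ).contDiff.contDiffAt
    (Eventually.of_forall fun y => P.differentiableAt)
  have e : ((fun z : Cn n => Real.log (‖z‖ ^ 2)) ∘ P) = fun z : Cn n => Real.log (‖z j‖ ^ 2) := by
    funext y
    simp only [Function.comp, hn]
  have hf : fderiv ℝ (⇑P) z = P.restrictScalars ℝ := (P.restrictScalars ℝ).fderiv
  rw [← e, h1, ddcFun_log h0, hf, toAlt_comp, map_smul, map_sub, map_smul, map_smul,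
    map_covPull_bExt, map_smul, map_covPull_hPair, hn]
  have e1 : ∑ k, ePos ((dz k).comp P) = ePos (dz j) := by
    rw [Finset.sum_eq_single j]
    · congr 1
      ext v
      simp [P]
    · intro k _ hk
      have : (dz k).comp P = (0 : ℂ) • (0 : Cn n →L[ℂ] ℂ) := by ext v; simp [P, hk]
      rw [this, ePos, hPair_smul_left, zero_smul]
    · simp
  have e2 : (ell (P z)).comp P = starRingEnd ℂ (z j) • dz j := by
    rw [ell_eq]
    ext v
    simp [P, mul_comm]
  simp only [e1, e2, ePos]
  rw [hPair_smul_left, hPair_smul_right, smul_smul, smul_smul, Complex.conj_conj,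
    ← sub_smul]
  have e3 : ((1 / ‖z j‖ ^ 2 : ℝ) : ℂ) - ((1 / (‖z j‖ ^ 2) ^ 2 : ℝ) : ℂ) *
      (starRingEnd ℂ (z j) * z j) = 0 := by
    rw [mul_comm (starRingEnd ℂ (z j)), Complex.mul_conj, Complex.normSq_eq_norm_sq,
      ← Complex.ofReal_mul, ← Complex.ofReal_sub, Complex.ofReal_eq_zero]
    have : ‖z j‖ ≠ 0 := by simpa using h
    field_simp
    ring
  rw [mul_assoc, e3, zero_smul, map_zero]
  ext v
  exact mul_zero _

/-- The form `dd^c (|z|² + log |z|²)`, up to the factor `2π`, in the exterior algebra. -/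
def omegaExt {n : ℕ} (z : Cn n) : Ext n :=
  ((1 + 1 / ‖z‖ ^ 2 : ℝ) : ℂ) • bExt n - ((1 / (‖z‖ ^ 2) ^ 2 : ℝ) : ℂ) • ePos (ell z)

/-- In the chart |dir|² = |z|² / |z_j|², so the potential differs from |z|² + log |z|² by the
pluriharmonic function log |z_j|². The result is thus independent of j. -/
theorem kahler_comp_chartCoord {n : ℕ} (j : Fin n) {z : Cn n} (h : z j ≠ 0) :
    (kahler j (chartCoord j z)).compContinuousLinearMap (fderiv ℝ (chartCoord j) z) =
      toAlt n 2 (((1 / (2 * Real.pi) : ℝ) : ℂ) • omegaExt z) := by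
  have hz : z ≠ 0 := fun h0 => h (by rw [h0]; rfl)
  have hd := dir_ne_zero j (chartCoord j z)
  have hlog : ContDiffAt ℝ ∞ (fun w : Cn n => Real.log (‖dir j w‖ ^ 2)) (chartCoord j z) :=
    (contDiffAt_log_normSq hd).comp _ (contDiff_dir j).contDiffAt
  have hsq : ContDiffAt ℝ ∞ (fun w : Cn n => ‖chartProj j w‖ ^ 2) (chartCoord j z) :=
    (contDiff_norm_sq ℝ).contDiffAt.comp _ (contDiff_chartProj j).contDiffAt
  have hev : ∀ᶠ y : Cn n in 𝓝 z, y j ≠ 0 := (isOpen_coord_ne j).eventually_mem h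
  have h1 := ddcFun_comp (f := fun w : Cn n => ‖chartProj j w‖ ^ 2 + Real.log (‖dir j w‖ ^ 2))
    (h := chartCoord j) (x := z) (hsq.add hlog) (contDiffAt_chartCoord j h)
    (hev.mono fun y hy => differentiableAt_chartCoord j hy)
  rw [kahler, ← h1]
  have hL : ContDiffAt ℝ ∞ (fun y : Cn n => Real.log (‖dir j (chartCoord j y)‖ ^ 2)) z :=
    hlog.comp z (contDiffAt_chartCoord j h)
  have e1 : ((fun w : Cn n => ‖chartProj j w‖ ^ 2 + Real.log (‖dir j w‖ ^ 2)) ∘ chartCoord j) =ᶠ[𝓝 z]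
      fun y => ‖y‖ ^ 2 + Real.log (‖dir j (chartCoord j y)‖ ^ 2) := by
    filter_upwards [hev] with y hy
    simp only [Function.comp, chartProj_chartCoord j hy]
  have e2 : (fun y : Cn n => Real.log (‖y‖ ^ 2)) =ᶠ[𝓝 z]
      fun y => Real.log (‖dir j (chartCoord j y)‖ ^ 2) + Real.log (‖y j‖ ^ 2) := by
    filter_upwards [hev] with y hy
    have hy0 : y ≠ 0 := fun h0 => hy (by rw [h0]; rfl)
    have hyn : ‖y j‖ ≠ 0 := by simpa using hy
    have hyn' : ‖y‖ ≠ 0 := by simpa using hy0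
    rw [dir_chartCoord j hy, norm_smul, norm_inv, ← Real.log_mul (by positivity) (by positivity)]
    congr 1
    field_simp
  have hj : ContDiffAt ℝ ∞ (fun y : Cn n => Real.log (‖y j‖ ^ 2)) z :=
    ((contDiff_norm_sq ℝ).contDiffAt.comp z (contDiff_coord j).contDiffAt).log (by simpa using h)
  have e3 := ddcFun_congr e2
  rw [ddcFun_add hL hj, ddcFun_log_coord j h, add_zero, ddcFun_log hz] at e3
  rw [ddcFun_congr e1, ddcFun_add (contDiff_norm_sq ℝ).contDiffAt hL, ← e3]
  have hb : ddcFun (fun z : Cn n => ‖z‖ ^ 2) z = beta n z := rfl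
  rw [hb, beta_eq, ← map_add, ← smul_add, omegaExt]
  congr 2
  push_cast
  module

/-- The form `(dd^c (|z|² + log |z|²))^m`. -/
def omegaPow {n : ℕ} (m : ℕ) (z : Cn n) : Alt n (2 * m) :=
  toAlt n (2 * m) ((((1 / (2 * Real.pi) : ℝ) : ℂ) • omegaExt z) ^ m)

theorem wedgePow_kahler_comp {n : ℕ} (j : Fin n) {z : Cn n} (h : z j ≠ 0) (m : ℕ) :
    (wedgePow (kahler j (chartCoord j z)) m).compContinuousLinearMap (fderiv ℝ (chartCoord j) z) =
      omegaPow m z := by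
  rw [← wedgePow_comp, kahler_comp_chartCoord j h, wedgePow_toAlt_of_mem, omegaPow]
  exact Submodule.smul_mem _ _ (Submodule.sub_mem _ (Submodule.smul_mem _ _ (Submodule.sum_mem _
    fun k _ => hPair_mem_span _ _)) (Submodule.smul_mem _ _ (hPair_mem_span _ _)))



/-! ### Spanning forms -/

/-- The generating forms: the strongly positive generators and the forms of the other types. -/
def genForms (n m : ℕ) : Set (Alt n (2 * m)) :=
  range strongGen ∪ {η | ∃ a b : ℕ, a + b = 2 * m ∧ a ≠ m ∧ IsOfType a b η}

/-- The coefficients are the Wirtinger derivatives of θ; those of the antilinear part are conjugated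
beforehand because `antilin` conjugates them again. -/
theorem exists_lin_add_antilin {n : ℕ} (θ : Cov n) :
    ∃ α γ : Cn n →L[ℂ] ℂ, θ = lin α + antilin γ := by
  refine ⟨∑ k, ((1 / 2 : ℂ) * (θ (EuclideanSpace.single k 1) -
      Complex.I * θ (EuclideanSpace.single k Complex.I))) • dz k,
    ∑ k, (starRingEnd ℂ) ((1 / 2 : ℂ) * (θ (EuclideanSpace.single k 1) +
      Complex.I * θ (EuclideanSpace.single k Complex.I))) • dz k, ?_⟩
  ext v
  have hv : v = ∑ k, ((v k).re • EuclideanSpace.single k (1 : ℂ) +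
      (v k).im • EuclideanSpace.single k Complex.I) := by
    ext l
    simp only [WithLp.ofLp_sum, Finset.sum_apply, PiLp.add_apply, PiLp.smul_apply,
      PiLp.single_apply]
    rw [Finset.sum_eq_single l]
    · simp [Complex.re_add_im]
    · intro b _ hb
      simp [hb.symm]
    · simp
  conv_lhs => rw [hv]
  simp only [map_sum, map_add, map_smul, add_apply, ContinuousLinearMap.coe_restrictScalars',
    sum_apply, smul_apply, ContinuousLinearMap.comp_apply, Complex.real_smul, smul_eq_mul]
  rw [← Finset.sum_add_distrib]
  refine Finset.sum_congr rfl fun k _ => ?_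
  simp only [ContinuousLinearEquiv.coe_coe, Complex.conjCLE_apply, map_mul, Complex.conj_conj]
  have hd : dz k v = v k := rfl
  rw [hd]
  have h1 : v k = (v k).re + (v k).im * Complex.I := (Complex.re_add_im _).symm
  have h2 : (starRingEnd ℂ) (v k) = (v k).re - (v k).im * Complex.I := by
    apply Complex.ext <;> simp
  rw [h2]
  generalize (v k).re = a at h1 ⊢
  generalize (v k).im = b at h1 ⊢
  rw [h1]
  ring_nf
  simp only [Complex.I_sq]
  ring

/-- Polarisation over the four fourth roots of unity. -/
theorem hPair_mem_span_ePos {n : ℕ} (α γ : Cn n →L[ℂ] ℂ) :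
    hPair α γ ∈ Submodule.span ℂ (range (ePos (n := n))) := by
  have h : hPair α γ = (1 / 4 : ℂ) • ePos (α + γ) - (1 / 4 : ℂ) • ePos (α + (-1 : ℂ) • γ) +
      (Complex.I / 4) • ePos (α + Complex.I • γ) -
      (Complex.I / 4) • ePos (α + (-Complex.I) • γ) := by
    simp only [ePos, hPair_add_left, hPair_add_right, hPair_smul_left, hPair_smul_right, map_neg,
      Complex.conj_I, map_one]
    match_scalars <;> ring_nf <;> simp only [Complex.I_sq] <;> ring_nf
  rw [h]
  have hm : ∀ β : Cn n →L[ℂ] ℂ, ePos β ∈ Submodule.span ℂ (range (ePos (n := n))) := fun β =>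
    Submodule.subset_span ⟨β, rfl⟩
  exact Submodule.sub_mem _ (Submodule.add_mem _ (Submodule.sub_mem _
    (Submodule.smul_mem _ _ (hm _)) (Submodule.smul_mem _ _ (hm _)))
    (Submodule.smul_mem _ _ (hm _))) (Submodule.smul_mem _ _ (hm _))

theorem toAlt_prod_hPair_mem {n m : ℕ} (α γ : Fin m → (Cn n →L[ℂ] ℂ)) :
    toAlt n (2 * m) (List.ofFn fun a => hPair (α a) (γ a)).prod ∈
      Submodule.span ℂ (range (strongGen (n := n) (m := m))) := by
  have h1 : (List.ofFn fun a => hPair (α a) (γ a)).prod ∈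
      Submodule.span ℂ (range (ePos (n := n))) ^ m := by
    have : ∀ (k : ℕ) (f : Fin k → Ext n), (∀ i, f i ∈ Submodule.span ℂ (range (ePos (n := n)))) →
        (List.ofFn f).prod ∈ Submodule.span ℂ (range (ePos (n := n))) ^ k := by
      intro k
      induction k with
      | zero => intro f _; simp [Submodule.one_eq_span, Submodule.mem_span_singleton_self]
      | succ k ih =>
        intro f hf
        rw [List.ofFn_succ, List.prod_cons, pow_succ']
        exact Submodule.mul_mem_mul (hf 0) (ih _ fun i => hf i.succ)
    exact this m _ fun i => hPair_mem_span_ePos _ _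
  rw [Submodule.span_pow] at h1
  have h2 := Submodule.mem_map_of_mem (f := toAlt n (2 * m)) h1
  rw [Submodule.map_span] at h2
  refine Submodule.span_mono ?_ h2
  rintro _ ⟨y, hy, rfl⟩
  obtain ⟨f, hf⟩ := Set.mem_pow.1 hy
  choose β hβ using fun i => (f i).2
  exact ⟨β, by rw [← prod_ePos, ← hf]; simp only [hβ]⟩

/-- Multiplying the vectors by t multiplies the rows of the determinant indexed by s by t and the
other rows by its conjugate. -/
theorem wedgeOne_piecewise_isOfType {n k : ℕ} (s : Finset (Fin k)) (α γ : Fin k → (Cn n →L[ℂ] ℂ)) :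
    IsOfType s.card (k - s.card)
      (wedgeOne (s.piecewise (fun i => lin (α i)) (fun i => antilin (γ i)))) := by
  classical
  intro t v
  rw [wedgeOne_apply, wedgeOne_apply]
  have h := Matrix.det_mul_column (fun a => if a ∈ s then t else starRingEnd ℂ t)
    (Matrix.of fun a b => s.piecewise (fun i => lin (α i)) (fun i => antilin (γ i)) a (v b))
  have h2 : (∏ a : Fin k, if a ∈ s then t else starRingEnd ℂ t) =
      t ^ s.card * (starRingEnd ℂ t) ^ (k - s.card) := by
    rw [Finset.prod_ite]
    simp only [Finset.prod_const]
    congr 2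
    · congr 1
      ext; simp
    · rw [show Finset.univ.filter (fun a => a ∉ s) = sᶜ by ext; simp, Finset.card_compl,
        Fintype.card_fin]
  rw [h2] at h
  refine Eq.trans ?_ h
  show Matrix.det _ = _
  congr 1
  ext a b
  by_cases ha : a ∈ s <;> simp [ha]

/-- If s has m elements, a permutation brings the linear covectors to the even places, and up to a
sign and a power of `I` the form is a product of m pairs, which polarisation expresses by strongly
positive generators. Otherwise the form is of a type other than (m, m). -/
theorem wedgeOne_piecewise_mem {n m : ℕ} (s : Finset (Fin (2 * m)))
    (α γ : Fin (2 * m) → (Cn n →L[ℂ] ℂ)) :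
    wedgeOne (s.piecewise (fun i => lin (α i)) (fun i => antilin (γ i))) ∈
      Submodule.span ℂ (genForms n m) := by
  classical
  by_cases hs : s.card = m
  · have hc : (Finset.univ.filter fun b : Fin (2 * m) => (b : ℕ) % 2 = 0).card = s.card := by
      have : (Finset.univ.filter fun b : Fin (2 * m) => (b : ℕ) % 2 = 0) =
          Finset.univ.image fun a : Fin m => pairIdx a 0 := by
        ext b
        simp only [Finset.mem_filter, Finset.mem_univ, true_and, Finset.mem_image]
        constructor
        · intro h
          exact ⟨⟨(b : ℕ) / 2, by have := b.2; omega⟩, by apply Fin.ext; simp [pairIdx]; omega⟩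
        · rintro ⟨a, rfl⟩
          simp [pairIdx]
      rw [this, Finset.card_image_of_injective, Finset.card_univ, Fintype.card_fin, hs]
      intro a a' h
      have := congrArg Fin.val h
      simp only [pairIdx] at this
      apply Fin.ext
      omega
    obtain ⟨σ, hσ⟩ : ∃ σ : Equiv.Perm (Fin (2 * m)), ∀ b, σ b ∈ s ↔ (b : ℕ) % 2 = 0 := by
      have e : {b : Fin (2 * m) // (b : ℕ) % 2 = 0} ≃ {b // b ∈ s} :=
        Fintype.equivOfCardEq (by rw [Fintype.card_subtype, hc, Fintype.card_coe])
      refine ⟨e.extendSubtype, fun b => ⟨fun h => ?_, fun h => e.extendSubtype_mem b h⟩⟩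
      by_contra hb
      exact e.extendSubtype_not_mem b hb h
    have h1 := (wedgeAlt n (2 * m)).map_perm
      (s.piecewise (fun i => lin (α i)) (fun i => antilin (γ i))) σ
    have h2 : (s.piecewise (fun i => lin (α i)) (fun i => antilin (γ i))) ∘ σ =
        fun b : Fin (2 * m) => if (b : ℕ) % 2 = 0 then
          lin ((fun a : Fin m => α (σ (pairIdx a 0))) ⟨(b : ℕ) / 2, by have := b.2; omega⟩)
        else antilin ((fun a : Fin m => γ (σ (pairIdx a 1)))
          ⟨(b : ℕ) / 2, by have := b.2; omega⟩) := by
      funext b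
      by_cases hb : (b : ℕ) % 2 = 0
      · have h3 : pairIdx (⟨(b : ℕ) / 2, by have := b.2; omega⟩ : Fin m) 0 = b := by
          apply Fin.ext; simp [pairIdx]; omega
        simp [hb, (hσ b).2 hb, h3]
      · have h3 : pairIdx (⟨(b : ℕ) / 2, by have := b.2; omega⟩ : Fin m) 1 = b := by
          apply Fin.ext; simp [pairIdx]; omega
        have h4 : σ b ∉ s := fun h => hb ((hσ b).1 h)
        simp [hb, h4, h3]
    have h5 := toAlt_prod_hPair_mem (fun a : Fin m => α (σ (pairIdx a 0)))
      (fun a : Fin m => γ (σ (pairIdx a 1)))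
    rw [prod_hPair, ← h2] at h5
    have h6 : wedgeOne ((s.piecewise (fun i => lin (α i)) (fun i => antilin (γ i))) ∘ σ) ∈
        Submodule.span ℂ (range (strongGen (n := n) (m := m))) := by
      have := Submodule.smul_mem _ ((Complex.I ^ m)⁻¹) h5
      rwa [smul_smul, inv_mul_cancel₀ (pow_ne_zero _ Complex.I_ne_zero), one_smul] at this
    refine Submodule.span_mono subset_union_left ?_
    rw [show wedgeOne ((s.piecewise (fun i => lin (α i)) (fun i => antilin (γ i))) ∘ σ) = _ from h1]
      at h6
    rcases Int.units_eq_one_or (Equiv.Perm.sign σ) with h | h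
    · rw [h, one_smul] at h6; exact h6
    · rw [h, Units.neg_smul, one_smul] at h6
      exact (Submodule.neg_mem_iff _).1 h6
  · refine Submodule.subset_span (Or.inr ⟨s.card, 2 * m - s.card, ?_, hs,
      wedgeOne_piecewise_isOfType s α γ⟩)
    have := s.card_le_univ
    simp at this
    omega

theorem wedgeOne_mem_span {n m : ℕ} (θ : Fin (2 * m) → Cov n) :
    wedgeOne θ ∈ Submodule.span ℂ (genForms n m) := by
  classical
  choose α γ h using fun i => exists_lin_add_antilin (θ i)
  have h1 : θ = (fun i => lin (α i)) + fun i => antilin (γ i) := funext h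
  have h2 := (wedgeAlt n (2 * m)).toMultilinearMap.map_add_univ (fun i => lin (α i))
    (fun i => antilin (γ i))
  rw [← h1] at h2
  rw [show wedgeOne θ = _ from h2]
  exact Submodule.sum_mem _ fun s _ => wedgeOne_piecewise_mem s α γ

/-- The multilinear expansion of η in the basis is antisymmetrised; since η is already
antisymmetric, the left-hand side is only multiplied by k!. -/
theorem alt_eq_sum {n k : ℕ} (η : Alt n k) {ι : Type*} [Fintype ι] (B : Module.Basis ι ℝ (Cn n)) :
    η = ((Nat.factorial k : ℂ)⁻¹) • ∑ r : Fin k → ι, (η fun i => B (r i)) •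
      wedgeOne fun i => Complex.ofRealCLM.comp (LinearMap.toContinuousLinearMap (B.coord (r i))) := by
  classical
  have hk : (Nat.factorial k : ℂ) ≠ 0 := by exact_mod_cast Nat.factorial_ne_zero k
  have key : ((Nat.factorial k : ℂ)) • η = ∑ r : Fin k → ι, (η fun i => B (r i)) •
      wedgeOne fun i => Complex.ofRealCLM.comp (LinearMap.toContinuousLinearMap (B.coord (r i))) := by
    ext v
    have hexp : ∀ v : Fin k → Cn n, η v = ∑ r : Fin k → ι, (η fun i => B (r i)) *
        ∏ i, ((B.coord (r i) (v i) : ℝ) : ℂ) := by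
      intro v
      have h1 : v = fun i => ∑ j, B.coord j (v i) • B j := funext fun i => (B.sum_repr (v i)).symm
      conv_lhs => rw [h1]
      have h2 := η.toMultilinearMap.map_sum (fun i j => B.coord j (v i) • B j)
      refine (Eq.trans h2 ?_)
      refine Finset.sum_congr rfl fun r _ => ?_
      have h3 := η.toMultilinearMap.map_smul_univ (fun i => B.coord (r i) (v i)) (fun i => B (r i))
      refine h3.trans ?_
      rw [Complex.real_smul, mul_comm, Complex.ofReal_prod]
      rfl
    have hperm : (Nat.factorial k : ℂ) * η v =
        ∑ σ : Equiv.Perm (Fin k), ((Equiv.Perm.sign σ : ℤ) : ℂ) * η (v ∘ σ) := by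
      have : ∀ σ : Equiv.Perm (Fin k), ((Equiv.Perm.sign σ : ℤ) : ℂ) * η (v ∘ σ) = η v := by
        intro σ
        have h := η.toAlternatingMap.map_perm v σ
        have h' : η (v ∘ σ) = Equiv.Perm.sign σ • η v := h
        rw [h']
        rcases Int.units_eq_one_or (Equiv.Perm.sign σ) with h | h <;> simp [h]
      rw [Finset.sum_congr rfl fun σ _ => this σ]
      simp [Fintype.card_perm]
    rw [ContinuousAlternatingMap.smul_apply, smul_eq_mul, hperm]
    simp only [hexp (v ∘ _), Finset.mul_sum]
    rw [Finset.sum_comm, ContinuousAlternatingMap.sum_apply]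
    refine Finset.sum_congr rfl fun r _ => ?_
    rw [ContinuousAlternatingMap.smul_apply, wedgeOne,
      ContinuousMultilinearMap.alternatization_apply_apply, smul_eq_mul, Finset.mul_sum]
    refine Finset.sum_congr rfl fun σ _ => ?_
    simp only [ContinuousMultilinearMap.compContinuousLinearMap_apply,
      ContinuousMultilinearMap.mkPiAlgebra_apply]
    rcases Int.units_eq_one_or (Equiv.Perm.sign σ) with h | h <;> simp [h]
  rw [← key, smul_smul, inv_mul_cancel₀ hk, one_smul]

theorem span_genForms (n m : ℕ) : Submodule.span ℂ (genForms n m) = ⊤ := by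
  refine eq_top_iff.2 fun η _ => ?_
  rw [alt_eq_sum η (Module.finBasis ℝ (Cn n))]
  exact Submodule.smul_mem _ _ (Submodule.sum_mem _ fun r _ => Submodule.smul_mem _ _
    (wedgeOne_mem_span _))

theorem finite_alt (n k : ℕ) : Module.Finite ℂ (Alt n k) := by
  let B := Module.finBasis ℝ (Cn n)
  have h : Submodule.span ℂ (range fun r : Fin k → _ => (wedgeOne fun i =>
      Complex.ofRealCLM.comp (LinearMap.toContinuousLinearMap (B.coord (r i))) : Alt n k)) = ⊤ := by
    refine eq_top_iff.2 fun η _ => ?_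
    rw [alt_eq_sum η B]
    exact Submodule.smul_mem _ _ (Submodule.sum_mem _ fun r _ => Submodule.smul_mem _ _
      (Submodule.subset_span ⟨r, rfl⟩))
  exact ⟨⟨(Set.finite_range _).toFinset, by simpa using h⟩⟩

/-- With the coefficients given by fixed linear functionals, a smooth family of forms splits into
smooth scalar functions times constant generating forms, so statements on test forms reduce to the
generators. -/
theorem exists_decomposition (n m : ℕ) : ∃ (N : ℕ) (c : Fin N → (Alt n (2 * m) →L[ℂ] ℂ))
    (e : Fin N → Alt n (2 * m)), (∀ i, e i ∈ genForms n m) ∧ ∀ η, η = ∑ i, c i η • e i := by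
  have := finite_alt n (2 * m)
  obtain ⟨b, hb, hspan, hli⟩ := exists_linearIndependent ℂ (genForms n m)
  have hspan' : ⊤ ≤ Submodule.span ℂ (range ((↑) : b → Alt n (2 * m))) := by
    rw [Subtype.range_coe, hspan, span_genForms]
  let B := Module.Basis.mk hli hspan'
  let : Fintype b := FiniteDimensional.fintypeBasisIndex B
  let f := Fintype.equivFin b
  refine ⟨_, fun i => LinearMap.toContinuousLinearMap (B.coord (f.symm i)),
    fun i => (f.symm i : Alt n (2 * m)), fun i => hb (f.symm i).2, fun η => ?_⟩
  rw [Equiv.sum_comp f.symm fun i => (LinearMap.toContinuousLinearMap (B.coord i)) η •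
    (i : Alt n (2 * m))]
  conv_lhs => rw [← B.sum_repr η]
  refine Finset.sum_congr rfl fun i _ => ?_
  rw [Module.Basis.mk_apply]
  rfl


/-! ### Averaging over rotations -/

/-- A primitive root of unity of order `2 m + 1`. -/
def rootU (m : ℕ) : ℂ := Complex.exp (2 * Real.pi * Complex.I / ((2 * m + 1 : ℕ) : ℂ))

theorem isPrimitiveRoot_rootU (m : ℕ) : IsPrimitiveRoot (rootU m) (2 * m + 1) :=
  Complex.isPrimitiveRoot_exp _ (by omega)

theorem norm_rootU (m : ℕ) : ‖rootU m‖ = 1 :=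
  (isPrimitiveRoot_rootU m).norm'_eq_one (by omega)

/-- The average of a form over the rotations by the powers of `rootU m`. -/
def avg (n m : ℕ) : Alt n (2 * m) →L[ℝ] Alt n (2 * m) :=
  (1 / ((2 * m + 1 : ℕ) : ℝ)) • ∑ j ∈ Finset.range (2 * m + 1),
    ContinuousAlternatingMap.compContinuousLinearMapCLM
      (((rootU m) ^ j • ContinuousLinearMap.id ℂ (Cn n)).restrictScalars ℝ)

theorem avg_apply {n m : ℕ} (η : Alt n (2 * m)) (v : Fin (2 * m) → Cn n) :
    avg n m η v = (1 / ((2 * m + 1 : ℕ) : ℝ)) •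
      ∑ j ∈ Finset.range (2 * m + 1), η (fun i => rootU m ^ j • v i) := by
  simp only [avg, smul_apply, sum_apply, ContinuousAlternatingMap.smul_apply,
    ContinuousAlternatingMap.sum_apply]
  rfl

theorem avg_smul {n m : ℕ} (c : ℂ) (η : Alt n (2 * m)) : avg n m (c • η) = c • avg n m η := by
  ext v
  simp only [avg_apply, ContinuousAlternatingMap.smul_apply, ← Finset.smul_sum]
  rw [smul_comm]

theorem avg_comp {n m : ℕ} (η : Alt n (2 * m)) (A : Cn n →L[ℂ] Cn n) :
    avg n m (η.compContinuousLinearMap (A.restrictScalars ℝ)) =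
      (avg n m η).compContinuousLinearMap (A.restrictScalars ℝ) := by
  ext v
  simp only [avg_apply, ContinuousAlternatingMap.compContinuousLinearMap_apply]
  congr 1
  refine Finset.sum_congr rfl fun j _ => ?_
  congr 1
  funext i
  simp

theorem strongGen_rotate {n m : ℕ} (α : Fin m → (Cn n →L[ℂ] ℂ)) {t : ℂ} (ht : ‖t‖ = 1)
    (v : Fin (2 * m) → Cn n) : strongGen α (fun i => t • v i) = strongGen α v := by
  have h1 := strongGen_comp α (t • ContinuousLinearMap.id ℂ (Cn n))
  have h2 : ∀ a, ePos ((α a).comp (t • ContinuousLinearMap.id ℂ (Cn n))) = ePos (α a) := by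
    intro a
    have : (α a).comp (t • ContinuousLinearMap.id ℂ (Cn n)) = t • α a := by
      ext v; simp
    rw [this]
    simp only [ePos]
    rw [hPair_smul_left, hPair_smul_right, smul_smul, Complex.mul_conj, Complex.normSq_eq_norm_sq,
      ht]
    simp
  rw [← prod_ePos (fun a => (α a).comp (t • ContinuousLinearMap.id ℂ (Cn n)))] at h1
  simp only [h2, prod_ePos] at h1
  exact congrArg (fun η : Alt n (2 * m) => η v) h1

theorem avg_strongGen {n m : ℕ} (α : Fin m → (Cn n →L[ℂ] ℂ)) :
    avg n m (strongGen α) = strongGen α := by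
  ext v
  rw [avg_apply, Finset.sum_congr rfl fun j _ => strongGen_rotate α (t := rootU m ^ j)
    (by rw [norm_pow, norm_rootU, one_pow]) v]
  rw [Finset.sum_const, Finset.card_range, ← Nat.cast_smul_eq_nsmul ℝ, smul_smul,
    one_div_mul_cancel (by positivity), one_smul]

/-- The rotation by ζ multiplies a form of type (a, b) by w = ζ^a ζ^{-b}. The order 2m + 1 of ζ
exceeds both a and b, so w = 1 would force a = b = m; hence w ≠ 1 and the geometric sum of its
powers vanishes. -/
theorem avg_isOfType {n m a b : ℕ} (hab : a + b = 2 * m) (ha : a ≠ m) {η : Alt n (2 * m)}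
    (h : IsOfType a b η) : avg n m η = 0 := by
  ext v
  rw [avg_apply, Finset.sum_congr rfl fun j _ => h (rootU m ^ j) v, ← Finset.sum_mul]
  have hprim := isPrimitiveRoot_rootU m
  set ζ := rootU m
  have hζ0 : ζ ≠ 0 := hprim.ne_zero (by omega)
  have hconj : starRingEnd ℂ ζ = ζ⁻¹ := by
    rw [Complex.inv_def, Complex.normSq_eq_norm_sq, norm_rootU]; simp
  set w := ζ ^ a * (starRingEnd ℂ ζ) ^ b with hw
  have hs : ∀ j ∈ Finset.range (2 * m + 1), (ζ ^ j) ^ a * (starRingEnd ℂ (ζ ^ j)) ^ b = w ^ j := by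
    intro j _
    rw [hw, map_pow, mul_pow, ← pow_mul, ← pow_mul, ← pow_mul, ← pow_mul, mul_comm j, mul_comm j]
  rw [Finset.sum_congr rfl hs]
  have hw1 : w ^ (2 * m + 1) = 1 := by
    rw [hw, hconj, mul_pow, ← pow_mul, ← pow_mul, mul_comm a, mul_comm b, pow_mul, pow_mul,
      hprim.pow_eq_one, inv_pow, hprim.pow_eq_one]
    simp
  have hwne : w ≠ 1 := by
    intro h1
    rw [hw, hconj, inv_pow, mul_inv_eq_one₀ (pow_ne_zero _ hζ0)] at h1
    have := hprim.pow_inj (by omega) (by omega) h1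
    omega
  have hg := geom_sum_mul w (2 * m + 1)
  rw [hw1, sub_self] at hg
  rw [(mul_eq_zero.1 hg).resolve_right (sub_ne_zero.2 hwne)]
  simp

/-- The real part of the average of a form. -/
def realAvg (n m : ℕ) : Alt n (2 * m) →L[ℝ] Alt n (2 * m) :=
  (ContinuousLinearMap.compContinuousAlternatingMapCLM (ι := Fin (2 * m)) ℝ (Cn n) ℂ ℂ
    (Complex.ofRealCLM.comp Complex.reCLM)).comp (avg n m)

theorem realAvg_apply {n m : ℕ} (η : Alt n (2 * m)) (v : Fin (2 * m) → Cn n) :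
    realAvg n m η v = ((avg n m η v).re : ℂ) := rfl

theorem avg_eq_realAvg {n m : ℕ} (η : Alt n (2 * m)) :
    avg n m η = realAvg n m η + Complex.I • realAvg n m (-Complex.I • η) := by
  ext v
  rw [ContinuousAlternatingMap.add_apply, ContinuousAlternatingMap.smul_apply, realAvg_apply,
    realAvg_apply, avg_smul, ContinuousAlternatingMap.smul_apply]
  apply Complex.ext <;> simp

theorem realAvg_comp {n m : ℕ} (η : Alt n (2 * m)) (A : Cn n →L[ℂ] Cn n) :
    realAvg n m (η.compContinuousLinearMap (A.restrictScalars ℝ)) =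
      (realAvg n m η).compContinuousLinearMap (A.restrictScalars ℝ) := by
  ext v
  rw [realAvg_apply, avg_comp]
  rfl

theorem wedgeCov_conj {n k : ℕ} (θ : Cov n) (c : Alt n k) (v : Fin (k + 1) → Cn n) :
    starRingEnd ℂ (wedgeCov θ c v) = wedgeCov ((Complex.conjCLE : ℂ →L[ℝ] ℂ).comp θ)
      ((Complex.conjCLE : ℂ →L[ℝ] ℂ).compContinuousAlternatingMap c) v := by
  rw [wedgeCov_apply, wedgeCov_apply, map_sum]
  refine Finset.sum_congr rfl fun i _ => ?_
  simp

/-- Each factor iα ∧ ᾱ is real: conjugation turns -iᾱ ∧ α ∧ y into iα ∧ ᾱ ∧ ȳ. The induction peels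
off the first factor in these two forms. -/
theorem conj_toAlt_prod {n : ℕ} : ∀ (m : ℕ) (α : Fin m → (Cn n →L[ℂ] ℂ)),
    (Complex.conjCLE : ℂ →L[ℝ] ℂ).compContinuousAlternatingMap
      (toAlt n (2 * m) (List.ofFn fun a => ePos (α a)).prod) =
      toAlt n (2 * m) (List.ofFn fun a => ePos (α a)).prod := by
  intro m
  induction m with
  | zero =>
    intro α
    ext v
    have : toAlt n (2 * 0) (List.ofFn fun a => ePos (α a)).prod =
        (wedgeOne (fun i => i.elim0 : Fin 0 → Cov n) : Alt n 0) := by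
      rw [← toAlt_ιMulti]; simp
    rw [this]
    have hE : IsEmpty (Fin (2 * 0)) := inferInstanceAs (IsEmpty (Fin 0))
    rw [ContinuousLinearMap.compContinuousAlternatingMap_coe, Function.comp_apply, wedgeOne_apply]
    have hd : ∀ A : Matrix (Fin (2 * 0)) (Fin (2 * 0)) ℂ, Matrix.detRowAlternating A = 1 :=
      fun A => Matrix.det_isEmpty
    exact (congrArg (starRingEnd ℂ) (hd _)).trans ((map_one _).trans (hd _).symm)
  | succ m ih =>
    intro α
    have h1 : ∀ y : Ext n, (toAlt n (2 * (m + 1)) (ePos (α 0) * y) : Alt n (2 * m + 2)) =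
        Complex.I • wedgeCov (lin (α 0)) (wedgeCov (antilin (α 0)) (toAlt n (2 * m) y)) := by
      intro y
      rw [wedgeCov_toAlt, wedgeCov_toAlt, ← map_smul, ← mul_assoc, ← smul_mul_assoc]
      rfl
    have h2 : ∀ y : Ext n, (toAlt n (2 * (m + 1)) (ePos (α 0) * y) : Alt n (2 * m + 2)) =
        -Complex.I • wedgeCov (antilin (α 0)) (wedgeCov (lin (α 0)) (toAlt n (2 * m) y)) := by
      intro y
      rw [wedgeCov_toAlt, wedgeCov_toAlt, ← map_smul, ← mul_assoc, ← smul_mul_assoc, neg_smul,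
        ← smul_neg, ← ι_mul_swap]
      rfl
    have hl : (Complex.conjCLE : ℂ →L[ℝ] ℂ).comp (antilin (α 0)) = lin (α 0) := by
      ext v; simp
    rw [List.ofFn_succ, List.prod_cons]
    set y := (List.ofFn fun a : Fin m => ePos (α a.succ)).prod with hy
    have e : ∀ v, starRingEnd ℂ ((toAlt n (2 * (m + 1)) (ePos (α 0) * y) : Alt n (2 * m + 2)) v) =
        (toAlt n (2 * (m + 1)) (ePos (α 0) * y) : Alt n (2 * m + 2)) v := by
      intro v
      conv_rhs => rw [h1]
      rw [h2, ContinuousAlternatingMap.smul_apply, ContinuousAlternatingMap.smul_apply, smul_eq_mul,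
        smul_eq_mul, map_mul, wedgeCov_conj, hl, map_neg, Complex.conj_I, neg_neg]
      congr 2
      congr 1
      have := ih (fun a => α a.succ)
      rw [← hy] at this
      ext w
      have h3 := wedgeCov_conj (lin (α 0)) (toAlt n (2 * m) y) w
      rw [this] at h3
      exact h3
    ext v
    exact e v

theorem realAvg_strongGen {n m : ℕ} (t : ℂ) (α : Fin m → (Cn n →L[ℂ] ℂ)) :
    realAvg n m (t • strongGen α) = (t.re : ℂ) • strongGen α := by
  ext v
  rw [realAvg_apply, avg_smul, avg_strongGen, ContinuousAlternatingMap.smul_apply,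
    ContinuousAlternatingMap.smul_apply]
  have h1 := congrArg (fun η : Alt n (2 * m) => η v) (conj_toAlt_prod m α)
  rw [prod_ePos] at h1
  have h2 : (strongGen α v).im = 0 := Complex.conj_eq_iff_im.1 h1
  apply Complex.ext <;> simp [h2]



/-! ### Domination of forms -/

/-- By Riesz representation α_a = `ell (z a)`, and K = ∏ ‖z a‖² is the constant of `pow_dominates`.
For s ≥ 0 nothing has to be compensated. For s < 0 the sum is split as (-s)(K c^{-m} x^m - g) + K
c^{-m} (M + s) x^m, where g is the generator. -/
theorem exists_dominating_strongGen {n m : ℕ} (α : Fin m → (Cn n →L[ℂ] ℂ)) :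
    ∃ K : ℝ, 0 ≤ K ∧ ∀ (x : Ext n) (c : ℝ), 0 < c → x - (c : ℂ) • bExt n ∈ posCone n →
      ∀ (s M : ℝ), |s| ≤ M → StronglyPositive
        (((K * M / c ^ m : ℝ) : ℂ) • toAlt n (2 * m) (x ^ m) + (s : ℂ) • strongGen α) := by
  have hz : ∀ a, ∃ z : Cn n, ell z = α a := fun a =>
    ⟨(InnerProductSpace.toDual ℂ (Cn n)).symm (α a), by
      ext v
      simp⟩
  choose z hz using hz
  refine ⟨∏ a, ‖z a‖ ^ 2, Finset.prod_nonneg fun _ _ => by positivity, fun x c hc hx s M hs => ?_⟩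
  have hK : 0 ≤ ∏ a, ‖z a‖ ^ 2 := Finset.prod_nonneg fun _ _ => by positivity
  have h1 := stronglyPositive_of_mem (pow_dominates hc hx z)
  rw [map_sub, map_smul] at h1
  simp only [hz, prod_ePos] at h1
  have hprod : (∏ a, (‖z a‖ ^ 2 / c) : ℝ) = (∏ a, ‖z a‖ ^ 2) / c ^ m := by
    rw [Finset.prod_div_distrib]; simp
  rw [hprod] at h1
  have hxm : StronglyPositive (toAlt n (2 * m) (x ^ m)) := by
    apply stronglyPositive_of_mem
    have : x ∈ posCone n := by
      have := Submodule.add_mem _ hx (smul_mem_cone (bExt_mem n) hc.le)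
      simpa using this
    exact Submodule.pow_mem_pow _ this m
  have hsg : StronglyPositive (strongGen α) :=
    ⟨1, fun _ => 1, fun _ => α, fun _ => zero_le_one, by simp⟩
  generalize (∏ a, ‖z a‖ ^ 2) = K at *
  have hM : 0 ≤ M := (abs_nonneg s).trans hs
  rcases le_total 0 s with h | h
  · exact (hxm.smul (by positivity)).add (hsg.smul h)
  · have h2 : 0 ≤ M + s := by rw [abs_of_nonpos h] at hs; linarith
    convert (h1.smul (neg_nonneg.2 h)).add (hxm.smul (c := K * (M + s) / c ^ m) (by positivity))
      using 1
    have e : ((K * M / c ^ m : ℝ) : ℂ) = ((-s : ℝ) : ℂ) * ((K / c ^ m : ℝ) : ℂ) +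
        ((K * (M + s) / c ^ m : ℝ) : ℂ) := by
      push_cast; ring
    rw [e]
    generalize ((K / c ^ m : ℝ) : ℂ) = p
    push_cast
    ext v
    simp only [ContinuousAlternatingMap.add_apply, ContinuousAlternatingMap.smul_apply,
      ContinuousAlternatingMap.sub_apply, smul_eq_mul]
    ring

theorem realAvg_isOfType {n m a b : ℕ} (hab : a + b = 2 * m) (ha : a ≠ m) {η : Alt n (2 * m)}
    (h : IsOfType a b η) (t : ℂ) : realAvg n m (t • η) = 0 := by
  ext v
  rw [realAvg_apply, avg_smul, avg_isOfType hab ha h]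
  simp

/-- Powers of a form that dominates the standard one dominate all real forms. -/
theorem exists_dominating (n m : ℕ) : ∃ C : ℝ, 0 ≤ C ∧ ∀ (x : Ext n) (c : ℝ), 0 < c →
    x - (c : ℂ) • bExt n ∈ posCone n → ∀ (η : Alt n (2 * m)) (M : ℝ), ‖η‖ ≤ M →
      StronglyPositive (((C * M / c ^ m : ℝ) : ℂ) • toAlt n (2 * m) (x ^ m) + realAvg n m η) := by
  obtain ⟨N, L, e, he, hL⟩ := exists_decomposition n m
  have key : ∀ i, ∃ K : ℝ, 0 ≤ K ∧ ∀ (x : Ext n) (c : ℝ), 0 < c →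
      x - (c : ℂ) • bExt n ∈ posCone n → ∀ (t : ℂ) (M : ℝ), ‖t‖ ≤ M → StronglyPositive
        (((K * M / c ^ m : ℝ) : ℂ) • toAlt n (2 * m) (x ^ m) + realAvg n m (t • e i)) := by
    intro i
    rcases he i with ⟨α, hα⟩ | ⟨a, b, hab, ha, h⟩
    · obtain ⟨K, hK, h⟩ := exists_dominating_strongGen α
      refine ⟨K, hK, fun x c hc hx t M ht => ?_⟩
      rw [← hα, realAvg_strongGen]
      exact h x c hc hx _ _ ((Complex.abs_re_le_norm t).trans ht)
    · refine ⟨0, le_rfl, fun x c hc hx t M ht => ?_⟩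
      rw [realAvg_isOfType hab ha h]
      convert StronglyPositive.zero using 1
      ext v
      simp
  choose K hK h using key
  refine ⟨∑ i, K i * ‖L i‖, Finset.sum_nonneg fun i _ => mul_nonneg (hK i) (L i).opNorm_nonneg,
    fun x c hc hx η M hη => ?_⟩
  have h1 := StronglyPositive.sum Finset.univ fun i (_ : i ∈ Finset.univ) =>
    h i x c hc hx (L i η) (‖L i‖ * M) ((L i).le_opNorm_of_le hη)
  convert h1 using 1
  rw [Finset.sum_add_distrib, ← map_sum, ← hL η]
  congr 1
  ext v
  simp only [ContinuousAlternatingMap.smul_apply, ContinuousAlternatingMap.sum_apply, smul_eq_mul]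
  rw [← Finset.sum_mul, ← Complex.ofReal_sum, Finset.sum_mul, Finset.sum_div]
  congr 3
  funext i
  ring

/-! ### Test forms and positive currents -/

/-- The test function with given values. -/
def mkTest {E F : Type*} [NormedAddCommGroup E] [NormedSpace ℝ E] [NormedAddCommGroup F]
    [NormedSpace ℝ F] (f : E → F)
    (hf : ContDiff ℝ ∞ f) (hs : HasCompactSupport f) :
    𝓓((⊤ : TopologicalSpace.Opens E), F) where
  toFun := f
  contDiff' := hf
  hasCompactSupport' := hs
  tsupport_subset' := fun _ _ => trivial

@[simp]
theorem mkTest_apply {E F : Type*} [NormedAddCommGroup E] [NormedSpace ℝ E] [NormedAddCommGroup F]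
    [NormedSpace ℝ F] (f : E → F)
    (hf : ContDiff ℝ ∞ f) (hs : HasCompactSupport f) (z : E) : mkTest f hf hs z = f z := rfl

/-- Composition of a test form with a linear map. -/
def mapTest {n k l : ℕ} (L : Alt n k →L[ℝ] Alt n l) (η : TestForm n k) : TestForm n l :=
  mkTest (fun z => L (η z)) (L.contDiff.comp η.contDiff)
    (η.hasCompactSupport.comp_left (map_zero L))

@[simp]
theorem mapTest_apply {n k l : ℕ} (L : Alt n k →L[ℝ] Alt n l) (η : TestForm n k) (z : Cn n) :
    mapTest L η z = L (η z) := rfl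

/-- After decomposition into generators, averaging fixes the strongly positive pieces, while the
pieces of the other types are killed both by the average and by T. -/
theorem IsPositive.apply_avg {n m : ℕ} {T : TestForm n (2 * m) →ₗ[ℂ] ℂ} (hT : IsPositive T)
    (η : TestForm n (2 * m)) : T (mapTest (avg n m) η) = T η := by
  obtain ⟨N, L, e, he, hL⟩ := exists_decomposition n m
  let P : Fin N → (Alt n (2 * m) →L[ℝ] Alt n (2 * m)) :=
    fun i => ((L i).smulRight (e i)).restrictScalars ℝ
  have h1 : η = ∑ i, mapTest (P i) η := by
    ext1 z
    rw [sum_apply]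
    exact hL (η z)
  have h2 : mapTest (avg n m) η = ∑ i, mapTest ((avg n m).comp (P i)) η := by
    ext1 z
    rw [sum_apply]
    simp only [mapTest_apply, ContinuousLinearMap.comp_apply]
    rw [← map_sum]
    exact congrArg (avg n m) (hL (η z))
  conv_rhs => rw [h1]
  rw [h2, map_sum, map_sum]
  refine Finset.sum_congr rfl fun i _ => ?_
  rcases he i with ⟨α, hα⟩ | ⟨a, b, hab, ha, h⟩
  · congr 1
    ext1 z
    show avg n m (L i (η z) • e i) = L i (η z) • e i
    rw [avg_smul, ← hα, avg_strongGen]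
  · have e1 : mapTest ((avg n m).comp (P i)) η = 0 := by
      ext1 z
      show avg n m (L i (η z) • e i) = 0
      rw [avg_smul, avg_isOfType hab ha h]
      ext v
      simp
    rw [e1, map_zero]
    refine (hT.1 a b hab ha _ fun z t v => ?_).symm
    show L i (η z) * e i (fun j => t • v j) = _ * (L i (η z) * e i v)
    rw [h t v]
    ring

/-- Applied to c and -c, the hypothesis shows that T takes a real value of modulus at most T κ on
the real average of cη. The values c = 1 and c = -i recover the real and imaginary parts of the
average, whence the factor 2. -/
theorem IsPositive.norm_le {n m : ℕ} {T : TestForm n (2 * m) →ₗ[ℂ] ℂ} (hT : IsPositive T)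
    (η κ : TestForm n (2 * m))
    (h : ∀ (c : ℂ) (z : Cn n), ‖c‖ = 1 → StronglyPositive (κ z + realAvg n m (c • η z))) :
    ‖T η‖ ≤ 2 * (T κ).re := by
  have key : ∀ c : ℂ, ‖c‖ = 1 → ‖T (mapTest (realAvg n m) (c • η))‖ ≤ (T κ).re := by
    intro c hc
    have h1 := hT.2 (κ + mapTest (realAvg n m) (c • η)) fun z => h c z hc
    have h2 := hT.2 (κ - mapTest (realAvg n m) (c • η)) fun z => by
      have := h (-c) z (by rwa [norm_neg])
      have e : (-c) • η z = -(c • η z) := by ext v; simp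
      rw [e, map_neg, ← sub_eq_add_neg] at this
      exact this
    rw [map_add, Complex.add_re, Complex.add_im] at h1
    rw [map_sub, Complex.sub_re, Complex.sub_im] at h2
    have him : (T (mapTest (realAvg n m) (c • η))).im = 0 := by linarith [h1.2, h2.2]
    have : T (mapTest (realAvg n m) (c • η)) =
        (((T (mapTest (realAvg n m) (c • η))).re : ℝ) : ℂ) := by
      apply Complex.ext <;> simp [him]
    rw [this, Complex.norm_real, Real.norm_eq_abs, abs_le]
    constructor <;> linarith [h1.1, h2.1]
  have h1 : mapTest (avg n m) η = mapTest (realAvg n m) ((1 : ℂ) • η) +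
      Complex.I • mapTest (realAvg n m) ((-Complex.I) • η) := by
    ext1 z
    refine (avg_eq_realAvg (η z)).trans ?_
    rw [one_smul]
    rfl
  rw [← hT.apply_avg, h1, map_add, map_smul]
  refine (norm_add_le _ _).trans ?_
  rw [norm_smul, Complex.norm_I, one_mul]
  linarith [key 1 (by simp), key (-Complex.I) (by simp)]


/-! ### Test functions on the line -/

/-- Real test functions on the line. -/
abbrev TestFun : Type := 𝓓((⊤ : TopologicalSpace.Opens ℝ), ℝ)

/-- The derivative of a test function. -/
def derivTest (g : TestFun) : TestFun :=
  mkTest (deriv g) ((contDiff_infty_iff_deriv.1 g.contDiff).2) g.hasCompactSupport.deriv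

@[simp]
theorem derivTest_apply (g : TestFun) (x : ℝ) : derivTest g x = deriv g x := rfl

/-- A smooth step, which increases from `0` to `1` on `[a - δ, a]`. -/
def step (a δ v : ℝ) : ℝ := Real.smoothTransition ((v - a) / δ + 1)

theorem contDiff_step (a δ : ℝ) : ContDiff ℝ ∞ (step a δ) :=
  Real.smoothTransition.contDiff.comp (((contDiff_id.sub contDiff_const).div_const _).add
    contDiff_const)

theorem step_mono (a : ℝ) {δ : ℝ} (hδ : 0 < δ) : Monotone (step a δ) := by
  intro x y h
  apply Real.smoothTransition.monotone
  gcongr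

theorem step_nonneg (a δ v : ℝ) : 0 ≤ step a δ v := Real.smoothTransition.nonneg _

theorem step_le_one (a δ v : ℝ) : step a δ v ≤ 1 := Real.smoothTransition.le_one _

theorem step_eq_zero {a δ v : ℝ} (hδ : 0 < δ) (h : v ≤ a - δ) : step a δ v = 0 := by
  apply Real.smoothTransition.zero_of_nonpos
  have : (v - a) / δ ≤ -1 := by rw [div_le_iff₀ hδ]; linarith
  linarith

theorem step_eq_one {a δ v : ℝ} (hδ : 0 < δ) (h : a ≤ v) : step a δ v = 1 := by
  apply Real.smoothTransition.one_of_one_le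
  have : 0 ≤ (v - a) / δ := div_nonneg (by linarith) hδ.le
  linarith

theorem step_anti {a b δ : ℝ} (hδ : 0 < δ) (h : a ≤ b) (v : ℝ) : step b δ v ≤ step a δ v := by
  apply Real.smoothTransition.monotone
  gcongr

theorem deriv_step_nonneg (a : ℝ) {δ : ℝ} (hδ : 0 < δ) (v : ℝ) : 0 ≤ deriv (step a δ) v :=
  (step_mono a hδ).deriv_nonneg

theorem deriv_step_eq_zero {a δ v : ℝ} (hδ : 0 < δ) (h : v ∉ Icc (a - δ) a) :
    deriv (step a δ) v = 0 := by
  rw [mem_Icc, not_and_or, not_le, not_le] at h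
  rcases h with h | h
  · have : step a δ =ᶠ[𝓝 v] fun _ => 0 := by
      filter_upwards [Iio_mem_nhds h] with x hx
      exact step_eq_zero hδ (le_of_lt hx)
    rw [this.deriv_eq, deriv_const]
  · have : step a δ =ᶠ[𝓝 v] fun _ => 1 := by
      filter_upwards [Ioi_mem_nhds h] with x hx
      exact step_eq_one hδ (le_of_lt hx)
    rw [this.deriv_eq, deriv_const]

theorem continuous_deriv_step (a δ : ℝ) : Continuous (deriv (step a δ)) :=
  (contDiff_step a δ).continuous_deriv (by simp)

theorem hasCompactSupport_deriv_step (a : ℝ) {δ : ℝ} (hδ : 0 < δ) :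
    HasCompactSupport (deriv (step a δ)) :=
  HasCompactSupport.intro isCompact_Icc fun _ h => deriv_step_eq_zero hδ h

theorem integral_deriv_step (a : ℝ) {δ : ℝ} (hδ : 0 < δ) : ∫ v, deriv (step a δ) v = 1 := by
  have h1 : ∫ v in (a - δ - 1)..(a + 1), deriv (step a δ) v = 1 := by
    rw [intervalIntegral.integral_deriv_eq_sub
      (fun x _ => (contDiff_step a δ).differentiable (by simp) x)
      ((continuous_deriv_step a δ).intervalIntegrable _ _),
      step_eq_one hδ (by linarith), step_eq_zero hδ (by linarith), sub_zero]
  rw [← h1]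
  refine (intervalIntegral.integral_eq_integral_of_support_subset ?_).symm
  intro v hv
  by_contra h
  refine hv (deriv_step_eq_zero hδ fun h' => h ⟨?_, ?_⟩) <;> linarith [h'.1, h'.2]

/-- The test function that is `1` on `[a, b - δ]` and `0` off `[a - δ, b]`. -/
def plateau (a b : ℝ) {δ : ℝ} (hδ : 0 < δ) : TestFun :=
  mkTest (fun v => step a δ v - step b δ v) ((contDiff_step a δ).sub (contDiff_step b δ)) (by
    refine HasCompactSupport.intro (K := Icc (min a b - δ) (max a b)) isCompact_Icc fun v hv => ?_
    rw [mem_Icc, not_and_or, not_le, not_le] at hv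
    rcases hv with h | h
    · rw [step_eq_zero hδ (h.le.trans (sub_le_sub_right (min_le_left _ _) _)),
        step_eq_zero hδ (h.le.trans (sub_le_sub_right (min_le_right _ _) _)), sub_zero]
    · rw [step_eq_one hδ ((le_max_left _ _).trans h.le),
        step_eq_one hδ ((le_max_right _ _).trans h.le), sub_self])

theorem plateau_apply (a b : ℝ) {δ : ℝ} (hδ : 0 < δ) (v : ℝ) :
    plateau a b hδ v = step a δ v - step b δ v := rfl

theorem plateau_nonneg {a b δ : ℝ} (hδ : 0 < δ) (h : a ≤ b) (v : ℝ) : 0 ≤ plateau a b hδ v :=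
  sub_nonneg.2 (step_anti hδ h v)

theorem plateau_le_one (a b : ℝ) {δ : ℝ} (hδ : 0 < δ) (v : ℝ) : plateau a b hδ v ≤ 1 := by
  rw [plateau_apply]; linarith [step_le_one a δ v, step_nonneg b δ v]

theorem plateau_eq_one {a b δ v : ℝ} (hδ : 0 < δ) (h1 : a ≤ v) (h2 : v ≤ b - δ) :
    plateau a b hδ v = 1 := by
  rw [plateau_apply, step_eq_one hδ h1, step_eq_zero hδ h2, sub_zero]

theorem plateau_eq_zero_of_le {a b δ v : ℝ} (hδ : 0 < δ) (hab : a ≤ b) (h : v ≤ a - δ) :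
    plateau a b hδ v = 0 := by
  rw [plateau_apply, step_eq_zero hδ h, step_eq_zero hδ (by linarith), sub_zero]

theorem plateau_eq_zero_of_ge {a b δ v : ℝ} (hδ : 0 < δ) (hab : a ≤ b) (h : b ≤ v) :
    plateau a b hδ v = 0 := by
  rw [plateau_apply, step_eq_one hδ h, step_eq_one hδ (by linarith), sub_self]

theorem deriv_plateau (a b : ℝ) {δ : ℝ} (hδ : 0 < δ) (v : ℝ) :
    deriv (plateau a b hδ) v = deriv (step a δ) v - deriv (step b δ) v :=
  deriv_fun_sub ((contDiff_step a δ).differentiable (by simp) v)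
    ((contDiff_step b δ).differentiable (by simp) v)

/-! ### Distribution functions -/

/-- The left continuous distribution function of a measure. -/
def cdfL (μ : Measure ℝ) (v : ℝ) : ℝ := μ.real (Iio v)

theorem cdfL_nonneg (μ : Measure ℝ) (v : ℝ) : 0 ≤ cdfL μ v := ENNReal.toReal_nonneg

theorem cdfL_mono {μ : Measure ℝ} (hμ : ∀ v, μ (Iio v) < ⊤) : Monotone (cdfL μ) := fun _ b h =>
  ENNReal.toReal_mono (hμ b).ne (measure_mono (Iio_subset_Iio h))

theorem cdfL_eq_zero {μ : Measure ℝ} (h0 : μ (Iio 0) = 0) {v : ℝ} (hv : v ≤ 0) : cdfL μ v = 0 := by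
  rw [cdfL, measureReal_def, measure_mono_null (Iio_subset_Iio hv) h0]
  rfl

/-- Continuity of the measure from below along a sequence increasing to v. Open half-lines are used
because they correspond to the open balls in the definition of `nu`. -/
theorem tendsto_cdfL {μ : Measure ℝ} (hμ : ∀ v, μ (Iio v) < ⊤) (v : ℝ) :
    Tendsto (cdfL μ) (𝓝[<] v) (𝓝 (cdfL μ v)) := by
  have h1 := (cdfL_mono hμ).tendsto_nhdsLT v
  obtain ⟨u, hu1, hu2, hu3⟩ := exists_seq_strictMono_tendsto v
  have h2 : Tendsto (fun k => cdfL μ (u k)) atTop (𝓝 (sSup (cdfL μ '' Iio v))) :=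
    h1.comp (tendsto_nhdsWithin_iff.2 ⟨hu3, Eventually.of_forall hu2⟩)
  have h3 : Tendsto (fun k => cdfL μ (u k)) atTop (𝓝 (cdfL μ v)) := by
    have hU : ⋃ k, Iio (u k) = Iio v := by
      ext x
      simp only [mem_iUnion, mem_Iio]
      refine ⟨fun ⟨k, hk⟩ => hk.trans (hu2 k), fun hx => ?_⟩
      exact ((hu3.eventually (lt_mem_nhds hx)).exists)
    have := tendsto_measure_iUnion_atTop (μ := μ) (s := fun k => Iio (u k))
      (fun i j h => Iio_subset_Iio (hu1.monotone h))
    rw [hU] at this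
    exact (ENNReal.tendsto_toReal (hμ v).ne).comp this
  rwa [tendsto_nhds_unique h2 h3] at h1

theorem integrable_mul_of_monotone {h F : ℝ → ℝ} (hc : Continuous h) (hs : HasCompactSupport h)
    (hF : Monotone F) : Integrable (fun v => h v * F v) :=
  hF.locallyIntegrable.integrable_smul_left_of_hasCompactSupport hc hs

/-- Integration by parts against a measure on the line. -/
theorem integral_eq_neg_integral_deriv {μ : Measure ℝ} [SFinite μ] (hμ : ∀ v, μ (Iio v) < ⊤)
    {g : ℝ → ℝ} (hg : ContDiff ℝ 1 g) (hs : HasCompactSupport g) :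
    ∫ x, g x ∂μ = -∫ v, deriv g v * cdfL μ v := by
  have hgc : Continuous (deriv g) := hg.continuous_deriv le_rfl
  obtain ⟨C, hC⟩ := hgc.bounded_above_of_compact_support hs.deriv
  obtain ⟨M, hM⟩ := hs.deriv.isCompact.isBounded.subset_closedBall 0
  have hzero : ∀ v, v ∉ Icc (-M) M → deriv g v = 0 := by
    intro v hv
    apply image_eq_zero_of_notMem_tsupport
    intro h
    have := hM h
    rw [Real.closedBall_eq_Icc] at this
    simp only [zero_sub, zero_add] at this
    exact hv this
  -- Fubini's theorem for 1_{x < v} g'(v): integrating in v first gives -g(x), integrating in x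
  -- first gives g'(v) μ((-∞, v)).
  let f : ℝ → ℝ → ℝ := fun x v => (Ioi x).indicator (deriv g) v
  have hf : Function.uncurry f = {p : ℝ × ℝ | p.1 < p.2}.indicator (fun p => deriv g p.2) := by
    funext ⟨x, v⟩
    simp only [Function.uncurry, f, indicator, mem_Ioi, mem_ofPred_eq]
  have hmeas : MeasurableSet {p : ℝ × ℝ | p.1 < p.2} := measurableSet_lt measurable_fst measurable_snd
  have hint : Integrable (Function.uncurry f) (μ.prod volume) := by
    have hb : Integrable ((Iio M ×ˢ Icc (-M) M).indicator fun _ : ℝ × ℝ => C) (μ.prod volume) := by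
      rw [integrable_indicator_iff (measurableSet_Iio.prod measurableSet_Icc)]
      refine integrableOn_const ?_
      rw [Measure.prod_prod]
      exact (ENNReal.mul_lt_top (hμ M) (by simp)).ne
    refine hb.mono' ?_ (Eventually.of_forall fun ⟨x, v⟩ => ?_)
    · rw [hf]
      exact ((hgc.comp continuous_snd).aestronglyMeasurable).indicator hmeas
    · rw [hf]
      by_cases h : x < v
      · rw [indicator_of_mem (show (x, v) ∈ {p : ℝ × ℝ | p.1 < p.2} from h)]
        by_cases hv : v ∈ Icc (-M) M
        · rw [indicator_of_mem (show (x, v) ∈ Iio M ×ˢ Icc (-M) M from ⟨h.trans_le hv.2, hv⟩)]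
          exact hC v
        · simp only [hzero v hv, norm_zero]
          exact indicator_nonneg (fun _ _ => (norm_nonneg _).trans (hC 0)) _
      · rw [indicator_of_notMem (show (x, v) ∉ {p : ℝ × ℝ | p.1 < p.2} from h), norm_zero]
        exact indicator_nonneg (fun _ _ => (norm_nonneg _).trans (hC 0)) _
  have h1 : ∀ x, ∫ v, f x v = -g x := by
    intro x
    rw [integral_indicator measurableSet_Ioi]
    exact hs.integral_Ioi_deriv_eq hg x
  have h2 : ∀ v, ∫ x, f x v ∂μ = deriv g v * cdfL μ v := by
    intro v
    have : (fun x => f x v) = (Iio v).indicator fun _ => deriv g v := by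
      funext x
      simp only [f, indicator, mem_Ioi, mem_Iio]
    rw [this, integral_indicator_const _ measurableSet_Iio, smul_eq_mul, mul_comm]
    rfl
  have h3 := integral_integral_swap hint
  simp only [h1, h2] at h3
  rw [← h3, integral_neg, neg_neg]

theorem withDensity_Iio {w : ℝ → ℝ} (h0 : ∀ x, 0 ≤ w x) (hi : ∀ v, IntegrableOn w (Iio v))
    (v : ℝ) : volume.withDensity (fun x => ENNReal.ofReal (w x)) (Iio v) =
      ENNReal.ofReal (∫ x in Iio v, w x) := by
  rw [withDensity_apply _ measurableSet_Iio,
    ofReal_integral_eq_lintegral_ofReal (hi v) (Eventually.of_forall h0)]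

theorem cdfL_withDensity {w : ℝ → ℝ} (h0 : ∀ x, 0 ≤ w x) (hi : ∀ v, IntegrableOn w (Iio v))
    (v : ℝ) : cdfL (volume.withDensity fun x => ENNReal.ofReal (w x)) v = ∫ x in Iio v, w x := by
  rw [cdfL, measureReal_def, withDensity_Iio h0 hi, ENNReal.toReal_ofReal (integral_nonneg h0)]

theorem tendsto_setIntegral_Iio {w : ℝ → ℝ} (h0 : ∀ x, 0 ≤ w x) (hi : ∀ v, IntegrableOn w (Iio v))
    (v : ℝ) : Tendsto (fun v => ∫ x in Iio v, w x) (𝓝[<] v) (𝓝 (∫ x in Iio v, w x)) := by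
  have h := tendsto_cdfL (fun v => (withDensity_Iio h0 hi v).trans_lt ENNReal.ofReal_lt_top) v
  have e : (cdfL (volume.withDensity fun x => ENNReal.ofReal (w x))) = fun v => ∫ x in Iio v, w x :=
    funext fun v => cdfL_withDensity h0 hi v
  rwa [e] at h

theorem integral_mul_eq_neg_integral_deriv {w : ℝ → ℝ} (hw : Measurable w) (h0 : ∀ x, 0 ≤ w x)
    (hi : ∀ v, IntegrableOn w (Iio v)) {g : ℝ → ℝ} (hg : ContDiff ℝ 1 g)
    (hs : HasCompactSupport g) :
    ∫ x, g x * w x = -∫ v, deriv g v * ∫ x in Iio v, w x := by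
  have h := integral_eq_neg_integral_deriv
    (fun v => (withDensity_Iio h0 hi v).trans_lt ENNReal.ofReal_lt_top) hg hs
  rw [integral_withDensity_eq_integral_toReal_smul hw.ennreal_ofReal (by simp)] at h
  have e1 : ∀ x, (ENNReal.ofReal (w x)).toReal • g x = g x * w x := fun x => by
    rw [ENNReal.toReal_ofReal (h0 x), smul_eq_mul, mul_comm]
  simpa only [e1, cdfL_withDensity h0 hi] using h

/-! ### Positive functionals are measures -/

/-- Test functions as continuous functions with compact support. -/
def toCc : TestFun →ₗ[ℝ] CompactlySupportedContinuousMap ℝ ℝ where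
  toFun g := ⟨⟨g, g.continuous⟩, g.hasCompactSupport⟩
  map_add' _ _ := rfl
  map_smul' _ _ := rfl

theorem toCc_injective : Function.Injective toCc := by
  intro g h hgh
  ext1 x
  exact DFunLike.congr_fun hgh x

/-- M. Riesz's extension theorem extends the functional from test functions to continuous functions
with compact support, which are dominated by multiples of plateaus; the Riesz–Markov theorem then
gives μ. Plateaus supported in (-∞, 0] show that μ does not charge the negative half-line, and other
plateaus bound the mass of [0, v]. -/
theorem exists_measure (m : TestFun →ₗ[ℝ] ℝ) (hpos : ∀ g : TestFun, (∀ x, 0 ≤ g x) → 0 ≤ m g)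
    (hsupp : ∀ g : TestFun, (∀ x, 0 ≤ x → g x = 0) → m g = 0) :
    ∃ μ : Measure ℝ, SFinite μ ∧ (∀ v, μ (Iio v) < ⊤) ∧ μ (Iio 0) = 0 ∧
      ∀ g : TestFun, m g = ∫ x, g x ∂μ := by
  let E := CompactlySupportedContinuousMap ℝ ℝ
  let s : PointedCone ℝ E :=
    { carrier := {f | ∀ x, 0 ≤ f x}
      add_mem' := fun {a b} ha hb x => add_nonneg (ha x) (hb x)
      zero_mem' := fun x => le_rfl
      smul_mem' := fun c f hf x => mul_nonneg c.2 (hf x) }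
  let e := LinearEquiv.ofInjective toCc toCc_injective
  let f : E →ₗ.[ℝ] ℝ := ⟨LinearMap.range toCc, m.comp e.symm.toLinearMap⟩
  have hf : ∀ g : TestFun, f ⟨toCc g, ⟨g, rfl⟩⟩ = m g := by
    intro g
    have : e.symm ⟨toCc g, ⟨g, rfl⟩⟩ = g := by
      rw [LinearEquiv.symm_apply_eq]; rfl
    show m (e.symm ⟨toCc g, ⟨g, rfl⟩⟩) = m g
    rw [this]
  obtain ⟨Λ, hΛ1, hΛ2⟩ := riesz_extension s f (by
      rintro ⟨_, g, rfl⟩ hg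
      rw [hf]
      exact hpos g hg) (by
      intro y
      obtain ⟨C, hC⟩ := y.continuous.bounded_above_of_compact_support y.hasCompactSupport
      obtain ⟨M, hM0, hM⟩ := y.hasCompactSupport.isCompact.isBounded.subset_closedBall_lt 0 0
      refine ⟨⟨toCc (C • plateau (-M) (M + 1) one_pos), ⟨_, rfl⟩⟩, fun x => ?_⟩
      show 0 ≤ C * plateau (-M) (M + 1) one_pos x + y x
      have hC0 : 0 ≤ C := (norm_nonneg _).trans (hC 0)
      by_cases hx : x ∈ Icc (-M) M
      · rw [plateau_eq_one one_pos hx.1 (by linarith [hx.2]), mul_one]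
        linarith [neg_abs_le (y x), (Real.norm_eq_abs (y x)).symm.trans_le (hC x)]
      · have : y x = 0 := by
          apply image_eq_zero_of_notMem_tsupport
          intro h
          have := hM h
          rw [Real.closedBall_eq_Icc, zero_sub, zero_add] at this
          exact hx this
        rw [this, add_zero]
        exact mul_nonneg hC0 (plateau_nonneg one_pos (by linarith) x))
  let Λ' : E →ₚ[ℝ] ℝ := PositiveLinearMap.mk₀ Λ fun g hg => hΛ2 g hg
  let μ := RealRMK.rieszMeasure Λ'
  have hμ : ∀ g : TestFun, m g = ∫ x, g x ∂μ := by
    intro g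
    have h1 := RealRMK.integral_rieszMeasure Λ' (toCc g)
    have h2 := hΛ1 ⟨toCc g, ⟨g, rfl⟩⟩
    rw [hf] at h2
    rw [← h2]
    exact h1.symm
  have hle : ∀ (a b : ℝ) (g : TestFun), (∀ x, 0 ≤ g x) → (∀ x ∈ Icc a b, g x = 1) →
      μ (Icc a b) ≤ ENNReal.ofReal (m g) := by
    intro a b g hg0 hg1
    rw [hμ, ofReal_integral_eq_lintegral_ofReal
      (g.continuous.integrable_of_hasCompactSupport g.hasCompactSupport) (Eventually.of_forall hg0)]
    calc μ (Icc a b) = ∫⁻ x in Icc a b, 1 ∂μ := by simp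
      _ = ∫⁻ x in Icc a b, ENNReal.ofReal (g x) ∂μ := by
        refine setLIntegral_congr_fun measurableSet_Icc fun x hx => ?_
        rw [hg1 x hx, ENNReal.ofReal_one]
      _ ≤ _ := setLIntegral_le_lintegral _ _
  have h0 : μ (Iio 0) = 0 := by
    have hU : Iio (0 : ℝ) ⊆ ⋃ k : ℕ, Icc (-(k + 1 : ℝ)) (-(1 / (k + 1 : ℝ))) := by
      intro x hx
      rw [mem_Iio] at hx
      obtain ⟨k, hk⟩ := exists_nat_gt (max (-x) (1 / (-x)))
      have h1 := (le_max_left _ _).trans_lt hk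
      have h2 := (le_max_right _ _).trans_lt hk
      refine mem_iUnion.2 ⟨k, by linarith, ?_⟩
      rw [le_neg, one_div_le (by positivity) (by linarith)]
      linarith
    refine measure_mono_null hU (measure_iUnion_null fun k => ?_)
    have hk : (0 : ℝ) < 1 / (k + 1) := by positivity
    have hk1 : 1 / (k + 1 : ℝ) ≤ 1 := by
      rw [div_le_one (by positivity)]; linarith [Nat.cast_nonneg (α := ℝ) k]
    have h1 := hle (-(k + 1 : ℝ)) (-(1 / (k + 1 : ℝ))) (plateau (-(k + 1 : ℝ)) 0 hk)
      (plateau_nonneg hk (by linarith [Nat.cast_nonneg (α := ℝ) k]))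
      (fun x hx => plateau_eq_one hk hx.1 (by linarith [hx.2]))
    rw [hsupp _ fun x hx => plateau_eq_zero_of_ge hk (by linarith [Nat.cast_nonneg (α := ℝ) k]) hx,
      ENNReal.ofReal_zero] at h1
    exact le_antisymm h1 bot_le
  have hfin : ∀ v, μ (Iio v) < ⊤ := by
    intro v
    have h1 : Iio v ⊆ Iio 0 ∪ Icc 0 v := by
      intro x hx
      by_cases h : x < 0
      · exact Or.inl h
      · exact Or.inr ⟨not_lt.1 h, le_of_lt hx⟩
    refine (measure_mono h1).trans_lt ((measure_union_le _ _).trans_lt ?_)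
    rw [h0, zero_add]
    rcases lt_or_ge v 0 with hv | hv
    · simp [Icc_eq_empty (not_le.2 hv)]
    · exact (hle 0 v (plateau 0 (v + 1) one_pos) (plateau_nonneg one_pos (by linarith))
        fun x hx => plateau_eq_one one_pos hx.1 (by linarith [hx.2])).trans_lt ENNReal.ofReal_lt_top
  have hsig : SigmaFinite μ := by
    refine ⟨⟨⟨fun k : ℕ => Iio (k : ℝ), fun _ => trivial, fun k => hfin k, ?_⟩⟩⟩
    ext x
    simpa using exists_nat_gt x
  exact ⟨μ, inferInstance, hfin, h0, hμ⟩


/-! ### Test functions on the half-line -/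

/-- Real test functions on `(0, ∞)`. -/
abbrev PosFun : Type := 𝓓((⟨Ioi 0, isOpen_Ioi⟩ : TopologicalSpace.Opens ℝ), ℝ)

theorem PosFun.eventually_eq_zero (ψ : PosFun) {x : ℝ} (hx : x ≤ 0) : ψ =ᶠ[𝓝 x] fun _ => 0 := by
  have h : x ∉ tsupport ψ := fun h => (not_lt.2 hx) (ψ.tsupport_subset h)
  exact notMem_tsupport_iff_eventuallyEq.1 h

theorem PosFun.eq_zero (ψ : PosFun) {x : ℝ} (hx : x ≤ 0) : ψ x = 0 :=
  (ψ.eventually_eq_zero hx).self_of_nhds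

theorem PosFun.exists_pos (ψ : PosFun) : ∃ s : ℝ, 0 < s ∧ ∀ x ≤ s, ψ x = 0 := by
  rcases (tsupport ψ).eq_empty_or_nonempty with h | h
  · exact ⟨1, one_pos, fun x _ => image_eq_zero_of_notMem_tsupport (by rw [h]; exact fun h => h)⟩
  · obtain ⟨a, ha, hmin⟩ := ψ.hasCompactSupport.isCompact.exists_isLeast h
    have ha0 : 0 < a := ψ.tsupport_subset ha
    refine ⟨a / 2, by linarith, fun x hx => image_eq_zero_of_notMem_tsupport fun h => ?_⟩
    have := hmin h
    linarith

theorem PosFun.differentiable (ψ : PosFun) : Differentiable ℝ ψ :=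
  ψ.contDiff.differentiable (by simp)

theorem PosFun.contDiff_one (ψ : PosFun) : ContDiff ℝ 1 ψ := ψ.contDiff.of_le (by simp)

/-- A test function on the half-line as a test function on the line. -/
def mulInvPow (k : ℕ) : PosFun →ₗ[ℝ] TestFun where
  toFun ψ := mkTest (fun v => ψ v * (v ^ k)⁻¹) (by
      refine contDiff_iff_contDiffAt.2 fun x => ?_
      rcases le_or_gt x 0 with hx | hx
      · refine (contDiffAt_const (c := (0 : ℝ))).congr_of_eventuallyEq ?_
        filter_upwards [ψ.eventually_eq_zero hx] with y hy
        rw [hy, zero_mul]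
      · exact ψ.contDiff.contDiffAt.mul ((contDiffAt_id.pow k).inv (pow_ne_zero _ hx.ne')))
    ψ.hasCompactSupport.mul_right
  map_add' ψ φ := by
    ext1 x
    show (ψ x + φ x) * _ = ψ x * _ + φ x * _
    ring
  map_smul' c ψ := by
    ext1 x
    show (c * ψ x) * _ = c * (ψ x * _)
    ring

theorem mulInvPow_apply (k : ℕ) (ψ : PosFun) (v : ℝ) : mulInvPow k ψ v = ψ v * (v ^ k)⁻¹ := rfl

theorem deriv_mulInvPow (k : ℕ) (ψ : PosFun) (v : ℝ) :
    deriv (mulInvPow k ψ) v = deriv ψ v * (v ^ k)⁻¹ - k * (ψ v * (v ^ (k + 1))⁻¹) := by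
  rcases le_or_gt v 0 with hv | hv
  · have h1 := ψ.eventually_eq_zero hv
    have h2 : mulInvPow k ψ =ᶠ[𝓝 v] fun _ => 0 := by
      filter_upwards [h1] with y hy
      rw [mulInvPow_apply, hy, zero_mul]
    rw [h2.deriv_eq, h1.deriv_eq, ψ.eq_zero hv, deriv_const]
    ring
  · have h1 : HasDerivAt (fun v : ℝ => (v ^ k)⁻¹) (-(k * (v ^ (k + 1))⁻¹)) v := by
      refine ((hasDerivAt_pow k v).fun_inv (pow_ne_zero _ hv.ne')).congr_deriv ?_
      rcases k with _ | k
      · simp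
      · rw [Nat.add_sub_cancel]
        field_simp
        ring
    have h2 := ((ψ.differentiable v).hasDerivAt.mul h1).deriv
    have h3 : (mulInvPow k ψ : ℝ → ℝ) = (ψ : ℝ → ℝ) * fun v => (v ^ k)⁻¹ := rfl
    rw [h3, h2]
    ring

/-- The derivative of a test function on the half-line. -/
def derivPos (ψ : PosFun) : PosFun where
  toFun := deriv ψ
  contDiff' := (contDiff_infty_iff_deriv.1 ψ.contDiff).2
  hasCompactSupport' := ψ.hasCompactSupport.deriv
  tsupport_subset' := tsupport_deriv_subset.trans ψ.tsupport_subset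

theorem integrable_deriv_mul (k : ℕ) (ψ : PosFun) {F : ℝ → ℝ} (hF : Monotone F) :
    Integrable fun v => deriv ψ v * ((v ^ k)⁻¹ * F v) := by
  refine (integrable_mul_of_monotone (mulInvPow k (derivPos ψ)).continuous
    (mulInvPow k (derivPos ψ)).hasCompactSupport hF).congr (Eventually.of_forall fun v => ?_)
  show deriv ψ v * (v ^ k)⁻¹ * F v = _
  ring

theorem integrable_mul (k : ℕ) (ψ : PosFun) {F : ℝ → ℝ} (hF : Monotone F) :
    Integrable fun v => ψ v * (v ^ k)⁻¹ * F v :=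
  integrable_mul_of_monotone (mulInvPow k ψ).continuous (mulInvPow k ψ).hasCompactSupport hF

/-- The plateau function as a test function on the half-line. -/
def plateauPos (a b : ℝ) {δ : ℝ} (hδ : 0 < δ) (ha : δ < a) (hab : a ≤ b) : PosFun where
  toFun := plateau a b hδ
  contDiff' := (plateau a b hδ).contDiff
  hasCompactSupport' := (plateau a b hδ).hasCompactSupport
  tsupport_subset' := by
    refine (closure_minimal (fun v hv => ?_) isClosed_Ici : _ ⊆ Ici (a - δ)).trans fun x hx => ?_
    · by_contra h
      exact hv (plateau_eq_zero_of_le hδ hab (le_of_lt (not_le.1 h)))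
    · exact (sub_pos.2 ha).trans_le hx

/-! ### Monotone functions and test functions -/

/-- The derivative of `step a δ` is a probability density on [a - δ, a], so the integral is a mean
of F just to the left of a. The left side suits left continuous functions. -/
theorem integral_deriv_step_mul_le {F : ℝ → ℝ} {a δ c : ℝ} (hδ : 0 < δ)
    (hi : Integrable fun v => deriv (step a δ) v * F v)
    (hF : ∀ v, a - δ ≤ v → v ≤ a → F v ≤ c) : ∫ v, deriv (step a δ) v * F v ≤ c := by
  have h1 : ∫ v, deriv (step a δ) v * c = c := by
    rw [integral_mul_const, integral_deriv_step a hδ, one_mul]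
  rw [← h1]
  refine integral_mono hi (((continuous_deriv_step a δ).integrable_of_hasCompactSupport
    (hasCompactSupport_deriv_step a hδ)).mul_const c) fun v => ?_
  by_cases hv : v ∈ Icc (a - δ) a
  · exact mul_le_mul_of_nonneg_left (hF v hv.1 hv.2) (deriv_step_nonneg a hδ v)
  · simp only [deriv_step_eq_zero hδ hv, zero_mul, le_refl]

theorem le_integral_deriv_step_mul {F : ℝ → ℝ} {a δ c : ℝ} (hδ : 0 < δ)
    (hi : Integrable fun v => deriv (step a δ) v * F v)
    (hF : ∀ v, a - δ ≤ v → v ≤ a → c ≤ F v) : c ≤ ∫ v, deriv (step a δ) v * F v := by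
  have h := integral_deriv_step_mul_le (F := fun v => -F v) (c := -c) hδ
    (hi.neg.congr (Eventually.of_forall fun v => by simp)) fun v h1 h2 => neg_le_neg (hF v h1 h2)
  simp only [mul_neg, integral_neg] at h
  linarith

theorem neg_integral_deriv_plateau {F : ℝ → ℝ}
    (hi : ∀ a δ : ℝ, 0 < δ → δ < a → Integrable fun v => deriv (step a δ) v * F v)
    {a b δ : ℝ} (hδ : 0 < δ) (ha : δ < a) (hab : a ≤ b) :
    -∫ v, deriv (plateauPos a b hδ ha hab) v * F v =
      (∫ v, deriv (step b δ) v * F v) - ∫ v, deriv (step a δ) v * F v := by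
  have : ∀ v, deriv (plateauPos a b hδ ha hab) v * F v =
      deriv (step a δ) v * F v - deriv (step b δ) v * F v := fun v => by
    rw [← sub_mul, ← deriv_plateau a b hδ v]
    rfl
  simp only [this]
  rw [integral_sub (hi a δ hδ ha) (hi b δ hδ (ha.trans_le hab))]
  ring

/-- A left continuous function with nonnegative distributional derivative is monotone. -/
theorem monotone_of_integral_deriv {F : ℝ → ℝ}
    (hi : ∀ a δ : ℝ, 0 < δ → δ < a → Integrable fun v => deriv (step a δ) v * F v)
    (hleft : ∀ v, 0 < v → Tendsto F (𝓝[<] v) (𝓝 (F v)))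
    (hpos : ∀ ψ : PosFun, (∀ x, 0 ≤ ψ x) → 0 ≤ -∫ v, deriv ψ v * F v)
    {a b : ℝ} (ha : 0 < a) (hab : a ≤ b) : F a ≤ F b := by
  rcases hab.eq_or_lt with rfl | hlt
  · exact le_rfl
  by_contra! hcon
  have hε : 0 < (F a - F b) / 3 := by linarith
  have hb := ha.trans hlt
  have near : ∀ v : ℝ, 0 < v → ∃ δ₀ > 0, ∀ δ, 0 < δ → δ < δ₀ → ∀ x, v - δ ≤ x → x ≤ v →
      |F x - F v| < (F a - F b) / 3 := by
    intro v hv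
    have h1 := (Metric.tendsto_nhds.1 (hleft v hv)) _ hε
    rw [eventually_nhdsWithin_iff, Metric.eventually_nhds_iff] at h1
    obtain ⟨δ₀, h0, h1⟩ := h1
    refine ⟨δ₀, h0, fun δ hδ hδ0 x hx1 hx2 => ?_⟩
    rcases hx2.eq_or_lt with rfl | hx2
    · simpa using hε
    · refine h1 ?_ hx2
      rw [Real.dist_eq, abs_lt]
      constructor <;> linarith
  obtain ⟨δ₁, h1, hd1⟩ := near a ha
  obtain ⟨δ₂, h2, hd2⟩ := near b hb
  obtain ⟨δ, hδ, hδm⟩ := exists_between (show 0 < min δ₁ (min δ₂ a) by positivity)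
  simp only [lt_min_iff] at hδm
  -- On this plateau the hypothesis says that the mean of F just before b is at least its mean just
  -- before a, which contradicts F b < F a for small δ.
  have h3 := hpos (plateauPos a b hδ hδm.2.2 hab) fun x => plateau_nonneg hδ hab x
  rw [neg_integral_deriv_plateau hi hδ hδm.2.2 hab] at h3
  have h4 := integral_deriv_step_mul_le (c := F b + (F a - F b) / 3) hδ
    (hi b δ hδ (hδm.2.2.trans hlt)) fun v hv1 hv2 => by
      linarith [(abs_lt.1 (hd2 δ hδ hδm.2.1 v hv1 hv2)).2]
  have h5 := le_integral_deriv_step_mul (c := F a - (F a - F b) / 3) hδ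
    (hi a δ hδ hδm.2.2) fun v hv1 hv2 => by
      linarith [(abs_lt.1 (hd1 δ hδ hδm.1 v hv1 hv2)).1]
  linarith

/-- A positive functional controlled by the derivative of `F` is bounded by the oscillation
of `F`. -/
theorem le_sub_of_integral_deriv {F : ℝ → ℝ} {X : PosFun →ₗ[ℝ] ℝ} {c : ℝ}
    (hi : ∀ a δ : ℝ, 0 < δ → δ < a → Integrable fun v => deriv (step a δ) v * F v)
    (hmono : ∀ a b : ℝ, 0 < a → a ≤ b → F a ≤ F b) (hc : ∀ v, 0 < v → c ≤ F v)
    (hX : ∀ ψ : PosFun, (∀ x, 0 ≤ ψ x) → 0 ≤ X ψ)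
    (hXF : ∀ ψ : PosFun, (∀ x, 0 ≤ ψ x) → X ψ ≤ -∫ v, deriv ψ v * F v)
    {ψ : PosFun} (h1 : ∀ x, ψ x ≤ 1) {R R' : ℝ} (hR : 0 < R) (hR' : R' < R)
    (hψ : ∀ x, R' ≤ x → ψ x = 0) : X ψ ≤ F R - c := by
  obtain ⟨s, hs, hψs⟩ := ψ.exists_pos
  set a := min s R with ha
  have ha0 : 0 < a := lt_min hs hR
  obtain ⟨δ, hδ, hδm⟩ := exists_between (show 0 < min a (R - R') from lt_min ha0 (by linarith))
  rw [lt_min_iff] at hδm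
  have haR : a ≤ R := min_le_right _ _
  -- The plateau φ equals 1 wherever ψ may be positive, hence X ψ ≤ X φ, and on φ the derivative of
  -- F gives a difference of means of F near R and near a.
  set φ := plateauPos a R hδ hδm.1 haR
  have hφ0 : ∀ x, 0 ≤ φ x := fun x => plateau_nonneg hδ haR x
  have h2 : 0 ≤ X (φ - ψ) := by
    refine hX _ fun x => ?_
    show 0 ≤ φ x - ψ x
    rcases le_or_gt x a with hx | hx
    · rw [hψs x (hx.trans (min_le_left _ _)), sub_zero]
      exact hφ0 x
    · rcases le_or_gt R' x with hx' | hx'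
      · rw [hψ x hx', sub_zero]
        exact hφ0 x
      · have : φ x = 1 := plateau_eq_one hδ hx.le (by linarith)
        rw [this]
        linarith [h1 x]
  rw [map_sub] at h2
  have h3 := hXF φ hφ0
  rw [neg_integral_deriv_plateau hi hδ hδm.1 haR] at h3
  have h4 := integral_deriv_step_mul_le (c := F R) hδ (hi R δ hδ (hδm.1.trans_le haR))
    fun v hv1 hv2 => hmono v R (by linarith [hδm.1]) hv2
  have h5 := le_integral_deriv_step_mul (c := c) hδ (hi a δ hδ hδm.1)
    fun v hv1 hv2 => hc v (by linarith [hδm.1])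
  linarith

/-! ### The second primitive -/

/-- Integrating twice from the right end M of the support gives a second primitive that vanishes
beyond M. It need not vanish on the left, so it is cut off between -2 and -1; this does not alter it
on [0, ∞), where the values of |z|² lie. -/
theorem exists_deriv_deriv_eq (h : TestFun) : ∃ g : TestFun, ∀ x, 0 ≤ x →
    derivTest (derivTest g) x = h x := by
  obtain ⟨M, hM0, hM⟩ := h.hasCompactSupport.isCompact.isBounded.subset_closedBall_lt 0 0
  have hzero : ∀ x, M < x → h x = 0 := by
    intro x hx
    apply image_eq_zero_of_notMem_tsupport
    intro hx'
    have := hM hx'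
    rw [Real.closedBall_eq_Icc, zero_add] at this
    linarith [this.2]
  have prim : ∀ f : ℝ → ℝ, ContDiff ℝ ∞ f → (∀ x, M < x → f x = 0) →
      ∃ H : ℝ → ℝ, ContDiff ℝ ∞ H ∧ deriv H = f ∧ ∀ x, M < x → H x = 0 := by
    intro f hf hf0
    have hd : deriv (fun x => ∫ t in M..x, f t) = f :=
      funext fun x => hf.continuous.deriv_integral f M x
    refine ⟨fun x => ∫ t in M..x, f t, contDiff_infty_iff_deriv.2 ⟨fun x => ?_, by rwa [hd]⟩, hd,
      fun x hx => ?_⟩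
    · exact (hf.continuous.integral_hasStrictDerivAt M x).hasDerivAt.differentiableAt
    · refine (intervalIntegral.integral_congr_ae (g := fun _ => 0) ?_).trans (by simp)
      refine Eventually.of_forall fun t ht => ?_
      rw [uIoc_of_le hx.le] at ht
      exact hf0 t ht.1
  obtain ⟨H1, hH1, hd1, hz1⟩ := prim h h.contDiff hzero
  obtain ⟨H2, hH2, hd2, hz2⟩ := prim H1 hH1 hz1
  refine ⟨mkTest (fun v => step (-1) 1 v * H2 v) ((contDiff_step _ _).mul hH2)
    (HasCompactSupport.intro (K := Icc (-2) M) isCompact_Icc fun v hv => ?_), fun x hx => ?_⟩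
  · rw [mem_Icc, not_and_or, not_le, not_le] at hv
    rcases hv with hv | hv
    · rw [step_eq_zero one_pos (by linarith), zero_mul]
    · rw [hz2 v hv, mul_zero]
  · have hev : (fun v => step (-1) 1 v * H2 v) =ᶠ[𝓝 x] H2 := by
      filter_upwards [Ioi_mem_nhds (show (-1 : ℝ) < x by linarith)] with y hy
      rw [step_eq_one one_pos (le_of_lt hy), one_mul]
    show deriv (deriv fun v => step (-1) 1 v * H2 v) x = h x
    rw [hev.deriv.deriv_eq, hd2, hd1]

/-! ### Radial functionals -/

/-- The primitive of the distribution function of a measure. -/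
def cdfInt (ρ : Measure ℝ) (v : ℝ) : ℝ := ∫ x in Iio v, cdfL ρ x

theorem integrableOn_cdfL {ρ : Measure ℝ} (hρ : ∀ v, ρ (Iio v) < ⊤) (h0 : ρ (Iio 0) = 0) (v : ℝ) :
    IntegrableOn (cdfL ρ) (Iio v) := by
  have h1 : IntegrableOn (cdfL ρ) (Icc 0 v) :=
    (cdfL_mono hρ).locallyIntegrable.integrableOn_isCompact isCompact_Icc
  have h2 : IntegrableOn (cdfL ρ) (Iio 0) :=
    integrableOn_zero.congr_fun (fun x hx => (cdfL_eq_zero h0 (le_of_lt hx)).symm) measurableSet_Iio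
  refine (h2.union h1).mono_set fun x hx => ?_
  by_cases h : x < 0
  · exact Or.inl h
  · exact Or.inr ⟨not_lt.1 h, le_of_lt hx⟩

theorem setIntegral_Iio_mono {w : ℝ → ℝ} (h0 : ∀ x, 0 ≤ w x) (hi : ∀ v, IntegrableOn w (Iio v)) :
    Monotone fun v => ∫ x in Iio v, w x := fun _ b h =>
  setIntegral_mono_set (hi b) (Eventually.of_forall h0) (Iio_subset_Iio h).eventuallyLE

theorem cdfInt_mono {ρ : Measure ℝ} (hρ : ∀ v, ρ (Iio v) < ⊤) (h0 : ρ (Iio 0) = 0) :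
    Monotone (cdfInt ρ) :=
  setIntegral_Iio_mono (cdfL_nonneg ρ) (integrableOn_cdfL hρ h0)

theorem cdfInt_nonneg (ρ : Measure ℝ) (v : ℝ) : 0 ≤ cdfInt ρ v :=
  setIntegral_nonneg measurableSet_Iio fun x _ => cdfL_nonneg ρ x

theorem cdfInt_eq_zero {ρ : Measure ℝ} (h0 : ρ (Iio 0) = 0) {v : ℝ} (hv : v ≤ 0) :
    cdfInt ρ v = 0 :=
  setIntegral_eq_zero_of_forall_eq_zero fun _ hx => cdfL_eq_zero h0 ((le_of_lt hx).trans hv)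

/-- The relation `hrel` determines τ on second derivatives, and on [0, ∞) every test function is a
second derivative g''. One integration by parts in the μ-term and two in the ρ-term put all
derivatives on g''. -/
theorem tau_eq {μ ρ : Measure ℝ} [SFinite μ] [SFinite ρ] (hμ : ∀ v, μ (Iio v) < ⊤)
    (hμ0 : μ (Iio 0) = 0) (hρ : ∀ v, ρ (Iio v) < ⊤) (hρ0 : ρ (Iio 0) = 0) {τ : TestFun →ₗ[ℝ] ℝ}
    {ε : ℝ} (hτ0 : ∀ g : TestFun, (∀ x, 0 ≤ x → g x = 0) → τ g = 0)
    (hrel : ∀ g : TestFun, ∫ x, derivTest g x ∂μ + τ (derivTest (derivTest g)) = ε * ∫ x, g x ∂ρ)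
    (h : TestFun) : τ h = ∫ v, h v * (cdfL μ v + ε * cdfInt ρ v) := by
  obtain ⟨g, hg⟩ := exists_deriv_deriv_eq h
  have h1 : τ h = τ (derivTest (derivTest g)) := by
    rw [← sub_eq_zero, ← map_sub]
    refine hτ0 _ fun x hx => ?_
    show h x - derivTest (derivTest g) x = 0
    rw [hg x hx, sub_self]
  have hcd : ∀ g : TestFun, ContDiff ℝ 1 g := fun g => g.contDiff.of_le (by simp)
  have h2 := integral_eq_neg_integral_deriv hμ (hcd (derivTest g)) (derivTest g).hasCompactSupport
  have h3 := integral_eq_neg_integral_deriv hρ (hcd g) g.hasCompactSupport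
  have h4 := integral_mul_eq_neg_integral_deriv (cdfL_mono hρ).measurable (cdfL_nonneg ρ)
    (integrableOn_cdfL hρ hρ0) (hcd (derivTest g)) (derivTest g).hasCompactSupport
  have h5 := hrel g
  rw [h2, h3] at h5
  have h6 : ∫ v, h v * (cdfL μ v + ε * cdfInt ρ v) =
      ∫ v, (deriv (derivTest g) v * cdfL μ v + ε * (deriv (derivTest g) v * cdfInt ρ v)) := by
    refine integral_congr_ae (Eventually.of_forall fun v => ?_)
    show _ = deriv (derivTest g) v * cdfL μ v + ε * (deriv (derivTest g) v * cdfInt ρ v)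
    rcases le_total v 0 with hv | hv
    · simp only [cdfL_eq_zero hμ0 hv, cdfInt_eq_zero hρ0 hv]; ring
    · have := hg v hv
      rw [derivTest_apply] at this
      rw [this]; ring
  have hc := (derivTest (derivTest g)).continuous
  have hs := (derivTest (derivTest g)).hasCompactSupport
  have hi1 : Integrable fun v => deriv (derivTest g) v * cdfL μ v :=
    integrable_mul_of_monotone hc hs (cdfL_mono hμ)
  have hi2 : Integrable fun v => deriv (derivTest g) v * cdfInt ρ v :=
    integrable_mul_of_monotone hc hs (cdfInt_mono hρ hρ0)
  rw [h6, integral_add hi1 (hi2.const_mul ε), integral_const_mul, h1]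
  have h7 : ∫ v, deriv g v * cdfL ρ v = -∫ v, deriv (derivTest g) v * cdfInt ρ v := h4
  rw [h7] at h5
  linarith

/-- The functional `ψ ↦ ⟨T, ψ (u^{-k} β^p - k u^{-k-1} G)⟩`. -/
def XFun (m τ : TestFun →ₗ[ℝ] ℝ) (k : ℕ) : PosFun →ₗ[ℝ] ℝ :=
  m.comp (mulInvPow k) - (k : ℝ) • τ.comp (mulInvPow (k + 1))

/-- Differentiating v^{-k} in the integration by parts yields k ∫ ψ v^{-k-1} M, which cancels the
M-part of the τ-term. There remain the derivative of v^{-k} M and a term in ρ whose sign is that of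
-ε when ψ ≥ 0. -/
theorem XFun_eq {μ ρ : Measure ℝ} [SFinite μ] (hμ : ∀ v, μ (Iio v) < ⊤)
    (hρ : ∀ v, ρ (Iio v) < ⊤) (hρ0 : ρ (Iio 0) = 0) {m τ : TestFun →ₗ[ℝ] ℝ}
    {ε : ℝ} (hm : ∀ g : TestFun, m g = ∫ x, g x ∂μ)
    (hτ : ∀ h : TestFun, τ h = ∫ v, h v * (cdfL μ v + ε * cdfInt ρ v)) (k : ℕ) (ψ : PosFun) :
    XFun m τ k ψ = -(∫ v, deriv ψ v * ((v ^ k)⁻¹ * cdfL μ v)) -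
      ε * (k * ∫ v, ψ v * (v ^ (k + 1))⁻¹ * cdfInt ρ v) := by
  have h1 := integral_eq_neg_integral_deriv hμ ((mulInvPow k ψ).contDiff.of_le (by simp))
    (mulInvPow k ψ).hasCompactSupport
  have h2 : ∀ v, deriv (mulInvPow k ψ) v * cdfL μ v = deriv ψ v * ((v ^ k)⁻¹ * cdfL μ v) -
      k * (ψ v * (v ^ (k + 1))⁻¹ * cdfL μ v) := fun v => by rw [deriv_mulInvPow]; ring
  have h3 : ∀ v, mulInvPow (k + 1) ψ v * (cdfL μ v + ε * cdfInt ρ v) =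
      ψ v * (v ^ (k + 1))⁻¹ * cdfL μ v + ε * (ψ v * (v ^ (k + 1))⁻¹ * cdfInt ρ v) := fun v => by
    rw [mulInvPow_apply]; ring
  have i1 := integrable_deriv_mul k ψ (cdfL_mono hμ)
  have i2 := integrable_mul (k + 1) ψ (cdfL_mono hμ)
  have i3 := integrable_mul (k + 1) ψ (cdfInt_mono hρ hρ0)
  simp only [h2] at h1
  rw [integral_sub i1 (i2.const_mul _), integral_const_mul] at h1
  have h4 : XFun m τ k ψ = m (mulInvPow k ψ) - k * τ (mulInvPow (k + 1) ψ) := rfl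
  rw [h4, hm, hτ, h1]
  simp only [h3]
  rw [integral_add i2 (i3.const_mul _), integral_const_mul]
  ring

/-- The primitive of `x^{-k} ρ((-∞, x))`. -/
def cdfPowInt (ρ : Measure ℝ) (k : ℕ) (v : ℝ) : ℝ := ∫ x in Iio v, (x ^ k)⁻¹ * cdfL ρ x

theorem inv_pow_mul_cdfL_nonneg {ρ : Measure ℝ} (hρ0 : ρ (Iio 0) = 0) (k : ℕ) (x : ℝ) :
    0 ≤ (x ^ k)⁻¹ * cdfL ρ x := by
  rcases le_total x 0 with h | h
  · rw [cdfL_eq_zero hρ0 h, mul_zero]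
  · have := cdfL_nonneg ρ x
    positivity

/-- The integral of ψ v^{-k} `cdfL ρ` is integrated by parts in two ways: with `cdfL ρ` as the
derivative of `cdfInt ρ`, and with v^{-k} `cdfL ρ` as the derivative of `cdfPowInt ρ k`. -/
theorem integral_mul_cdfInt {ρ : Measure ℝ} (hρ : ∀ v, ρ (Iio v) < ⊤) (hρ0 : ρ (Iio 0) = 0)
    {k : ℕ} (hk : ∀ v, IntegrableOn (fun x => (x ^ k)⁻¹ * cdfL ρ x) (Iio v)) (ψ : PosFun) :
    k * ∫ v, ψ v * (v ^ (k + 1))⁻¹ * cdfInt ρ v =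
      (∫ v, deriv ψ v * ((v ^ k)⁻¹ * cdfInt ρ v)) - ∫ v, deriv ψ v * cdfPowInt ρ k v := by
  have h1 := integral_mul_eq_neg_integral_deriv (cdfL_mono hρ).measurable (cdfL_nonneg ρ)
    (integrableOn_cdfL hρ hρ0) ((mulInvPow k ψ).contDiff.of_le (by simp))
    (mulInvPow k ψ).hasCompactSupport
  have h2 := integral_mul_eq_neg_integral_deriv
    (((measurable_id.pow_const k).inv).mul (cdfL_mono hρ).measurable)
    (inv_pow_mul_cdfL_nonneg hρ0 k) hk ψ.contDiff_one ψ.hasCompactSupport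
  have h3 : ∀ v, deriv (mulInvPow k ψ) v * (∫ x in Iio v, cdfL ρ x) =
      deriv ψ v * ((v ^ k)⁻¹ * cdfInt ρ v) - k * (ψ v * (v ^ (k + 1))⁻¹ * cdfInt ρ v) := fun v => by
    rw [deriv_mulInvPow, cdfInt]; ring
  have i1 := integrable_deriv_mul k ψ (cdfInt_mono hρ hρ0)
  have i3 := integrable_mul (k + 1) ψ (cdfInt_mono hρ hρ0)
  simp only [h3] at h1
  rw [integral_sub i1 (i3.const_mul _), integral_const_mul] at h1
  have h4 : ∀ v, mulInvPow k ψ v * cdfL ρ v = ψ v * ((v ^ k)⁻¹ * cdfL ρ v) := fun v => by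
    rw [mulInvPow_apply]; ring
  simp only [h4] at h1
  have h5 : ∫ v, ψ v * ((v ^ k)⁻¹ * cdfL ρ v) = -∫ v, deriv ψ v * cdfPowInt ρ k v := h2
  linarith

theorem integrable_deriv_step_mul (k : ℕ) {F : ℝ → ℝ} (hF : Monotone F) {a δ : ℝ} (hδ : 0 < δ)
    (ha : δ < a) : Integrable fun v => deriv (step a δ) v * ((v ^ k)⁻¹ * F v) := by
  let ψ : PosFun :=
    { toFun := deriv (step a δ)
      contDiff' := (contDiff_infty_iff_deriv.1 (contDiff_step a δ)).2
      hasCompactSupport' := hasCompactSupport_deriv_step a hδ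
      tsupport_subset' := by
        refine (closure_minimal (fun v hv => ?_) isClosed_Icc : _ ⊆ Icc (a - δ) a).trans
          fun x hx => (sub_pos.2 ha).trans_le hx.1
        by_contra h
        exact hv (deriv_step_eq_zero hδ h) }
  refine (integrable_mul k ψ hF).congr (Eventually.of_forall fun v => ?_)
  show deriv (step a δ) v * (v ^ k)⁻¹ * F v = _
  ring

theorem tendsto_inv_pow_mul {F : ℝ → ℝ} {v : ℝ} (k : ℕ) (hv : 0 < v)
    (hF : Tendsto F (𝓝[<] v) (𝓝 (F v))) :
    Tendsto (fun v => (v ^ k)⁻¹ * F v) (𝓝[<] v) (𝓝 ((v ^ k)⁻¹ * F v)) := by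
  have : Tendsto (fun v : ℝ => (v ^ k)⁻¹) (𝓝[<] v) (𝓝 ((v ^ k)⁻¹)) :=
    (((continuous_id.pow k).tendsto v).inv₀ (pow_ne_zero _ hv.ne')).mono_left nhdsWithin_le_nhds
  exact this.mul hF

/-- The radial estimates for a plurisubharmonic current. -/
theorem radial_estimates_of_pos {μ ρ : Measure ℝ} [SFinite μ] (hμ : ∀ v, μ (Iio v) < ⊤)
    (hρ : ∀ v, ρ (Iio v) < ⊤) (hρ0 : ρ (Iio 0) = 0) {m τ : TestFun →ₗ[ℝ] ℝ}
    (hm : ∀ g : TestFun, m g = ∫ x, g x ∂μ)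
    (hτ : ∀ h : TestFun, τ h = ∫ v, h v * (cdfL μ v + 1 * cdfInt ρ v)) (k : ℕ)
    (hX : ∀ ψ : PosFun, (∀ x, 0 ≤ ψ x) → 0 ≤ XFun m τ k ψ) :
    (∀ a b : ℝ, 0 < a → a ≤ b → (a ^ k)⁻¹ * cdfL μ a ≤ (b ^ k)⁻¹ * cdfL μ b) ∧
    ∀ (c : ℝ), (∀ v, 0 < v → c ≤ (v ^ k)⁻¹ * cdfL μ v) → ∀ (ψ : PosFun), (∀ x, 0 ≤ ψ x) →
      (∀ x, ψ x ≤ 1) → ∀ R R' : ℝ, 0 < R → R' < R → (∀ x, R' ≤ x → ψ x = 0) →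
        XFun m τ k ψ ≤ (R ^ k)⁻¹ * cdfL μ R - c := by
  have hXF : ∀ ψ : PosFun, (∀ x, 0 ≤ ψ x) →
      XFun m τ k ψ ≤ -∫ v, deriv ψ v * ((v ^ k)⁻¹ * cdfL μ v) := by
    intro ψ hψ
    -- For ε = 1 the ρ-term is subtracted and nonnegative, so it can be dropped.
    rw [XFun_eq hμ hρ hρ0 hm hτ]
    have : 0 ≤ ∫ v, ψ v * (v ^ (k + 1))⁻¹ * cdfInt ρ v := by
      refine integral_nonneg fun v => ?_
      rcases le_total v 0 with h | h
      · show 0 ≤ ψ v * _ * _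
        rw [ψ.eq_zero h, zero_mul, zero_mul]
      · exact mul_nonneg (mul_nonneg (hψ v) (by positivity)) (cdfInt_nonneg ρ v)
    have hk : (0 : ℝ) ≤ k := Nat.cast_nonneg k
    nlinarith [mul_nonneg hk this]
  have hi := fun a δ (hδ : 0 < δ) (ha : δ < a) =>
    integrable_deriv_step_mul k (cdfL_mono hμ) hδ ha
  have hmono : ∀ a b : ℝ, 0 < a → a ≤ b → (a ^ k)⁻¹ * cdfL μ a ≤ (b ^ k)⁻¹ * cdfL μ b :=
    fun a b => monotone_of_integral_deriv (F := fun v => (v ^ k)⁻¹ * cdfL μ v) hi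
      (fun v hv => tendsto_inv_pow_mul k hv (tendsto_cdfL hμ v))
      (fun ψ hψ => (hX ψ hψ).trans (hXF ψ hψ))
  exact ⟨hmono, fun c hc ψ hψ0 hψ1 R R' hR hR' hψ =>
    le_sub_of_integral_deriv (F := fun v => (v ^ k)⁻¹ * cdfL μ v) hi hmono hc hX hXF hψ1 hR hR' hψ⟩

/-- The radial estimates for a plurisuperharmonic current. -/
theorem radial_estimates_of_neg {μ ρ : Measure ℝ} [SFinite μ] (hμ : ∀ v, μ (Iio v) < ⊤)
    (hρ : ∀ v, ρ (Iio v) < ⊤) (hρ0 : ρ (Iio 0) = 0) {m τ : TestFun →ₗ[ℝ] ℝ}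
    (hm : ∀ g : TestFun, m g = ∫ x, g x ∂μ)
    (hτ : ∀ h : TestFun, τ h = ∫ v, h v * (cdfL μ v + (-1) * cdfInt ρ v)) (k : ℕ)
    (hk : ∀ v, IntegrableOn (fun x => (x ^ k)⁻¹ * cdfL ρ x) (Iio v))
    (hX : ∀ ψ : PosFun, (∀ x, 0 ≤ ψ x) → 0 ≤ XFun m τ k ψ) {F : ℝ → ℝ}
    (hF : ∀ v, F v = (v ^ k)⁻¹ * cdfL μ v + (cdfPowInt ρ k v - (v ^ k)⁻¹ * cdfInt ρ v)) :
    (∀ a b : ℝ, 0 < a → a ≤ b → F a ≤ F b) ∧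
    ∀ (c : ℝ), (∀ v, 0 < v → c ≤ F v) → ∀ (ψ : PosFun),
      (∀ x, ψ x ≤ 1) → ∀ R R' : ℝ, 0 < R → R' < R → (∀ x, R' ≤ x → ψ x = 0) →
        XFun m τ k ψ ≤ F R - c := by
  have hQ : Monotone (cdfPowInt ρ k) := setIntegral_Iio_mono (inv_pow_mul_cdfL_nonneg hρ0 k) hk
  -- For ε = -1 the ρ-term has the wrong sign to be dropped; it is absorbed in F, and X is then
  -- exactly the derivative of F.
  have hXF : ∀ ψ : PosFun, XFun m τ k ψ = -∫ v, deriv ψ v * F v := by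
    intro ψ
    have i1 := integrable_deriv_mul k ψ (cdfL_mono hμ)
    have i2 := integrable_deriv_mul k ψ (cdfInt_mono hρ hρ0)
    have i3 : Integrable fun v => deriv ψ v * cdfPowInt ρ k v := by
      simpa using integrable_deriv_mul 0 ψ hQ
    rw [XFun_eq hμ hρ hρ0 hm hτ, integral_mul_cdfInt hρ hρ0 hk]
    have e : ∀ v, deriv ψ v * F v = deriv ψ v * ((v ^ k)⁻¹ * cdfL μ v) +
        (deriv ψ v * cdfPowInt ρ k v - deriv ψ v * ((v ^ k)⁻¹ * cdfInt ρ v)) := fun v => by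
      rw [hF]; ring
    simp only [e]
    have i4 : Integrable fun v => deriv ψ v * cdfPowInt ρ k v -
        deriv ψ v * ((v ^ k)⁻¹ * cdfInt ρ v) := i3.sub i2
    rw [integral_add i1 i4, integral_sub i3 i2]
    ring
  have hi : ∀ a δ : ℝ, 0 < δ → δ < a → Integrable fun v => deriv (step a δ) v * F v := by
    intro a δ hδ ha
    have i1 := integrable_deriv_step_mul k (cdfL_mono hμ) hδ ha
    have i2 := integrable_deriv_step_mul k (cdfInt_mono hρ hρ0) hδ ha
    have i3 := integrable_deriv_step_mul 0 hQ hδ ha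
    refine (i1.add (i3.sub i2)).congr (Eventually.of_forall fun v => ?_)
    simp only [Pi.add_apply, Pi.sub_apply, hF, pow_zero]
    ring
  have hleft : ∀ v, 0 < v → Tendsto F (𝓝[<] v) (𝓝 (F v)) := by
    intro v hv
    have e : F = fun v => (v ^ k)⁻¹ * cdfL μ v + (cdfPowInt ρ k v - (v ^ k)⁻¹ * cdfInt ρ v) :=
      funext hF
    rw [e]
    exact (tendsto_inv_pow_mul k hv (tendsto_cdfL hμ v)).add
      ((tendsto_setIntegral_Iio (inv_pow_mul_cdfL_nonneg hρ0 k) hk v).sub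
        (tendsto_inv_pow_mul k hv
          (tendsto_setIntegral_Iio (cdfL_nonneg ρ) (integrableOn_cdfL hρ hρ0) v)))
  have hmono : ∀ a b : ℝ, 0 < a → a ≤ b → F a ≤ F b :=
    fun a b => monotone_of_integral_deriv hi hleft fun ψ hψ => (hX ψ hψ).trans_eq (hXF ψ)
  exact ⟨hmono, fun c hc ψ hψ1 R R' hR hR' hψ =>
    le_sub_of_integral_deriv hi hmono hc hX (fun ψ _ => (hXF ψ).le) hψ1 hR hR' hψ⟩


/-! ### Radial test forms -/

/-- The form `z ↦ g(|z|²) c(z)`. -/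
def radialTest {n k : ℕ} (c : Cn n → Alt n k) (hc : ContDiff ℝ ∞ c) :
    TestFun →ₗ[ℝ] TestForm n k where
  toFun g := mkTest (fun z => ((g (‖z‖ ^ 2) : ℝ) : ℂ) • c z)
    ((Complex.ofRealCLM.contDiff.comp (g.contDiff.comp (contDiff_norm_sq ℝ))).smul hc) (by
      obtain ⟨M, hM⟩ := g.hasCompactSupport.isCompact.isBounded.subset_closedBall 0
      refine HasCompactSupport.intro (K := Metric.closedBall 0 (Real.sqrt M))
        (isCompact_closedBall _ _) fun z hz => ?_
      have : g (‖z‖ ^ 2) = 0 := by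
        apply image_eq_zero_of_notMem_tsupport
        intro h
        have h1 := hM h
        rw [mem_closedBall_zero_iff, Real.norm_eq_abs, abs_of_nonneg (by positivity)] at h1
        exact hz (mem_closedBall_zero_iff.2 (Real.le_sqrt_of_sq_le h1))
      rw [this]
      ext v
      simp)
  map_add' g h := by
    ext z v
    show ((g (‖z‖ ^ 2) + h (‖z‖ ^ 2) : ℝ) : ℂ) * c z v = (g (‖z‖ ^ 2) : ℂ) * c z v + (h (‖z‖ ^ 2) : ℂ) * c z v
    push_cast
    ring
  map_smul' a g := by
    ext z v
    show ((a * g (‖z‖ ^ 2) : ℝ) : ℂ) * c z v = a • ((g (‖z‖ ^ 2) : ℂ) * c z v)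
    rw [Complex.real_smul]
    push_cast
    ring

/-- The form `β^m`. -/
def betaPow (n m : ℕ) : Alt n (2 * m) :=
  toAlt n (2 * m) ((((1 / (2 * Real.pi)) ^ m : ℝ) : ℂ) • bExt n ^ m)

/-- The test form `g(|z|²) β^m`. -/
abbrev betaTest (n m : ℕ) : TestFun →ₗ[ℝ] TestForm n (2 * m) :=
  radialTest (fun _ => betaPow n m) contDiff_const

/-- The form `(2π)^{-(q+1)} i ∂|z|² ∧ ∂̄|z|² ∧ (2π β)^q`. -/
def gradForm (n q : ℕ) (z : Cn n) : Alt n (2 * (q + 1)) :=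
  toAlt n (2 * (q + 1)) ((((1 / (2 * Real.pi)) ^ (q + 1) : ℝ) : ℂ) • (ePos (ell z) * bExt n ^ q))

theorem contDiff_gradForm (n q : ℕ) : ContDiff ℝ ∞ (gradForm n q) := by
  have : gradForm n q = fun z => ∑ j, ∑ k, ((starRingEnd ℂ (z j)) * z k) •
      toAlt n (2 * (q + 1)) ((((1 / (2 * Real.pi)) ^ (q + 1) : ℝ) : ℂ) •
        (hPair (dz j) (dz k) * bExt n ^ q)) := by
    funext z
    rw [gradForm, ell_eq]
    simp only [ePos]
    rw [hPair_sum, Finset.sum_mul, Finset.smul_sum, map_sum]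
    refine Finset.sum_congr rfl fun j _ => ?_
    rw [Finset.sum_mul, Finset.smul_sum, map_sum]
    refine Finset.sum_congr rfl fun k _ => ?_
    rw [smul_mul_assoc, smul_comm, map_smul, Complex.conj_conj]
  rw [this]
  refine ContDiff.sum fun j _ => ContDiff.sum fun k _ => ?_
  exact ((Complex.conjCLE.contDiff.comp (contDiff_coord j)).mul (contDiff_coord k)).smul
    contDiff_const

/-- The test form `g(|z|²) (2π)^{-(q+1)} i ∂|z|² ∧ ∂̄|z|² ∧ (2π β)^q`. -/
abbrev gradTest (n q : ℕ) : TestFun →ₗ[ℝ] TestForm n (2 * (q + 1)) :=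
  radialTest (gradForm n q) (contDiff_gradForm n q)

/-- This is `ddcForm_radial` with the constant form β^q, which J^* fixes. Through this identity the
sign of dd^c T enters the radial estimates. -/
theorem ddcTest_betaTest (n q : ℕ) (g : TestFun) :
    ddcTest n (2 * q) (betaTest n q g) =
      betaTest n (q + 1) (derivTest g) + gradTest n q (derivTest (derivTest g)) := by
  ext1 x
  have hX : ExteriorAlgebra.map (covPull (cplxJ n))
      ((((1 / (2 * Real.pi)) ^ q : ℝ) : ℂ) • bExt n ^ q) =
      (((1 / (2 * Real.pi)) ^ q : ℝ) : ℂ) • bExt n ^ q := by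
    rw [map_smul, map_pow, bExt, map_sum]
    simp only [ePos, map_cplxJ_hPair]
  have hd : ∀ (h : TestFun) t, HasDerivAt h (derivTest h t) t := fun h t =>
    (h.contDiff.differentiable (by simp) t).hasDerivAt
  have h := ddcForm_radial (k := 2 * q) (x := x) (Eventually.of_forall (hd g))
    (hd (derivTest g) (‖x‖ ^ 2)) _ hX
  refine Eq.trans h ?_
  show _ = ((derivTest g (‖x‖ ^ 2) : ℝ) : ℂ) • betaPow n (q + 1) +
    ((derivTest (derivTest g) (‖x‖ ^ 2) : ℝ) : ℂ) • gradForm n q x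
  rw [betaPow, gradForm, ← map_smul, ← map_smul, ← map_add]
  show toAlt n (2 * (q + 1)) _ = _
  congr 1
  rw [add_mul, smul_mul_assoc, smul_mul_assoc, mul_smul_comm, mul_smul_comm, ← pow_succ']
  generalize ((derivTest g (‖x‖ ^ 2) : ℝ) : ℂ) = a
  generalize ((derivTest (derivTest g) (‖x‖ ^ 2) : ℝ) : ℂ) = a'
  push_cast
  module

/-- The functional `g ↦ Re ⟨T, g(|z|²) c⟩`. -/
def radialFun {n k : ℕ} (T : TestForm n k →ₗ[ℂ] ℂ) (c : Cn n → Alt n k) (hc : ContDiff ℝ ∞ c) :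
    TestFun →ₗ[ℝ] ℝ :=
  Complex.reLm.comp ((T.restrictScalars ℝ).comp (radialTest c hc))

theorem radialFun_apply {n k : ℕ} (T : TestForm n k →ₗ[ℂ] ℂ) (c : Cn n → Alt n k)
    (hc : ContDiff ℝ ∞ c) (g : TestFun) : radialFun T c hc g = (T (radialTest c hc g)).re := rfl

theorem radialFun_eq_zero {n k : ℕ} (T : TestForm n k →ₗ[ℂ] ℂ) {c : Cn n → Alt n k}
    (hc : ContDiff ℝ ∞ c) {g : TestFun} (hg : ∀ x, 0 ≤ x → g x = 0) : radialFun T c hc g = 0 := by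
  have : radialTest c hc g = 0 := by
    ext z v
    show ((g (‖z‖ ^ 2) : ℝ) : ℂ) * c z v = 0
    rw [hg _ (by positivity)]
    simp
  rw [radialFun_apply, this, map_zero, Complex.zero_re]

theorem stronglyPositive_betaPow (n m : ℕ) : StronglyPositive (betaPow n m) := by
  rw [betaPow, map_smul]
  exact (stronglyPositive_of_mem (Submodule.pow_mem_pow _ (bExt_mem n) m)).smul (by positivity)

theorem wedgePow_beta_eq {n : ℕ} (m : ℕ) (z : Cn n) : wedgePow (beta n z) m = betaPow n m :=
  wedgePow_beta z m

theorem alt_smul_nonneg_sub {n m : ℕ} {η : Alt n (2 * m)} (h : StronglyPositive η) {a b : ℝ}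
    (hab : b ≤ a) : StronglyPositive ((a : ℂ) • η - (b : ℂ) • η) := by
  convert h.smul (sub_nonneg.2 hab) using 1
  ext v
  simp [sub_mul]

/-- The trace measure of a positive current, pushed forward by `|z|²`. -/
theorem exists_trace_measure {n m : ℕ} {T : TestForm n (2 * m) →ₗ[ℂ] ℂ} (hT : IsPositive T) :
    ∃ μ : Measure ℝ, SFinite μ ∧ (∀ v, μ (Iio v) < ⊤) ∧ μ (Iio 0) = 0 ∧
      (∀ g : TestFun, (T (betaTest n m g)).re = ∫ x, g x ∂μ) ∧
      ∀ r : ℝ, 0 < r → traceIntegral T (Metric.ball 0 r) = cdfL μ (r ^ 2) := by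
  have hm0 : ∀ g : TestFun, (∀ x, 0 ≤ g x) → 0 ≤ radialFun T (fun _ => betaPow n m) contDiff_const g :=
    fun g hg => (hT.2 _ fun z => (stronglyPositive_betaPow n m).smul (hg _)).1
  obtain ⟨μ, hs, hfin, h0, hμ⟩ := exists_measure (radialFun T (fun _ => betaPow n m) contDiff_const) hm0
    fun g hg => radialFun_eq_zero T _ hg
  refine ⟨μ, hs, hfin, h0, hμ, fun r hr => ?_⟩
  have hr2 : 0 < r ^ 2 := by positivity
  have hae : ∀ᵐ x ∂μ, 0 ≤ x := by
    rw [ae_iff]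
    convert h0 using 2
    ext x; simp
  have hneg : posTrace (-T) (Metric.ball 0 r) = 0 := by
    rw [posTrace]
    refine le_antisymm (iSup₂_le fun η hη => ?_) bot_le
    obtain ⟨φ, hφ, -, hη⟩ := hη
    have := (hT.2 η fun z => by
      rw [hη, wedgePow_beta_eq]; exact (stronglyPositive_betaPow n m).smul (hφ z).1).1
    rw [LinearMap.neg_apply, Complex.neg_re, ENNReal.ofReal_of_nonpos (by linarith)]
  have hint : ∀ g : TestFun, Integrable g μ := by
    intro g
    have hfm : IsLocallyFiniteMeasure μ :=
      ⟨fun x => ⟨Iio (x + 1), Iio_mem_nhds (by linarith), hfin _⟩⟩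
    exact g.continuous.integrable_of_hasCompactSupport g.hasCompactSupport
  have hpos : posTrace T (Metric.ball 0 r) = μ (Iio (r ^ 2)) := by
    rw [posTrace]
    refine le_antisymm (iSup₂_le fun η hη => ?_) ?_
    · obtain ⟨φ, hφ, ⟨K, hK, hKU, hφK⟩, hη⟩ := hη
      -- The compact set K lies in a strictly smaller ball, so a radial plateau that vanishes for u
      -- ≥ r² still dominates every cut-off function supported in K.
      obtain ⟨R', hR', hKR⟩ : ∃ R' < r ^ 2, ∀ z ∈ K, ‖z‖ ^ 2 ≤ R' := by
        rcases K.eq_empty_or_nonempty with rfl | hne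
        · exact ⟨0, hr2, fun z hz => hz.elim⟩
        · obtain ⟨z₀, hz₀, hmax⟩ := hK.exists_isMaxOn hne
            (continuous_norm.pow 2).continuousOn
          refine ⟨‖z₀‖ ^ 2, ?_, fun z hz => hmax hz⟩
          have := mem_ball_zero_iff.1 (hKU hz₀)
          gcongr
      have hδ : 0 < r ^ 2 - R' := by linarith
      set g := plateau 0 (r ^ 2) hδ
      have h1 := (hT.2 (betaTest n m g - η) fun z => by
        show StronglyPositive (betaTest n m g z - η z)
        rw [hη, wedgePow_beta_eq]
        refine alt_smul_nonneg_sub (stronglyPositive_betaPow n m) ?_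
        by_cases hz : z ∈ K
        · have : g (‖z‖ ^ 2) = 1 := plateau_eq_one hδ (by positivity) (by linarith [hKR z hz])
          rw [this]
          exact (hφ z).2
        · rw [hφK z hz]
          exact plateau_nonneg hδ hr2.le _).1
      rw [map_sub, Complex.sub_re, sub_nonneg] at h1
      have h2 : (T (betaTest n m g)).re = ∫ x, g x ∂μ := hμ g
      rw [h2] at h1
      have h3 : ∫ x, g x ∂μ ≤ μ.real (Iio (r ^ 2)) := by
        have h4 : ∫ x, (Iio (r ^ 2)).indicator (fun _ => (1 : ℝ)) x ∂μ = μ.real (Iio (r ^ 2)) := by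
          rw [integral_indicator_const _ measurableSet_Iio]; simp
        rw [← h4]
        refine integral_mono (hint g) ((integrable_indicator_iff measurableSet_Iio).2
          (integrableOn_const (hfin _).ne)) fun x => ?_
        by_cases hx : x < r ^ 2
        · rw [indicator_of_mem (show x ∈ Iio (r ^ 2) from hx)]
          exact plateau_le_one _ _ hδ x
        · rw [indicator_of_notMem (show x ∉ Iio (r ^ 2) from hx)]
          exact (plateau_eq_zero_of_ge hδ hr2.le (not_lt.1 hx)).le
      exact ENNReal.ofReal_le_of_le_toReal (h1.trans h3)
    -- Conversely, radial plateaus equal to 1 on [0, s] with s < r² are admissible cut-offs, and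
    -- left continuity allows s → r².
    · have hlim := tendsto_cdfL hfin (r ^ 2)
      rw [← ENNReal.ofReal_toReal (hfin (r ^ 2)).ne]
      refine le_of_tendsto (ENNReal.tendsto_ofReal hlim) ?_
      filter_upwards [Ioo_mem_nhdsLT hr2] with s hs
      have hδ : 0 < (s + r ^ 2) / 2 - s := by linarith [hs.2]
      have hb : 0 ≤ (s + r ^ 2) / 2 := by linarith [hs.1]
      set g := plateau 0 ((s + r ^ 2) / 2) hδ with hg
      have h1 : cdfL μ s ≤ ∫ x, g x ∂μ := by
        have h4 : ∫ x, (Iio s).indicator (fun _ => (1 : ℝ)) x ∂μ = cdfL μ s := by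
          rw [integral_indicator_const _ measurableSet_Iio]; simp [cdfL]
        rw [← h4]
        refine integral_mono_ae ((integrable_indicator_iff measurableSet_Iio).2
          (integrableOn_const (hfin _).ne)) (hint g) ?_
        filter_upwards [hae] with x hx
        by_cases hxs : x < s
        · rw [indicator_of_mem (show x ∈ Iio s from hxs)]
          exact (plateau_eq_one hδ hx (by linarith)).ge
        · rw [indicator_of_notMem (show x ∉ Iio s from hxs)]
          exact plateau_nonneg hδ hb x
      refine (ENNReal.ofReal_le_ofReal h1).trans ?_
      rw [← hμ g]
      refine le_iSup₂_of_le (betaTest n m g) ⟨fun z => g (‖z‖ ^ 2), fun z =>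
        ⟨plateau_nonneg hδ hb _, plateau_le_one _ _ hδ _⟩,
        ⟨Metric.closedBall 0 (Real.sqrt ((s + r ^ 2) / 2)), isCompact_closedBall _ _,
          fun z hz => ?_, fun z hz => ?_⟩, fun z => ?_⟩ le_rfl
      · rw [mem_closedBall_zero_iff] at hz
        rw [mem_ball_zero_iff]
        refine hz.trans_lt ((Real.sqrt_lt' hr).2 (by linarith [hs.2]))
      · rw [mem_closedBall_zero_iff, not_le] at hz
        exact plateau_eq_zero_of_ge hδ hb (Real.lt_sq_of_sqrt_lt hz).le
      · rw [wedgePow_beta_eq]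
        rfl
  rw [traceIntegral, hneg, hpos]
  simp [cdfL, measureReal_def]

/-! ### Positivity of the radial functionals -/

/-- The form β - (2πu)⁻¹ i∂u ∧ ∂̄u is positive by Cauchy–Schwarz, and its (q + 1)-st power is
β^{q+1} - (q + 1) u⁻¹ G because the subtracted term has square zero. For k ≤ q + 1 the form is the
convex combination of this power and β^{q+1} with weights k/(q + 1) and 1 - k/(q + 1). -/
theorem stronglyPositive_sub_gradForm {n q k : ℕ} (hk : k ≤ q + 1) {z : Cn n} (hz : z ≠ 0) :
    StronglyPositive (betaPow n (q + 1) - ((k / ‖z‖ ^ 2 : ℝ) : ℂ) • gradForm n q z) := by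
  have hu : 0 < ‖z‖ ^ 2 := by positivity
  set u := ‖z‖ ^ 2 with hu_def
  have h1 : bExt n - ((1 / u : ℝ) : ℂ) • ePos (ell z) ∈ posCone n := by
    have := smul_mem_cone (norm_sq_smul_bExt_sub_mem z) (c := 1 / u) (by positivity)
    rw [smul_sub, smul_smul, ← hu_def, ← Complex.ofReal_mul, one_div_mul_cancel hu.ne',
      Complex.ofReal_one, one_smul] at this
    exact this
  have h2 := stronglyPositive_of_mem (Submodule.pow_mem_pow _ h1 (q + 1))
  have h3 := pow_sub_of_sq_zero (bExt_commute (ell z)) (hPair_self_sq (ell z) (ell z)) 1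
    ((1 / u : ℝ) : ℂ) q
  rw [one_smul, one_pow, one_pow, one_smul, mul_one] at h3
  rw [h3] at h2
  have hq : (0 : ℝ) < q + 1 := by positivity
  have h4 : 0 ≤ 1 - (k : ℝ) / (q + 1) := by
    rw [sub_nonneg, div_le_one hq]
    exact_mod_cast hk
  have h5 := ((stronglyPositive_betaPow n (q + 1)).smul h4).add
    (h2.smul (c := (k : ℝ) / (q + 1) * (1 / (2 * Real.pi)) ^ (q + 1)) (by positivity))
  convert h5 using 1
  rw [betaPow, gradForm, map_sub, map_smul, map_smul, map_smul]
  ext v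
  simp only [ContinuousAlternatingMap.add_apply, ContinuousAlternatingMap.smul_apply,
    ContinuousAlternatingMap.sub_apply, smul_eq_mul]
  have hq' : (q : ℂ) + 1 ≠ 0 := by exact_mod_cast hq.ne'
  push_cast
  field_simp
  ring

/-- The test form `ψ(u) (u^{-k} β^{q+1} - k u^{-k-1} G)` with `u = |z|²`. -/
def xTest (n q k : ℕ) : PosFun →ₗ[ℝ] TestForm n (2 * (q + 1)) :=
  (betaTest n (q + 1)).comp (mulInvPow k) - (k : ℝ) • (gradTest n q).comp (mulInvPow (k + 1))

theorem xTest_apply {n q k : ℕ} (ψ : PosFun) (z : Cn n) :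
    xTest n q k ψ z = ((ψ (‖z‖ ^ 2) * ((‖z‖ ^ 2) ^ k)⁻¹ : ℝ) : ℂ) • betaPow n (q + 1) -
      ((k * (ψ (‖z‖ ^ 2) * ((‖z‖ ^ 2) ^ (k + 1))⁻¹) : ℝ) : ℂ) • gradForm n q z := by
  ext v
  show _ - (k : ℝ) • (((ψ (‖z‖ ^ 2) * ((‖z‖ ^ 2) ^ (k + 1))⁻¹ : ℝ) : ℂ) * gradForm n q z v) = _
  rw [Complex.real_smul, ← mul_assoc, ← Complex.ofReal_mul]
  rfl

theorem re_xTest {n q k : ℕ} (T : TestForm n (2 * (q + 1)) →ₗ[ℂ] ℂ) (ψ : PosFun) :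
    (T (xTest n q k ψ)).re = XFun (radialFun T (fun _ => betaPow n (q + 1)) contDiff_const)
      (radialFun T (gradForm n q) (contDiff_gradForm n q)) k ψ := by
  have : ((T.restrictScalars ℝ) (xTest n q k ψ)).re =
    XFun (radialFun T (fun _ => betaPow n (q + 1)) contDiff_const)
      (radialFun T (gradForm n q) (contDiff_gradForm n q)) k ψ := by
    rw [xTest, LinearMap.sub_apply, map_sub, LinearMap.smul_apply, map_smul, Complex.sub_re,
      Complex.smul_re]
    rfl
  exact this

theorem stronglyPositive_xTest {n q k : ℕ} (hk : k ≤ q + 1) {ψ : PosFun} (hψ : ∀ x, 0 ≤ ψ x)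
    (z : Cn n) : StronglyPositive (xTest n q k ψ z) := by
  rw [xTest_apply]
  by_cases hz : z = 0
  · have : ψ (‖z‖ ^ 2) = 0 := ψ.eq_zero (by simp [hz])
    rw [this]
    convert StronglyPositive.zero using 1
    ext v
    simp
  · have hu : 0 < ‖z‖ ^ 2 := by positivity
    convert (stronglyPositive_sub_gradForm hk hz).smul
      (c := ψ (‖z‖ ^ 2) * ((‖z‖ ^ 2) ^ k)⁻¹) (mul_nonneg (hψ _) (by positivity)) using 1
    ext v
    simp only [ContinuousAlternatingMap.smul_apply, ContinuousAlternatingMap.sub_apply, smul_eq_mul]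
    have : ((‖z‖ : ℝ) : ℂ) ≠ 0 := by exact_mod_cast (norm_pos_iff.2 hz).ne'
    push_cast
    field_simp
    ring

theorem IsPositive.XFun_nonneg {n q k : ℕ} {T : TestForm n (2 * (q + 1)) →ₗ[ℂ] ℂ}
    (hT : IsPositive T) (hk : k ≤ q + 1) {ψ : PosFun} (hψ : ∀ x, 0 ≤ ψ x) :
    0 ≤ XFun (radialFun T (fun _ => betaPow n (q + 1)) contDiff_const)
      (radialFun T (gradForm n q) (contDiff_gradForm n q)) k ψ := by
  rw [← re_xTest]
  exact (hT.2 _ (stronglyPositive_xTest hk hψ)).1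

/-! ### The form `(β + dd^c log |z|²)^p` -/

/-- The test form `ψ(|z|²) (dd^c (|z|² + log |z|²))^{q+1}`. -/
def omegaTest (n q : ℕ) : PosFun →ₗ[ℝ] TestForm n (2 * (q + 1)) :=
  ∑ k ∈ Finset.range (q + 2), ((q + 1).choose k : ℝ) • xTest n q k

/-- The term in `ePos (ell z)` has square zero, so only the first two terms of the binomial
expansion survive. -/
theorem omegaPow_eq {n q : ℕ} (z : Cn n) :
    omegaPow (q + 1) z = (((1 + 1 / ‖z‖ ^ 2) ^ (q + 1) : ℝ) : ℂ) • betaPow n (q + 1) -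
      (((q + 1) * (1 + 1 / ‖z‖ ^ 2) ^ q * (1 / (‖z‖ ^ 2) ^ 2) : ℝ) : ℂ) • gradForm n q z := by
  rw [omegaPow, omegaExt, smul_pow,
    pow_sub_of_sq_zero (bExt_commute (ell z)) (hPair_self_sq (ell z) (ell z)), betaPow, gradForm,
    ← map_smul, ← map_smul, ← map_sub]
  congr 1
  rw [smul_sub]
  push_cast
  module

theorem sum_choose_mul_inv_pow (p : ℕ) (u : ℝ) :
    ∑ k ∈ Finset.range (p + 1), (p.choose k : ℝ) * (u ^ k)⁻¹ = (1 + 1 / u) ^ p := by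
  rw [add_comm 1 (1 / u), add_pow]
  refine Finset.sum_congr rfl fun k _ => ?_
  rw [one_pow, mul_one, one_div, inv_pow, mul_comm]

/-- Up to sign, this is the derivative in u of the binomial formula of `sum_choose_mul_inv_pow`. -/
theorem sum_choose_mul_mul_inv_pow (q : ℕ) (u : ℝ) :
    ∑ k ∈ Finset.range (q + 2), ((q + 1).choose k : ℝ) * (k * (u ^ (k + 1))⁻¹) =
      (q + 1) * (1 + 1 / u) ^ q * (1 / u ^ 2) := by
  rw [Finset.sum_range_succ', ← sum_choose_mul_inv_pow]
  simp only [Nat.cast_zero, zero_mul, mul_zero, add_zero, Finset.mul_sum, Finset.sum_mul]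
  refine Finset.sum_congr rfl fun k _ => ?_
  have h : ((q + 1).choose (k + 1) : ℝ) * ((k + 1 : ℕ) : ℝ) = (q + 1) * (q.choose k : ℝ) := by
    exact_mod_cast (Nat.add_one_mul_choose_eq q k).symm
  rw [← mul_assoc, h, pow_succ u (k + 1), pow_succ u k, pow_two, mul_inv, mul_inv, one_div, mul_inv]
  ring

/-- The power of the Kähler form is a nonnegative combination of the forms behind `xTest`, so its
mass can be estimated separately for each k. -/
theorem omegaTest_apply {n q : ℕ} (ψ : PosFun) (z : Cn n) :
    omegaTest n q ψ z = ((ψ (‖z‖ ^ 2) : ℝ) : ℂ) • omegaPow (q + 1) z := by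
  rw [omegaPow_eq, ← sum_choose_mul_inv_pow, ← sum_choose_mul_mul_inv_pow]
  ext v
  have h1 : omegaTest n q ψ z v =
      ∑ k ∈ Finset.range (q + 2), ((q + 1).choose k : ℝ) • xTest n q k ψ z v := by
    rw [omegaTest, LinearMap.sum_apply]
    simp only [sum_apply, ContinuousAlternatingMap.sum_apply]
    rfl
  rw [h1]
  simp only [xTest_apply, ContinuousAlternatingMap.smul_apply, ContinuousAlternatingMap.sub_apply,
    smul_eq_mul, Complex.real_smul]
  push_cast
  rw [mul_sub, Finset.sum_mul, Finset.sum_mul, Finset.mul_sum, Finset.mul_sum,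
    ← Finset.sum_sub_distrib]
  refine Finset.sum_congr rfl fun k _ => ?_
  ring

theorem re_omegaTest {n q : ℕ} (T : TestForm n (2 * (q + 1)) →ₗ[ℂ] ℂ) (ψ : PosFun) :
    (T (omegaTest n q ψ)).re = ∑ k ∈ Finset.range (q + 2), ((q + 1).choose k : ℝ) *
      (T (xTest n q k ψ)).re := by
  have : (T.restrictScalars ℝ (omegaTest n q ψ)).re = ∑ k ∈ Finset.range (q + 2),
      ((q + 1).choose k : ℝ) * (T (xTest n q k ψ)).re := by
    rw [omegaTest, LinearMap.sum_apply, map_sum, Complex.re_sum]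
    refine Finset.sum_congr rfl fun k _ => ?_
    rw [LinearMap.smul_apply, map_smul, Complex.smul_re]
    rfl
  exact this


/-! ### Lelong numbers -/

theorem extDeriv_sq {n k : ℕ} {η : Cn n → Alt n k} (h : ContDiff ℝ ∞ η) :
    extDeriv (extDeriv η) = 0 :=
  extDeriv_extDeriv (r := ∞) h (by
    rw [minSmoothness_of_isRCLikeNormedField]
    exact WithTop.coe_le_coe.2 (le_top : (2 : ℕ∞) ≤ ⊤))

/-- The form `ddcForm η` is exact, so its exterior derivative vanishes. It follows that -dd^c T is
dd^c-closed. -/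
theorem ddcTest_ddcTest {n k : ℕ} (η : TestForm n k) : ddcTest n (k + 2) (ddcTest n k η) = 0 := by
  ext1 x
  show ddcForm (ddcForm η) x = 0
  have h1 : ddcForm η = fun x => ((-(1 / (4 * Real.pi)) : ℝ) : ℂ) •
      extDeriv (fun y => pullJ (extDeriv η y)) x := rfl
  have h2 : extDeriv (ddcForm η) = 0 := by
    rw [h1, extDeriv_complex_smul]
    funext y
    have hcd : ContDiff ℝ ∞ (fun y => pullJ (extDeriv η y)) :=
      pullJ.contDiff.comp (contDiff_extDeriv η.contDiff)
    rw [extDeriv_sq hcd]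
    ext v
    simp
  rw [ddcForm, h2]
  have h3 : (fun y : Cn n => pullJ ((0 : Cn n → Alt n (k + 2 + 1)) y)) = fun _ => 0 := by
    funext y
    exact map_zero _
  rw [h3]
  have h4 : extDeriv (fun _ : Cn n => (0 : Alt n (k + 2 + 1))) x = 0 := by
    have := congrFun (extDeriv_complex_smul (0 : ℂ) (fun _ : Cn n => (0 : Alt n (k + 2 + 1)))) x
    have h5 : (fun _ : Cn n => (0 : ℂ) • (0 : Alt n (k + 2 + 1))) = fun _ => 0 := by
      ext y v
      simp
    rw [h5] at this
    rw [this]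
    ext v
    simp
  rw [h4]
  ext v
  simp

theorem traceIntegral_neg {n m : ℕ} (T : TestForm n (2 * m) →ₗ[ℂ] ℂ) (U : Set (Cn n)) :
    traceIntegral (-T) U = -traceIntegral T U := by
  rw [traceIntegral, traceIntegral, neg_neg]
  ring

theorem nu_neg {n m : ℕ} (T : TestForm n (2 * m) →ₗ[ℂ] ℂ) (r : ℝ) : nu (-T) r = -nu T r := by
  rw [nu, nu, traceIntegral_neg, neg_div]

/-- The radial measures of a positive current `T` and of `S`, if `dd^c T = ε S`. -/
theorem exists_radial_measures {n q : ℕ} {T : TestForm n (2 * (q + 1)) →ₗ[ℂ] ℂ} (hT : IsPositive T)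
    {S : TestForm n (2 * q) →ₗ[ℂ] ℂ} (hS : IsPositive S) {ε : ℝ} (hε : ddc T = (ε : ℂ) • S) :
    ∃ μ ρ : Measure ℝ, SFinite μ ∧ (∀ v, μ (Iio v) < ⊤) ∧ μ (Iio 0) = 0 ∧
      (∀ v, ρ (Iio v) < ⊤) ∧ ρ (Iio 0) = 0 ∧
      (∀ g : TestFun, radialFun T (fun _ => betaPow n (q + 1)) contDiff_const g = ∫ x, g x ∂μ) ∧
      (∀ h : TestFun, radialFun T (gradForm n q) (contDiff_gradForm n q) h =
        ∫ v, h v * (cdfL μ v + ε * cdfInt ρ v)) ∧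
      (∀ r : ℝ, 0 < r → nu T r = ((r ^ 2) ^ (q + 1))⁻¹ * cdfL μ (r ^ 2)) ∧
      (∀ r : ℝ, 0 < r → nu S r = ((r ^ 2) ^ q)⁻¹ * cdfL ρ (r ^ 2)) := by
  obtain ⟨μ, hμs, hμ, hμ0, hμT, hμr⟩ := exists_trace_measure hT
  obtain ⟨ρ, hρs, hρ, hρ0, hρS, hρr⟩ := exists_trace_measure hS
  refine ⟨μ, ρ, hμs, hμ, hμ0, hρ, hρ0, hμT, fun h => ?_, fun r hr => ?_, fun r hr => ?_⟩
  · refine tau_eq hμ hμ0 hρ hρ0 (fun g hg => radialFun_eq_zero T _ hg) (fun g => ?_) h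
    have h1 : ddc T (betaTest n q g) = (ε : ℂ) * S (betaTest n q g) := by rw [hε]; rfl
    have h2 : ddc T (betaTest n q g) = T (betaTest n (q + 1) (derivTest g)) +
        T (gradTest n q (derivTest (derivTest g))) := by
      rw [← map_add, ← ddcTest_betaTest]; rfl
    rw [h2] at h1
    have h3 := congrArg Complex.re h1
    rw [Complex.add_re, Complex.re_ofReal_mul, hμT, hρS] at h3
    exact h3
  · rw [nu, hμr r hr, ← pow_mul, div_eq_inv_mul]
  · rw [nu, hρr r hr, ← pow_mul, div_eq_inv_mul]

/-- The case k = q + 1 of the radial estimates. In the superharmonic case it is applied to -dd^c T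
in place of T. -/
theorem nu_mono {n q : ℕ} {T : TestForm n (2 * (q + 1)) →ₗ[ℂ] ℂ} (hT : IsPositive T)
    (hdd : IsPositive (ddc T)) {a b : ℝ} (ha : 0 < a) (hab : a ≤ b) : nu T a ≤ nu T b := by
  obtain ⟨μ, ρ, hμs, hμ, hμ0, hρ, hρ0, hm, hτ, hν, -⟩ :=
    exists_radial_measures hT hdd (ε := 1) (by simp)
  rw [hν a ha, hν b (ha.trans_le hab)]
  exact (radial_estimates_of_pos hμ hρ hρ0 hm hτ (q + 1) fun ψ hψ =>
    hT.XFun_nonneg le_rfl hψ).1 _ _ (by positivity) (by gcongr)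

theorem tendsto_sq_nhdsGT : Tendsto (fun r : ℝ => r ^ 2) (𝓝[>] 0) (𝓝[>] 0) := by
  refine tendsto_nhdsWithin_iff.2 ⟨?_, ?_⟩
  · have : Tendsto (fun r : ℝ => r ^ 2) (𝓝 0) (𝓝 (0 ^ 2)) := (continuous_pow 2).tendsto 0
    rw [zero_pow two_ne_zero] at this
    exact this.mono_left nhdsWithin_le_nhds
  · filter_upwards [self_mem_nhdsWithin] with r hr
    have : (0 : ℝ) < r := hr
    exact pow_pos this 2

theorem exists_limit_of_mono {F : ℝ → ℝ} (hmono : ∀ a b : ℝ, 0 < a → a ≤ b → F a ≤ F b)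
    (h0 : ∀ v, 0 < v → 0 ≤ F v) :
    ∃ c, Tendsto F (𝓝[>] 0) (𝓝 c) ∧ ∀ v, 0 < v → c ≤ F v := by
  have hbdd : BddBelow (F '' Ioi 0) := ⟨0, by rintro _ ⟨v, hv, rfl⟩; exact h0 v hv⟩
  refine ⟨sInf (F '' Ioi 0), MonotoneOn.tendsto_nhdsGT (fun a ha b _ hab => hmono a b ha hab) hbdd,
    fun v hv => csInf_le hbdd ⟨v, hv, rfl⟩⟩

/-- For v ≤ 1 the mass `cdfL μ v` is at most v^p F(1). So the current has no trace mass at the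
origin, which is needed for π_* of the limit to be T itself. -/
theorem tendsto_cdfL_zero {μ : Measure ℝ} {p : ℕ} (hp : p ≠ 0) {F : ℝ → ℝ}
    (hF : ∀ v, 0 < v → (v ^ p)⁻¹ * cdfL μ v ≤ F v)
    (hmono : ∀ a b : ℝ, 0 < a → a ≤ b → F a ≤ F b) : Tendsto (cdfL μ) (𝓝[>] 0) (𝓝 0) := by
  have h1 : Tendsto (fun v : ℝ => v ^ p * F 1) (𝓝[>] 0) (𝓝 0) := by
    have : Tendsto (fun v : ℝ => v ^ p * F 1) (𝓝 0) (𝓝 (0 ^ p * F 1)) :=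
      ((continuous_pow p).tendsto 0).mul_const _
    rw [zero_pow hp, zero_mul] at this
    exact this.mono_left nhdsWithin_le_nhds
  refine tendsto_of_tendsto_of_tendsto_of_le_of_le' tendsto_const_nhds h1
    (Eventually.of_forall fun v => cdfL_nonneg μ v) ?_
  filter_upwards [Ioc_mem_nhdsGT one_pos] with v hv
  have h2 := (hF v hv.1).trans (hmono v 1 hv.1 hv.2)
  have hvp : 0 < v ^ p := pow_pos hv.1 p
  rwa [inv_mul_le_iff₀ hvp] at h2

/-- The k-th term of the Kähler power carries r^{2(p-k)}; reversing the order of summation gives the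
sums from 1 to p that define C_r and C'_r. -/
theorem sum_range_choose_reflect (p : ℕ) (f : ℕ → ℝ) :
    ∑ k ∈ Finset.range p, (p.choose k : ℝ) * f (p - k) =
      ∑ k ∈ Finset.Icc 1 p, (p.choose k : ℝ) * f k := by
  refine Finset.sum_nbij' (fun k => p - k) (fun k => p - k) ?_ ?_ ?_ ?_ ?_
  · intro k hk; simp only [Finset.mem_range, Finset.mem_Icc] at *; omega
  · intro k hk; simp only [Finset.mem_range, Finset.mem_Icc] at *; omega
  · intro k hk; simp only [Finset.mem_range] at *; omega
  · intro k hk; simp only [Finset.mem_Icc] at *; omega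
  · intro k hk
    simp only [Finset.mem_range] at hk
    rw [Nat.choose_symm hk.le]

/-- Estimates for a positive plurisubharmonic current. -/
theorem estimates_of_psh {n q : ℕ} {T : TestForm n (2 * (q + 1)) →ₗ[ℂ] ℂ} (hT : IsPositive T)
    (hdd : IsPositive (ddc T)) : ∃ (ν₀ : ℝ) (μ : Measure ℝ), (∀ v, μ (Iio v) < ⊤) ∧
      Tendsto (nu T) (𝓝[>] 0) (𝓝 ν₀) ∧
      (∀ g : TestFun, (T (betaTest n (q + 1) g)).re = ∫ x, g x ∂μ) ∧
      Tendsto (cdfL μ) (𝓝[>] 0) (𝓝 0) ∧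
      ∀ r : ℝ, 0 < r → ∀ ψ : PosFun, (∀ x, 0 ≤ ψ x) → (∀ x, ψ x ≤ 1) →
        ∀ R' < r ^ 2, (∀ x, R' ≤ x → ψ x = 0) → (T (omegaTest n q ψ)).re ≤ nu T r - ν₀ +
          (∑ k ∈ Finset.Icc 1 (q + 1), ((q + 1).choose k : ℝ) * r ^ (2 * k)) * nu T r := by
  obtain ⟨μ, ρ, hμs, hμ, hμ0, hρ, hρ0, hm, hτ, hν, -⟩ :=
    exists_radial_measures hT hdd (ε := 1) (by simp)
  have hest := fun k (hk : k ≤ q + 1) => radial_estimates_of_pos hμ hρ hρ0 hm hτ k fun ψ hψ =>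
    hT.XFun_nonneg hk hψ
  have hmono := (hest (q + 1) le_rfl).1
  have hnn : ∀ (k : ℕ) v, 0 < v → 0 ≤ (v ^ k)⁻¹ * cdfL μ v := fun k v hv =>
    mul_nonneg (by positivity) (cdfL_nonneg μ v)
  obtain ⟨ν₀, hlim, hν₀⟩ := exists_limit_of_mono (F := fun v => (v ^ (q + 1))⁻¹ * cdfL μ v) hmono
    (hnn _)
  refine ⟨ν₀, μ, hμ, ?_, hm, tendsto_cdfL_zero (Nat.succ_ne_zero q) (fun v _ => le_rfl) hmono,
    fun r hr ψ hψ0 hψ1 R' hR' hψR => ?_⟩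
  · refine (hlim.comp tendsto_sq_nhdsGT).congr' ?_
    filter_upwards [self_mem_nhdsWithin] with r hr
    exact (hν r hr).symm
  · have hr2 : 0 < r ^ 2 := by positivity
    rw [re_omegaTest, Finset.sum_range_succ, Nat.choose_self, Nat.cast_one, one_mul]
    -- The top term is the only one in which the limit at 0 is subtracted.
    have h1 : (T (xTest n q (q + 1) ψ)).re ≤ nu T r - ν₀ := by
      rw [re_xTest, hν r hr]
      exact (hest (q + 1) le_rfl).2 ν₀ hν₀ ψ hψ0 hψ1 _ _ hr2 hR' hψR
    -- For k < q + 1 the lower bound 0 suffices, and u^{-k} times the mass of the ball is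
    -- r^{2(q+1-k)} ν_T(r) at u = r².
    have h2 : ∀ k ∈ Finset.range (q + 1), ((q + 1).choose k : ℝ) * (T (xTest n q k ψ)).re ≤
        ((q + 1).choose k : ℝ) * (r ^ (2 * (q + 1 - k)) * nu T r) := by
      intro k hk
      have hk' : k ≤ q + 1 := (Finset.mem_range.1 hk).le
      refine mul_le_mul_of_nonneg_left ?_ (Nat.cast_nonneg _)
      have h3 := (hest k hk').2 0 (hnn k) ψ hψ0 hψ1 _ _ hr2 hR' hψR
      rw [re_xTest]
      refine h3.trans_eq ?_
      have e : (r ^ 2) ^ (q + 1) = (r ^ 2) ^ (q + 1 - k) * (r ^ 2) ^ k := by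
        rw [← pow_add, Nat.sub_add_cancel hk']
      rw [hν r hr, sub_zero, pow_mul, e]
      field_simp
    refine (add_le_add (Finset.sum_le_sum h2) h1).trans_eq ?_
    rw [sum_range_choose_reflect (q + 1) fun j => r ^ (2 * j) * nu T r, Finset.sum_mul, add_comm]
    simp only [mul_assoc]



/-! ### Plurisuperharmonic currents -/

theorem image_sq_Ioo {r : ℝ} (hr : 0 < r) : (fun t : ℝ => t ^ 2) '' Ioo 0 r = Ioo 0 (r ^ 2) := by
  ext x
  constructor
  · rintro ⟨t, ⟨h1, h2⟩, rfl⟩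
    exact ⟨by positivity, pow_lt_pow_left₀ h2 h1.le two_ne_zero⟩
  · rintro ⟨h1, h2⟩
    exact ⟨√x, ⟨Real.sqrt_pos.2 h1, (Real.sqrt_lt' hr).2 h2⟩, Real.sq_sqrt h1.le⟩

theorem hasDerivWithinAt_sq (s : Set ℝ) (t : ℝ) :
    HasDerivWithinAt (fun t : ℝ => t ^ 2) (2 * t) s t := by
  simpa using (hasDerivAt_pow 2 t).hasDerivWithinAt

theorem injOn_sq (r : ℝ) : InjOn (fun t : ℝ => t ^ 2) (Ioo 0 r) := fun _ ha _ hb h =>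
  (pow_left_inj₀ ha.1.le hb.1.le two_ne_zero).1 h

theorem integrableOn_Ioo_sq {r : ℝ} (hr : 0 < r) (g : ℝ → ℝ) :
    IntegrableOn g (Ioo 0 (r ^ 2)) ↔ IntegrableOn (fun t => 2 * t * g (t ^ 2)) (Ioo 0 r) := by
  rw [← image_sq_Ioo hr, integrableOn_image_iff_integrableOn_abs_deriv_smul measurableSet_Ioo
    (fun t _ => hasDerivWithinAt_sq _ t) (injOn_sq r)]
  refine integrableOn_congr_fun (fun t ht => ?_) measurableSet_Ioo
  have : 0 < t := ht.1
  simp [abs_of_pos this]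

theorem setIntegral_Ioo_sq {r : ℝ} (hr : 0 < r) (g : ℝ → ℝ) :
    ∫ x in Ioo 0 (r ^ 2), g x = ∫ t in Ioo 0 r, 2 * t * g (t ^ 2) := by
  rw [← image_sq_Ioo hr, integral_image_eq_integral_abs_deriv_smul measurableSet_Ioo
    (fun t _ => hasDerivWithinAt_sq _ t) (injOn_sq r)]
  refine setIntegral_congr_fun measurableSet_Ioo (fun t ht => ?_)
  have : 0 < t := ht.1
  simp [abs_of_pos this]

/-- Only integrability near 0 is at stake, and it is assumed for the largest exponent p. A smaller
exponent costs the factor x^{p-k}, which is bounded by |v|^{p-k} on (0, v). -/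
theorem integrableOn_inv_pow_mul_cdfL {ρ : Measure ℝ} (hρ : ∀ v, ρ (Iio v) < ⊤)
    (hρ0 : ρ (Iio 0) = 0)
    {p : ℕ} {s : ℝ} (hs : 0 < s)
    (h : IntegrableOn (fun x => (x ^ p)⁻¹ * cdfL ρ x) (Ioo 0 s)) {k : ℕ} (hk : k ≤ p) (v : ℝ) :
    IntegrableOn (fun x => (x ^ k)⁻¹ * cdfL ρ x) (Iio v) := by
  have hp : IntegrableOn (fun x => (x ^ p)⁻¹ * cdfL ρ x) (Iio v) := by
    have h1 : IntegrableOn (fun x => (x ^ p)⁻¹ * cdfL ρ x) (Icc s v) := by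
      refine IntegrableOn.continuousOn_mul ?_
        ((cdfL_mono hρ).locallyIntegrable.integrableOn_isCompact isCompact_Icc) isCompact_Icc
      refine (continuousOn_pow p).inv₀ fun x hx => (pow_pos (hs.trans_le hx.1) p).ne'
    have h2 : IntegrableOn (fun x => (x ^ p)⁻¹ * cdfL ρ x) (Iic 0) :=
      integrableOn_zero.congr_fun (fun x hx => by
        show 0 = _
        rw [cdfL_eq_zero hρ0 hx, mul_zero]) measurableSet_Iic
    refine ((h2.union h).union h1).mono_set fun x hx => ?_
    rcases le_or_gt x 0 with h0 | h0
    · exact Or.inl (Or.inl h0)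
    · rcases lt_or_ge x s with h3 | h3
      · exact Or.inl (Or.inr ⟨h0, h3⟩)
      · exact Or.inr ⟨h3, le_of_lt hx⟩
  refine Integrable.mono' (hp.const_mul (|v| ^ (p - k)))
    (((measurable_id.pow_const k).inv).mul (cdfL_mono hρ).measurable).aestronglyMeasurable ?_
  refine ae_restrict_of_forall_mem measurableSet_Iio fun x hx => ?_
  rw [Real.norm_of_nonneg (inv_pow_mul_cdfL_nonneg hρ0 k x)]
  rcases le_or_gt x 0 with h0 | h0
  · rw [cdfL_eq_zero hρ0 h0]; simp
  · have e : x ^ p = x ^ (p - k) * x ^ k := by rw [← pow_add, Nat.sub_add_cancel hk]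
    have h3 : (x ^ k)⁻¹ * cdfL ρ x = x ^ (p - k) * ((x ^ p)⁻¹ * cdfL ρ x) := by
      rw [e]; field_simp
    rw [h3]
    refine mul_le_mul_of_nonneg_right ?_ (inv_pow_mul_cdfL_nonneg hρ0 p x)
    exact pow_le_pow_left₀ h0.le ((le_of_lt hx).trans (le_abs_self v)) _

theorem cdfPowInt_eq_Ioo {ρ : Measure ℝ} (hρ0 : ρ (Iio 0) = 0)
    (k : ℕ) (v : ℝ) :
    cdfPowInt ρ k v = ∫ x in Ioo 0 v, (x ^ k)⁻¹ * cdfL ρ x := by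
  refine setIntegral_eq_of_subset_of_forall_sdiff_eq_zero measurableSet_Iio
    (fun x hx => hx.2) fun x hx => ?_
  have : x ≤ 0 := by
    by_contra h
    exact hx.2 ⟨not_le.1 h, hx.1⟩
  rw [cdfL_eq_zero hρ0 this, mul_zero]

theorem inv_pow_mul_cdfInt_le {ρ : Measure ℝ} (hρ : ∀ v, ρ (Iio v) < ⊤)
    (hρ0 : ρ (Iio 0) = 0)
    {k : ℕ} (hk : ∀ v, IntegrableOn (fun x => (x ^ k)⁻¹ * cdfL ρ x) (Iio v))
    (v : ℝ) : (v ^ k)⁻¹ * cdfInt ρ v ≤ cdfPowInt ρ k v := by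
  rw [cdfInt, cdfPowInt, ← integral_const_mul]
  refine setIntegral_mono_on ((integrableOn_cdfL hρ hρ0 v).const_mul _) (hk v) measurableSet_Iio
    fun x hx => ?_
  rcases le_or_gt x 0 with h0 | h0
  · rw [cdfL_eq_zero hρ0 h0]; simp
  · refine mul_le_mul_of_nonneg_right ?_ (cdfL_nonneg ρ x)
    exact inv_anti₀ (pow_pos h0 k) (pow_le_pow_left₀ h0.le (le_of_lt hx) k)

/-- Since x^{-q} `cdfL ρ x` is increasing, the integrand x^{-k} `cdfL ρ x` is at most its value at v
times x^{q-k}. Integrating this power gives the denominators q + 1 - k, which become the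
coefficients of C'_r. -/
theorem cdfPowInt_le {ρ : Measure ℝ} (hρ0 : ρ (Iio 0) = 0)
    {q k : ℕ} (hkq : k ≤ q)
    (hk : ∀ v, IntegrableOn (fun x => (x ^ k)⁻¹ * cdfL ρ x) (Iio v))
    (hN : ∀ a b : ℝ, 0 < a → a ≤ b → (a ^ q)⁻¹ * cdfL ρ a ≤ (b ^ q)⁻¹ * cdfL ρ b)
    {v : ℝ} (hv : 0 < v) :
    cdfPowInt ρ k v ≤ (v ^ q)⁻¹ * cdfL ρ v * (v ^ (q + 1 - k) / ((q + 1 - k : ℕ) : ℝ)) := by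
  have h1 : ∫ x in Ioo 0 v, (v ^ q)⁻¹ * cdfL ρ v * x ^ (q - k) =
      (v ^ q)⁻¹ * cdfL ρ v * (v ^ (q + 1 - k) / ((q + 1 - k : ℕ) : ℝ)) := by
    rw [integral_const_mul, ← integral_Ioc_eq_integral_Ioo,
      ← intervalIntegral.integral_of_le hv.le, integral_pow, Nat.sub_add_comm hkq]
    simp
  rw [cdfPowInt_eq_Ioo hρ0, ← h1]
  refine setIntegral_mono_on ((hk v).mono_set fun x hx => hx.2) ?_ measurableSet_Ioo
    fun x hx => ?_
  · exact ((by fun_prop : Continuous fun x : ℝ => (v ^ q)⁻¹ * cdfL ρ v * x ^ (q - k)).integrableOn_Icc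
      (a := 0) (b := v)).mono_set Ioo_subset_Icc_self
  · have hx0 : 0 < x := hx.1
    have e : x ^ q = x ^ (q - k) * x ^ k := by rw [← pow_add, Nat.sub_add_cancel hkq]
    have h3 : (x ^ k)⁻¹ * cdfL ρ x = (x ^ q)⁻¹ * cdfL ρ x * x ^ (q - k) := by
      rw [e]; field_simp
    rw [h3]
    exact mul_le_mul_of_nonneg_right (hN x v hx0 hx.2.le) (by positivity)

theorem tendsto_cdfPowInt_zero {ρ : Measure ℝ} (hρ0 : ρ (Iio 0) = 0)
    {k : ℕ}
    (hk : ∀ v, IntegrableOn (fun x => (x ^ k)⁻¹ * cdfL ρ x) (Iio v)) :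
    Tendsto (cdfPowInt ρ k) (𝓝[>] 0) (𝓝 0) := by
  have h1 : ContinuousOn (fun v => ∫ x in Ioc 0 v, (x ^ k)⁻¹ * cdfL ρ x) (Icc (0 : ℝ) 1) :=
    intervalIntegral.continuousOn_primitive
      ((hk 2).mono_set fun x hx => lt_of_le_of_lt hx.2 one_lt_two)
  have h2 := h1 0 ⟨le_rfl, zero_le_one⟩
  have h3 : Tendsto (fun v => ∫ x in Ioc 0 v, (x ^ k)⁻¹ * cdfL ρ x) (𝓝[>] 0) (𝓝 0) := by
    have h4 := h2.tendsto
    simp only [Ioc_self, setIntegral_empty] at h4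
    refine h4.mono_left ?_
    rw [nhdsWithin_le_iff]
    filter_upwards [Ioc_mem_nhdsGT (zero_lt_one (α := ℝ))] with x hx using ⟨hx.1.le, hx.2⟩
  refine h3.congr fun v => ?_
  rw [cdfPowInt_eq_Ioo hρ0, integral_Ioc_eq_integral_Ioo]

/-- The left-hand side is the integral of (x^{-p} - r^{-2p}) `cdfL ρ x` over (0, r²); the
substitution x = t² gives the integral term of the superharmonic estimate. -/
theorem cdfPowInt_sub_sq {ρ : Measure ℝ} (hρ : ∀ v, ρ (Iio v) < ⊤)
    (hρ0 : ρ (Iio 0) = 0)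
    {p : ℕ} (hk : ∀ v, IntegrableOn (fun x => (x ^ p)⁻¹ * cdfL ρ x) (Iio v))
    {r : ℝ} (hr : 0 < r) : cdfPowInt ρ p (r ^ 2) - ((r ^ 2) ^ p)⁻¹ * cdfInt ρ (r ^ 2) =
      2 * ∫ t in (0 : ℝ)..r, (t ^ (2 * p) / r ^ (2 * p) - 1) *
        -(t * (((t ^ 2) ^ p)⁻¹ * cdfL ρ (t ^ 2))) := by
  have h0 : cdfInt ρ (r ^ 2) = cdfPowInt ρ 0 (r ^ 2) := by simp [cdfInt, cdfPowInt]
  have i0 : IntegrableOn (fun x => (x ^ 0)⁻¹ * cdfL ρ x) (Ioo 0 (r ^ 2)) := by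
    simpa using (integrableOn_cdfL hρ hρ0 (r ^ 2)).mono_set fun x hx => hx.2
  rw [h0, cdfPowInt_eq_Ioo hρ0, cdfPowInt_eq_Ioo hρ0, ← integral_const_mul,
    ← integral_sub ((hk _).mono_set fun x hx => hx.2) (i0.const_mul _), setIntegral_Ioo_sq hr,
    intervalIntegral.integral_of_le hr.le, integral_Ioc_eq_integral_Ioo, ← integral_const_mul]
  refine setIntegral_congr_fun measurableSet_Ioo fun t ht => ?_
  have ht0 : 0 < t := ht.1
  simp only [pow_mul, pow_zero, inv_one, one_mul]
  field_simp
  ring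

/-- Estimates for a positive plurisuperharmonic current satisfying the integrability condition. -/
theorem estimates_of_superharmonic {n q : ℕ} {T : TestForm n (2 * (q + 1)) →ₗ[ℂ] ℂ}
    (hT : IsPositive T) (hdd : IsPositive (-ddc T)) {r₀ : ℝ} (hr₀ : 0 < r₀)
    (hint : IntegrableOn (fun t => nu (ddc T) t / t) (Ioo 0 r₀)) :
    ∃ (ν₀ : ℝ) (μ : Measure ℝ), (∀ v, μ (Iio v) < ⊤) ∧
      Tendsto (nu T) (𝓝[>] 0) (𝓝 ν₀) ∧
      (∀ g : TestFun, (T (betaTest n (q + 1) g)).re = ∫ x, g x ∂μ) ∧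
      Tendsto (cdfL μ) (𝓝[>] 0) (𝓝 0) ∧
      ∀ r : ℝ, 0 < r → ∀ ψ : PosFun, (∀ x, 0 ≤ ψ x) → (∀ x, ψ x ≤ 1) →
        ∀ R' < r ^ 2, (∀ x, R' ≤ x → ψ x = 0) → (T (omegaTest n q ψ)).re ≤ |nu T r - ν₀| +
          (∑ k ∈ Finset.Icc 1 (q + 1), ((q + 1).choose k : ℝ) * r ^ (2 * k)) * nu T r -
          2 * (∑ k ∈ Finset.Icc 1 (q + 1), ((q + 1).choose k : ℝ) / (2 * k) * r ^ (2 * k)) *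
            nu (ddc T) r +
          2 * ∫ t in (0 : ℝ)..r, (t ^ (2 * (q + 1)) / r ^ (2 * (q + 1)) - 1) *
            (nu (ddc T) t / t) := by
  obtain ⟨μ, ρ, hμs, hμ, hμ0, hρ, hρ0, hm, hτ, hν, hνS⟩ :=
    exists_radial_measures hT hdd (ε := -1) (by simp)
  have hνd : ∀ r, 0 < r → nu (ddc T) r = -(((r ^ 2) ^ q)⁻¹ * cdfL ρ (r ^ 2)) := fun r hr => by
    rw [← hνS r hr, nu_neg, neg_neg]
  have hνt : ∀ t, 0 < t → nu (ddc T) t / t = -(t * (((t ^ 2) ^ (q + 1))⁻¹ * cdfL ρ (t ^ 2))) :=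
    fun t ht => by
      rw [hνd t ht, pow_succ (t ^ 2) q]
      field_simp
  -- Monotonicity of ν_S for S = -dd^c T. In bidimension 0 it is that of the mass itself; otherwise
  -- S is positive with dd^c S = 0, hence plurisubharmonic, and `nu_mono` applies.
  have hN : ∀ a b : ℝ, 0 < a → a ≤ b → (a ^ q)⁻¹ * cdfL ρ a ≤ (b ^ q)⁻¹ * cdfL ρ b := by
    intro a b ha hab
    have hb := ha.trans_le hab
    rcases q with _ | q
    · simpa using cdfL_mono hρ hab
    · have h1 : ddc (-ddc T) = 0 := by
        ext η
        have : ddcTest n (2 * (q + 1)) (ddcTest n (2 * q) η) = 0 := ddcTest_ddcTest η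
        show -T (ddcTest n (2 * (q + 1)) (ddcTest n (2 * q) η)) = 0
        rw [this, map_zero, neg_zero]
      have h2 := nu_mono hdd (by rw [h1]; exact ⟨fun _ _ _ _ _ _ => rfl, fun _ _ => ⟨le_rfl, rfl⟩⟩)
        (Real.sqrt_pos.2 ha) (Real.sqrt_le_sqrt hab)
      rwa [hνS _ (Real.sqrt_pos.2 ha), hνS _ (Real.sqrt_pos.2 hb), Real.sq_sqrt ha.le,
        Real.sq_sqrt hb.le] at h2
  have hi : ∀ k ≤ q + 1, ∀ v, IntegrableOn (fun x => (x ^ k)⁻¹ * cdfL ρ x) (Iio v) := by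
    refine fun k hk v => integrableOn_inv_pow_mul_cdfL hρ hρ0 (sq_pos_of_pos hr₀) ?_ hk v
    rw [integrableOn_Ioo_sq hr₀]
    -- Under x = t² the density x^{-(q+1)} `cdfL ρ x` dx becomes -2 ν_{dd^c T}(t) dt / t.
    refine (Integrable.const_mul hint (-2)).congr ?_
    refine ae_restrict_of_forall_mem measurableSet_Ioo fun t ht => ?_
    simp only [hνt t ht.1]
    ring
  let H : ℕ → ℝ → ℝ := fun k v => cdfPowInt ρ k v - (v ^ k)⁻¹ * cdfInt ρ v
  let G : ℕ → ℝ → ℝ := fun k v => (v ^ k)⁻¹ * cdfL μ v + H k v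
  have hest := fun k (hk : k ≤ q + 1) => radial_estimates_of_neg hμ hρ hρ0 hm hτ k (hi k hk)
    (fun ψ hψ => hT.XFun_nonneg hk hψ) (F := G k) fun v => rfl
  have hH0 : ∀ k ≤ q + 1, ∀ v, 0 < v → 0 ≤ H k v := fun k hk v _ =>
    sub_nonneg.2 (inv_pow_mul_cdfInt_le hρ hρ0 (hi k hk) v)
  have hHle : ∀ k v, 0 < v → H k v ≤ cdfPowInt ρ k v := fun k v hv =>
    sub_le_self _ (mul_nonneg (by positivity) (cdfInt_nonneg ρ v))
  have hG0 : ∀ k ≤ q + 1, ∀ v, 0 < v → 0 ≤ G k v := fun k hk v hv =>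
    add_nonneg (mul_nonneg (by positivity) (cdfL_nonneg μ v)) (hH0 k hk v hv)
  have hmono := (hest (q + 1) le_rfl).1
  obtain ⟨ν₀, hlim, hν₀⟩ := exists_limit_of_mono hmono (hG0 _ le_rfl)
  -- The correction `H` lies between 0 and the primitive of an integrable function. Hence ν_T has
  -- the same limit at 0 as the increasing function `G (q + 1)`, although ν_T itself need not be
  -- monotone.
  have hHlim : Tendsto (H (q + 1)) (𝓝[>] 0) (𝓝 0) := by
    refine tendsto_of_tendsto_of_tendsto_of_le_of_le' tendsto_const_nhds
      (tendsto_cdfPowInt_zero hρ0 (hi _ le_rfl)) ?_ ?_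
    · filter_upwards [self_mem_nhdsWithin] with v hv using hH0 _ le_rfl v hv
    · filter_upwards [self_mem_nhdsWithin] with v hv using hHle _ v hv
  refine ⟨ν₀, μ, hμ, ?_, hm, tendsto_cdfL_zero (Nat.succ_ne_zero q) (fun v hv =>
    le_add_of_nonneg_right (hH0 _ le_rfl v hv)) hmono, fun r hr ψ hψ0 hψ1 R' hR' hψR => ?_⟩
  · have h1 := (hlim.sub hHlim).comp tendsto_sq_nhdsGT
    rw [sub_zero] at h1
    refine h1.congr' ?_
    filter_upwards [self_mem_nhdsWithin] with r hr
    rw [hν r hr]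
    simp [G]
  · have hr2 : 0 < r ^ 2 := by positivity
    rw [re_omegaTest, Finset.sum_range_succ, Nat.choose_self, Nat.cast_one, one_mul]
    have h1 : (T (xTest n q (q + 1) ψ)).re ≤ |nu T r - ν₀| +
        2 * ∫ t in (0 : ℝ)..r, (t ^ (2 * (q + 1)) / r ^ (2 * (q + 1)) - 1) *
            (nu (ddc T) t / t) := by
      rw [re_xTest]
      refine ((hest (q + 1) le_rfl).2 ν₀ hν₀ ψ hψ1 _ _ hr2 hR' hψR).trans ?_
      have h4 : ∫ t in (0 : ℝ)..r, (t ^ (2 * (q + 1)) / r ^ (2 * (q + 1)) - 1) *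
            (nu (ddc T) t / t) = ∫ t in (0 : ℝ)..r, (t ^ (2 * (q + 1)) / r ^ (2 * (q + 1)) - 1) *
            -(t * (((t ^ 2) ^ (q + 1))⁻¹ * cdfL ρ (t ^ 2))) := by
        rw [intervalIntegral.integral_of_le hr.le, intervalIntegral.integral_of_le hr.le]
        refine setIntegral_congr_fun measurableSet_Ioc fun t ht => ?_
        simp only [hνt t ht.1]
      rw [h4, ← cdfPowInt_sub_sq hρ hρ0 (hi _ le_rfl) hr, hν r hr]
      have := le_abs_self (((r ^ 2) ^ (q + 1))⁻¹ * cdfL μ (r ^ 2) - ν₀)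
      show _ + H _ _ - ν₀ ≤ _ + H _ _
      linarith
    -- Here `H k` is only bounded by `cdfPowInt ρ k`. The minus sign in front of `nu (ddc T) r`
    -- makes that term nonnegative, because dd^c T ≤ 0.
    have h2 : ∀ k ∈ Finset.range (q + 1), ((q + 1).choose k : ℝ) * (T (xTest n q k ψ)).re ≤
        ((q + 1).choose k : ℝ) * (r ^ (2 * (q + 1 - k)) * nu T r -
          r ^ (2 * (q + 1 - k)) / ((q + 1 - k : ℕ) : ℝ) * nu (ddc T) r) := by
      intro k hk
      have hk' : k ≤ q + 1 := (Finset.mem_range.1 hk).le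
      have hkq : k ≤ q := Nat.lt_succ_iff.1 (Finset.mem_range.1 hk)
      refine mul_le_mul_of_nonneg_left ?_ (Nat.cast_nonneg _)
      have h3 := (hest k hk').2 0 (hG0 k hk') ψ hψ1 _ _ hr2 hR' hψR
      have h5 := (hHle k _ hr2).trans (cdfPowInt_le hρ0 hkq (hi k hk') hN hr2)
      rw [re_xTest]
      refine h3.trans ?_
      have e : (r ^ 2) ^ (q + 1) = (r ^ 2) ^ (q + 1 - k) * (r ^ 2) ^ k := by
        rw [← pow_add, Nat.sub_add_cancel hk']
      have e2 : ((r ^ 2) ^ k)⁻¹ * cdfL μ (r ^ 2) =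
          (r ^ 2) ^ (q + 1 - k) * (((r ^ 2) ^ (q + 1))⁻¹ * cdfL μ (r ^ 2)) := by
        rw [e]; field_simp
      rw [hν r hr, hνd r hr, sub_zero, pow_mul]
      show _ + H _ _ ≤ _
      rw [e2]
      linarith
    refine (add_le_add (Finset.sum_le_sum h2) h1).trans_eq ?_
    rw [sum_range_choose_reflect (q + 1) fun j => r ^ (2 * j) * nu T r -
      r ^ (2 * j) / (j : ℝ) * nu (ddc T) r]
    have h6 : ∑ k ∈ Finset.Icc 1 (q + 1), ((q + 1).choose k : ℝ) *
        (r ^ (2 * k) * nu T r - r ^ (2 * k) / (k : ℝ) * nu (ddc T) r) =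
        (∑ k ∈ Finset.Icc 1 (q + 1), ((q + 1).choose k : ℝ) * r ^ (2 * k)) * nu T r -
          2 * (∑ k ∈ Finset.Icc 1 (q + 1), ((q + 1).choose k : ℝ) / (2 * k) * r ^ (2 * k)) *
            nu (ddc T) r := by
      rw [Finset.mul_sum, Finset.sum_mul, Finset.sum_mul, ← Finset.sum_sub_distrib]
      refine Finset.sum_congr rfl fun k hk => ?_
      have hk0 : (k : ℝ) ≠ 0 := by
        have := (Finset.mem_Icc.1 hk).1
        positivity
      field_simp
    rw [h6]
    ring



/-! ### Forms on the blow-up in the coordinates of `ℂⁿ` -/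

theorem trans_chartCoord {n : ℕ} (i j : Fin n) {z : Cn n} (hi : z i ≠ 0) :
    trans i j (chartCoord i z) = chartCoord j z := by
  rw [trans, chartProj_chartCoord i hi, dir_chartCoord i hi, chartCoord]
  congr 1
  funext l
  rw [PiLp.smul_apply, PiLp.smul_apply, smul_eq_mul, smul_eq_mul,
    mul_div_mul_left _ _ (inv_ne_zero hi)]

theorem fderiv_chartCoord {n : ℕ} (j : Fin n) {z : Cn n} (h : z j ≠ 0) :
    fderiv ℝ (chartCoord j) z = (fderiv ℂ (chartCoord j) z).restrictScalars ℝ :=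
  ((differentiableAt_chartCoord j h).hasFDerivAt.restrictScalars ℝ).fderiv

open Classical in
/-- The expression on `ℂⁿ ∖ {0}` of a form on the blow-up, extended by `0` to the origin. -/
def downForm {n k : ℕ} (η : BlowupTestForm n k) (z : Cn n) : Alt n k :=
  if h : ∃ j, z j ≠ 0 then
    (η.1 h.choose (chartCoord h.choose z)).compContinuousLinearMap
      (fderiv ℝ (chartCoord h.choose) z)
  else 0

theorem downForm_zero {n k : ℕ} (η : BlowupTestForm n k) : downForm η 0 = 0 := by
  rw [downForm, dif_neg]
  rintro ⟨j, h⟩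
  exact h rfl

/-- The transition rule in `BlowupTestForm` and the chain rule make the chosen chart immaterial. -/
theorem downForm_eq {n k : ℕ} (η : BlowupTestForm n k) {j : Fin n} {z : Cn n} (h : z j ≠ 0) :
    downForm η z = (η.1 j (chartCoord j z)).compContinuousLinearMap
      (fderiv ℝ (chartCoord j) z) := by
  have hex : ∃ j, z j ≠ 0 := ⟨j, h⟩
  rw [downForm, dif_pos hex]
  set i := hex.choose
  have hi : z i ≠ 0 := hex.choose_spec
  have hd : dir i (chartCoord i z) j ≠ 0 := by
    rw [dir_chartCoord i hi, PiLp.smul_apply, smul_eq_mul]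
    exact mul_ne_zero (inv_ne_zero hi) h
  have hev : (fun y => trans i j (chartCoord i y)) =ᶠ[𝓝 z] chartCoord j := by
    filter_upwards [(isOpen_coord_ne i).mem_nhds hi] with y hy
    exact trans_chartCoord i j hy
  have hfd : fderiv ℝ (chartCoord j) z =
      (fderiv ℝ (trans i j) (chartCoord i z)).comp (fderiv ℝ (chartCoord i) z) := by
    rw [← hev.fderiv_eq]
    exact fderiv_comp z (differentiableAt_trans i j _ hd)
      ((contDiffAt_chartCoord i hi).differentiableAt (by simp))
  rw [η.2.2.1 i j _ hd, trans_chartCoord i j hi, hfd]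
  ext v
  simp [Function.comp_def]

theorem exists_coord_ne {n : ℕ} {z : Cn n} (h : z ≠ 0) : ∃ j, z j ≠ 0 := by
  by_contra! hcon
  exact h (by ext l; simpa using hcon l)

theorem downForm_add {n k : ℕ} (η ξ : BlowupTestForm n k) (z : Cn n) :
    downForm (η + ξ) z = downForm η z + downForm ξ z := by
  rcases eq_or_ne z 0 with rfl | h
  · simp only [downForm_zero]
    exact (add_zero _).symm
  · obtain ⟨j, hj⟩ := exists_coord_ne h
    rw [downForm_eq _ hj, downForm_eq _ hj, downForm_eq _ hj]
    rfl

theorem downForm_smul {n k : ℕ} (c : ℂ) (η : BlowupTestForm n k) (z : Cn n) :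
    downForm (c • η) z = c • downForm η z := by
  rcases eq_or_ne z 0 with rfl | h
  · simp only [downForm_zero]
    ext v
    simp
  · obtain ⟨j, hj⟩ := exists_coord_ne h
    rw [downForm_eq _ hj, downForm_eq _ hj]
    rfl

theorem downForm_eq_zero {n k : ℕ} {η : BlowupTestForm n k} {K : Set (Cn n)}
    (hK : ∀ j w, chartProj j w ∉ K → η.1 j w = 0) {z : Cn n} (hz : z ∉ K) : downForm η z = 0 := by
  rcases eq_or_ne z 0 with rfl | h
  · exact downForm_zero η
  · obtain ⟨j, hj⟩ := exists_coord_ne h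
    rw [downForm_eq _ hj, hK j _ (by rwa [chartProj_chartCoord j hj])]
    ext v
    simp

/-- A map that is smooth near a point agrees there with a globally smooth map. -/
theorem exists_contDiff_eventuallyEq {n : ℕ} {f : Cn n → Cn n} {z : Cn n}
    (h : ∀ᶠ y in 𝓝 z, ContDiffAt ℝ ∞ f y) : ∃ g : Cn n → Cn n, ContDiff ℝ ∞ g ∧ g =ᶠ[𝓝 z] f := by
  obtain ⟨ε, hε, hball⟩ := Metric.eventually_nhds_iff_ball.1 h
  let χ : ContDiffBump z := ⟨ε / 4, ε / 2, by positivity, by linarith⟩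
  refine ⟨fun y => χ y • f y, contDiff_iff_contDiffAt.2 fun y => ?_, ?_⟩
  · by_cases hy : y ∈ Metric.ball z ε
    · exact χ.contDiff.contDiffAt.smul (hball y hy)
    · have h1 : y ∉ tsupport χ := by
        rw [χ.tsupport_eq]
        intro h2
        exact hy (Metric.closedBall_subset_ball (by show ε / 2 < ε; linarith) h2)
      refine (contDiffAt_const (c := (0 : Cn n))).congr_of_eventuallyEq ?_
      filter_upwards [notMem_tsupport_iff_eventuallyEq.1 h1] with x hx
      rw [hx]
      exact zero_smul ℝ _
  · filter_upwards [χ.eventuallyEq_one] with y hy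
    rw [hy]
    exact one_smul ℝ _

/-- The chart coordinates are smooth only where z_j ≠ 0; near z they are replaced by a globally
smooth map, so that `contDiff_pullback` applies. -/
theorem contDiffAt_downForm {n k : ℕ} (η : BlowupTestForm n k) {z : Cn n} (h : z ≠ 0) :
    ContDiffAt ℝ ∞ (downForm η) z := by
  obtain ⟨j, hj⟩ := exists_coord_ne h
  have hmem := (isOpen_coord_ne j).mem_nhds hj
  obtain ⟨g, hg, hgf⟩ := exists_contDiff_eventuallyEq (f := chartCoord j) (z := z) (by
    filter_upwards [hmem] with y hy using contDiffAt_chartCoord j hy)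
  refine (contDiff_pullback (η.2.1 j) hg).contDiffAt.congr_of_eventuallyEq ?_
  filter_upwards [hmem, hgf.eventuallyEq_nhds] with y hy hgy
  rw [downForm_eq η hy, hgy.fderiv_eq, hgy.eq_of_nhds]

theorem downForm_pullBlowup {n k : ℕ} (η : TestForm n k) {z : Cn n} (h : z ≠ 0) :
    downForm (pullBlowup n k η) z = η z := by
  obtain ⟨j, hj⟩ := exists_coord_ne h
  have hev : (fun y => chartProj j (chartCoord j y)) =ᶠ[𝓝 z] fun y => y := by
    filter_upwards [(isOpen_coord_ne j).mem_nhds hj] with y hy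
    exact chartProj_chartCoord j hy
  have hfd : (fderiv ℝ (chartProj j) (chartCoord j z)).comp (fderiv ℝ (chartCoord j) z) =
      ContinuousLinearMap.id ℝ (Cn n) := by
    rw [← fderiv_fun_id (𝕜 := ℝ) (x := z), ← hev.fderiv_eq]
    exact (fderiv_comp z ((contDiff_chartProj j).differentiable (by simp) _)
      ((contDiffAt_chartCoord j hj).differentiableAt (by simp))).symm
  rw [downForm_eq _ hj]
  ext v
  have h1 : ∀ u, fderiv ℝ (chartProj j) (chartCoord j z) (fderiv ℝ (chartCoord j) z u) = u :=
    fun u => congrFun (congrArg DFunLike.coe hfd) u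
  simp [pullBlowup, chartProj_chartCoord j hj, Function.comp_def, h1]

/-! ### Cut-off functions -/

/-- A smooth function equal to `0` on `(-∞, 2⁻ⁱ]` and to `1` on `[2 · 2⁻ⁱ, ∞)`. -/
def cutoff (i : ℕ) (x : ℝ) : ℝ := Real.smoothTransition (2 ^ i * x - 1)

theorem contDiff_cutoff (i : ℕ) : ContDiff ℝ ∞ (cutoff i) :=
  Real.smoothTransition.contDiff.comp ((contDiff_const.mul contDiff_id).sub contDiff_const)

theorem cutoff_nonneg (i : ℕ) (x : ℝ) : 0 ≤ cutoff i x := Real.smoothTransition.nonneg _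

theorem cutoff_le_one (i : ℕ) (x : ℝ) : cutoff i x ≤ 1 := Real.smoothTransition.le_one _

theorem cutoff_eq_zero {i : ℕ} {x : ℝ} (h : x ≤ (2 ^ i)⁻¹) : cutoff i x = 0 := by
  apply Real.smoothTransition.zero_of_nonpos
  have h1 : (2 : ℝ) ^ i * x ≤ 2 ^ i * (2 ^ i)⁻¹ := by gcongr
  rw [mul_inv_cancel₀ (by positivity)] at h1
  linarith

theorem cutoff_eq_one {i : ℕ} {x : ℝ} (h : 2 * (2 ^ i)⁻¹ ≤ x) : cutoff i x = 1 := by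
  apply Real.smoothTransition.one_of_one_le
  have h1 : (2 : ℝ) ^ i * (2 * (2 ^ i)⁻¹) ≤ 2 ^ i * x := by gcongr
  have h2 : (2 : ℝ) ^ i * (2 * (2 ^ i)⁻¹) = 2 := by field_simp
  linarith

theorem cutoff_mono {i j : ℕ} (h : i ≤ j) {x : ℝ} (hx : 0 ≤ x) : cutoff i x ≤ cutoff j x := by
  apply Real.smoothTransition.monotone
  have : (2 : ℝ) ^ i ≤ 2 ^ j := pow_le_pow_right₀ one_le_two h
  gcongr

/-- The product of a cut-off function and a test function. -/
def cutPos (i : ℕ) (P : TestFun) : PosFun where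
  toFun x := cutoff i x * P x
  contDiff' := (contDiff_cutoff i).mul P.contDiff
  hasCompactSupport' := P.hasCompactSupport.mul_left
  tsupport_subset' := by
    refine (closure_minimal (fun x hx => ?_) isClosed_Ici : _ ⊆ Ici ((2 : ℝ) ^ i)⁻¹).trans
      fun x hx => ?_
    · by_contra h
      refine hx ?_
      show cutoff i x * P x = 0
      rw [cutoff_eq_zero (le_of_lt (not_le.1 h)), zero_mul]
    · exact (show (0 : ℝ) < (2 ^ i)⁻¹ by positivity).trans_le hx

theorem cutPos_apply (i : ℕ) (P : TestFun) (x : ℝ) : cutPos i P x = cutoff i x * P x := rfl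

/-- The form on `ℂⁿ` obtained by cutting off a form on the blow-up near the exceptional divisor. -/
def cutForm {n k : ℕ} (i : ℕ) : BlowupTestForm n k →ₗ[ℂ] TestForm n k where
  toFun η := mkTest (fun z => ((cutoff i (‖z‖ ^ 2) : ℝ) : ℂ) • downForm η z)
    (contDiff_iff_contDiffAt.2 fun z => by
      rcases eq_or_ne z 0 with rfl | h
      · refine (contDiffAt_const (c := (0 : Alt n k))).congr_of_eventuallyEq ?_
        have hc : Continuous fun z : Cn n => ‖z‖ ^ 2 := by fun_prop
        have h0 : ∀ᶠ z : Cn n in 𝓝 0, ‖z‖ ^ 2 < (2 ^ i)⁻¹ := by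
          refine hc.continuousAt.eventually_lt_const ?_
          simp
        filter_upwards [h0] with z hz
        rw [cutoff_eq_zero hz.le]
        ext v
        simp
      · exact (Complex.ofRealCLM.contDiff.comp
          ((contDiff_cutoff i).comp (contDiff_norm_sq ℝ))).contDiffAt.smul (contDiffAt_downForm η h))
    (by
      obtain ⟨K, hK, h⟩ := η.2.2.2
      refine HasCompactSupport.intro hK fun z hz => ?_
      rw [downForm_eq_zero h hz]
      ext v
      simp)
  map_add' η ξ := by
    ext z v
    simp only [mkTest_apply, add_apply, downForm_add, ContinuousAlternatingMap.smul_apply,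
      ContinuousAlternatingMap.add_apply, smul_add]
  map_smul' c η := by
    ext z v
    simp only [mkTest_apply, smul_apply, downForm_smul, ContinuousAlternatingMap.smul_apply,
      smul_eq_mul, RingHom.id_apply]
    ring

theorem cutForm_apply {n k : ℕ} (i : ℕ) (η : BlowupTestForm n k) (z : Cn n) :
    cutForm i η z = ((cutoff i (‖z‖ ^ 2) : ℝ) : ℂ) • downForm η z := rfl



/-! ### Domination by the Kähler form -/

/-- A form on the blow-up whose coefficients are bounded by `b` in the standard charts is dominated
by `C b ω^m`. -/
theorem exists_dominating_downForm (n m : ℕ) : ∃ C : ℝ, 0 ≤ C ∧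
    ∀ (η : BlowupTestForm n (2 * m)) (b : ℝ) (z : Cn n), z ≠ 0 →
      (∀ j w, (∀ l, l ≠ j → ‖w l‖ ≤ 1) → chartProj j w = z → ‖η.1 j w‖ ≤ b) →
      ∀ c : ℂ, ‖c‖ = 1 → StronglyPositive
        (((C * b : ℝ) : ℂ) • omegaPow m z + realAvg n m (c • downForm η z)) := by
  obtain ⟨C, hC, h⟩ := exists_dominating n m
  set c₀ : ℝ := 1 / (2 * Real.pi) * (1 / (n : ℝ) ^ 2) with hc₀
  refine ⟨C / c₀ ^ m, by positivity, fun η b z hz hb c hc => ?_⟩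
  obtain ⟨j₀, hj₀⟩ := exists_coord_ne hz
  have : Nonempty (Fin n) := ⟨j₀⟩
  -- In the chart of a coordinate of maximal modulus all ratios have modulus at most 1. So |dir|² ≤
  -- n, and 2π times the Kähler form dominates n⁻² ∑ i dw_l ∧ dw̄_l uniformly, even near the
  -- exceptional divisor.
  obtain ⟨j, hj⟩ := Finite.exists_max fun l => ‖z l‖
  have hzj : 0 < ‖z j‖ := (norm_pos_iff.2 hj₀).trans_le (hj j₀)
  have hzj0 : z j ≠ 0 := norm_pos_iff.1 hzj
  set w := chartCoord j z with hw
  have hwl : ∀ l, l ≠ j → ‖w l‖ ≤ 1 := by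
    intro l hl
    have : w l = z l / z j := by simp [hw, chartCoord, hl]
    rw [this, norm_div]
    exact (div_le_one hzj).2 (hj l)
  have hn : 0 < (n : ℝ) := by exact_mod_cast j₀.pos
  set u : ℝ := ‖dir j w‖ ^ 2 with hu
  have hu0 : 0 < u := pow_pos (norm_pos_iff.2 (dir_ne_zero j w)) 2
  have hun : u ≤ n := by
    rw [hu, EuclideanSpace.norm_sq_eq]
    have : ∀ l ∈ (Finset.univ : Finset (Fin n)), ‖dir j w l‖ ^ 2 ≤ 1 := by
      intro l _
      refine pow_le_one₀ (norm_nonneg _) ?_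
      by_cases hl : l = j
      · subst hl; simp [dir_self]
      · simpa [dir, hl] using hwl l hl
    simpa using Finset.sum_le_card_nsmul _ _ _ this
  have hmem : ((1 / (2 * Real.pi) : ℝ) : ℂ) • kahlerExt j w - (c₀ : ℂ) • bExt n ∈ posCone n := by
    have hle : 1 / (n : ℝ) ^ 2 ≤ 1 / u ^ 2 :=
      one_div_le_one_div_of_le (by positivity) (by gcongr)
    have h1 := smul_mem_cone (kahlerExt_sub_mem j w) (c := 1 / (2 * Real.pi)) (by positivity)
    have h2 := smul_mem_cone (bExt_mem n) (c := 1 / (2 * Real.pi) * (1 / u ^ 2 - 1 / (n : ℝ) ^ 2))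
      (mul_nonneg (by positivity) (sub_nonneg.2 hle))
    have h3 := (posCone n).add_mem h1 h2
    convert h3 using 1
    simp only [hc₀, ← hu]
    push_cast
    module
  have hc₀pos : 0 < c₀ := by positivity
  have h1 := h _ c₀ hc₀pos hmem (c • η.1 j w) b (by
    rw [norm_smul, hc, one_mul]
    exact hb j w hwl (chartProj_chartCoord j hzj0))
  rw [← wedgePow_kahler] at h1
  have h2 := h1.comp (fderiv ℂ (chartCoord j) z)
  rw [← fderiv_chartCoord j hzj0] at h2
  convert h2 using 1
  have h3 := wedgePow_kahler_comp j hzj0 m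
  have h4 := realAvg_comp (c • η.1 j w) (fderiv ℂ (chartCoord j) z)
  rw [← fderiv_chartCoord j hzj0] at h4
  have h5 : c • downForm η z = (c • η.1 j w).compContinuousLinearMap (fderiv ℝ (chartCoord j) z) := by
    rw [downForm_eq η hzj0]
    rfl
  rw [h5, h4, ← h3, div_mul_eq_mul_div]
  rfl

theorem downForm_massTest {n m : ℕ} {η : BlowupTestForm n (2 * m)} {Φ : Blowup n → ℝ}
    (h : ∀ j w, η.1 j w = ((Φ (chart j w) : ℝ) : ℂ) • wedgePow (kahler j w) m) {j : Fin n} {z : Cn n}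
    (hz : z j ≠ 0) : downForm η z = ((Φ (chart j (chartCoord j z)) : ℝ) : ℂ) • omegaPow m z := by
  rw [downForm_eq η hz, h, ← wedgePow_kahler_comp j hz m]
  rfl

theorem isOfType_downForm {n k a b : ℕ} {η : BlowupTestForm n k}
    (h : ∀ j w, IsOfType a b (η.1 j w)) (z : Cn n) : IsOfType a b (downForm η z) := by
  rcases eq_or_ne z 0 with rfl | hz
  · rw [downForm_zero]
    intro t v
    simp
  · obtain ⟨j, hj⟩ := exists_coord_ne hz
    rw [downForm_eq η hj, fderiv_chartCoord j hj]
    intro t v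
    have := h j (chartCoord j z) t (fun i => fderiv ℂ (chartCoord j) z (v i))
    simpa [Function.comp_def] using this

theorem stronglyPositive_downForm {n m : ℕ} {η : BlowupTestForm n (2 * m)}
    (h : ∀ j w, StronglyPositive (η.1 j w)) (z : Cn n) : StronglyPositive (downForm η z) := by
  rcases eq_or_ne z 0 with rfl | hz
  · rw [downForm_zero]
    exact StronglyPositive.zero
  · obtain ⟨j, hj⟩ := exists_coord_ne hz
    rw [downForm_eq η hj, fderiv_chartCoord j hj]
    exact (h j _).comp _

theorem stronglyPositive_omegaPow {n m : ℕ} {z : Cn n} (hz : z ≠ 0) :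
    StronglyPositive (omegaPow m z) := by
  obtain ⟨j, hj⟩ := exists_coord_ne hz
  rw [← wedgePow_kahler_comp j hj m, fderiv_chartCoord j hj]
  refine StronglyPositive.comp ?_ _
  rw [wedgePow_kahler]
  refine stronglyPositive_of_mem (Submodule.pow_mem_pow _ ?_ m)
  have h1 := (posCone n).add_mem (kahlerExt_sub_mem j (chartCoord j z))
    (smul_mem_cone (bExt_mem n) (c := 1 / (‖dir j (chartCoord j z)‖ ^ 2) ^ 2) (by positivity))
  rw [sub_add_cancel] at h1
  exact smul_mem_cone h1 (by positivity)

theorem stronglyPositive_omegaTest {n q : ℕ} {ψ : PosFun} (hψ : ∀ x, 0 ≤ x → 0 ≤ ψ x) (z : Cn n) :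
    StronglyPositive (omegaTest n q ψ z) := by
  rw [omegaTest_apply]
  rcases eq_or_ne z 0 with rfl | hz
  · rw [ψ.eq_zero (by simp)]
    convert StronglyPositive.zero using 1
    ext v
    simp
  · exact (stronglyPositive_omegaPow hz).smul (hψ _ (by positivity))



/-! ### Estimates of cut-off forms -/

/-- The sign of χ is absorbed into the unimodular constant c, after which |χ| ≤ ψ on the support
makes ψ times the Kähler power dominate. At the origin and off K the form vanishes and there is
nothing to dominate. -/
theorem IsPositive.norm_le_omegaTest {n q : ℕ} {T : TestForm n (2 * (q + 1)) →ₗ[ℂ] ℂ}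
    (hT : IsPositive T) {η : BlowupTestForm n (2 * (q + 1))} {b : ℝ}
    (hb : ∀ z, z ≠ 0 → ∀ c : ℂ, ‖c‖ = 1 → StronglyPositive
      (((b : ℝ) : ℂ) • omegaPow (q + 1) z + realAvg n (q + 1) (c • downForm η z)))
    (hb0 : 0 ≤ b) {K : Set (Cn n)} (hK : ∀ j w, chartProj j w ∉ K → η.1 j w = 0)
    {ξ : TestForm n (2 * (q + 1))} {χ : Cn n → ℝ} (hξ : ∀ z, ξ z = ((χ z : ℝ) : ℂ) • downForm η z)
    {ψ : PosFun} (hψ0 : ∀ x, 0 ≤ x → 0 ≤ ψ x) (hχψ : ∀ z ∈ K, |χ z| ≤ ψ (‖z‖ ^ 2)) :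
    ‖T ξ‖ ≤ 2 * (b * (T (omegaTest n q ψ)).re) := by
  have h := hT.norm_le ξ ((b : ℂ) • omegaTest n q ψ) fun c z hc => ?_
  · rwa [map_smul, smul_eq_mul, Complex.re_ofReal_mul] at h
  · show StronglyPositive ((b : ℂ) • omegaTest n q ψ z + realAvg n (q + 1) (c • ξ z))
    by_cases hz : z = 0 ∨ z ∉ K
    · have h0 : downForm η z = 0 := by
        rcases hz with rfl | hz
        · exact downForm_zero η
        · exact downForm_eq_zero hK hz
      have h1 : c • ξ z = 0 := by
        rw [hξ, h0]
        ext v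
        simp
      rw [h1, map_zero, add_zero]
      exact (stronglyPositive_omegaTest hψ0 z).smul hb0
    · rw [not_or, not_not] at hz
      obtain ⟨hz0, hzK⟩ := hz
      obtain ⟨c', hc', hcc⟩ : ∃ c' : ℂ, ‖c'‖ = 1 ∧ c * (χ z : ℂ) = ((|χ z| : ℝ) : ℂ) * c' := by
        rcases le_total 0 (χ z) with h0 | h0
        · exact ⟨c, hc, by rw [abs_of_nonneg h0, mul_comm]⟩
        · refine ⟨-c, by rwa [norm_neg], ?_⟩
          rw [abs_of_nonpos h0]
          push_cast
          ring
      have h1 := ((hb z hz0 c' hc').smul (abs_nonneg (χ z))).add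
        (((stronglyPositive_omegaPow hz0 (m := q + 1)).smul hb0).smul
          (sub_nonneg.2 (hχψ z hzK)))
      have h2 : c • ξ z = (|χ z| : ℝ) • (c' • downForm η z) := by
        rw [hξ]
        ext v
        simp only [ContinuousAlternatingMap.smul_apply, smul_eq_mul, Complex.real_smul]
        rw [← mul_assoc, hcc, mul_assoc]
      rw [h2, map_smul, omegaTest_apply]
      convert h1 using 1
      ext v
      simp only [ContinuousAlternatingMap.smul_apply, ContinuousAlternatingMap.add_apply,
        smul_eq_mul, Complex.real_smul, Complex.ofReal_sub]
      ring

theorem IsPositive.norm_cutForm_le {n q : ℕ} {T : TestForm n (2 * (q + 1)) →ₗ[ℂ] ℂ}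
    (hT : IsPositive T) {η : BlowupTestForm n (2 * (q + 1))} {b : ℝ}
    (hb : ∀ z, z ≠ 0 → ∀ c : ℂ, ‖c‖ = 1 → StronglyPositive
      (((b : ℝ) : ℂ) • omegaPow (q + 1) z + realAvg n (q + 1) (c • downForm η z)))
    (hb0 : 0 ≤ b) {K : Set (Cn n)} (hK : ∀ j w, chartProj j w ∉ K → η.1 j w = 0)
    {P : TestFun} (hP0 : ∀ x, 0 ≤ P x) (hP1 : ∀ z ∈ K, P (‖z‖ ^ 2) = 1) (i : ℕ) :
    ‖T (cutForm i η)‖ ≤ 2 * (b * (T (omegaTest n q (cutPos i P))).re) := by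
  refine hT.norm_le_omegaTest hb hb0 hK (cutForm_apply i η)
    (fun x _ => mul_nonneg (cutoff_nonneg i x) (hP0 x)) fun z hz => ?_
  rw [cutPos_apply, hP1 z hz, mul_one, abs_of_nonneg (cutoff_nonneg _ _)]

/-- The cut-offs increase with the index, so the difference is dominated by the difference of the
two Kähler test forms. The increments of the pairings are thus controlled by those of a monotone
real sequence. -/
theorem IsPositive.norm_cutForm_sub_le {n q : ℕ} {T : TestForm n (2 * (q + 1)) →ₗ[ℂ] ℂ}
    (hT : IsPositive T) {η : BlowupTestForm n (2 * (q + 1))} {b : ℝ}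
    (hb : ∀ z, z ≠ 0 → ∀ c : ℂ, ‖c‖ = 1 → StronglyPositive
      (((b : ℝ) : ℂ) • omegaPow (q + 1) z + realAvg n (q + 1) (c • downForm η z)))
    (hb0 : 0 ≤ b) {K : Set (Cn n)} (hK : ∀ j w, chartProj j w ∉ K → η.1 j w = 0)
    {P : TestFun} (hP0 : ∀ x, 0 ≤ P x) (hP1 : ∀ z ∈ K, P (‖z‖ ^ 2) = 1) {i j : ℕ} (hij : i ≤ j) :
    ‖T (cutForm j η) - T (cutForm i η)‖ ≤ 2 * (b * (T (omegaTest n q (cutPos j P))).re) -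
      2 * (b * (T (omegaTest n q (cutPos i P))).re) := by
  have h := hT.norm_le_omegaTest hb hb0 hK (ξ := cutForm j η - cutForm i η)
    (χ := fun z => cutoff j (‖z‖ ^ 2) - cutoff i (‖z‖ ^ 2)) (ψ := cutPos j P - cutPos i P)
    (fun z => ?_) (fun x hx => ?_) fun z hz => ?_
  · rw [map_sub, map_sub, map_sub, Complex.sub_re] at h
    linarith
  · ext v
    show cutForm j η z v - cutForm i η z v = _
    rw [cutForm_apply, cutForm_apply]
    simp only [ContinuousAlternatingMap.smul_apply, smul_eq_mul, Complex.ofReal_sub]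
    ring
  · show 0 ≤ cutoff j x * P x - cutoff i x * P x
    rw [← sub_mul]
    exact mul_nonneg (sub_nonneg.2 (cutoff_mono hij hx)) (hP0 x)
  · show _ ≤ cutoff j (‖z‖ ^ 2) * P (‖z‖ ^ 2) - cutoff i (‖z‖ ^ 2) * P (‖z‖ ^ 2)
    rw [hP1 z hz, mul_one, mul_one,
      abs_of_nonneg (sub_nonneg.2 (cutoff_mono hij (by positivity)))]

theorem IsPositive.omegaTest_cutPos_mono {n q : ℕ} {T : TestForm n (2 * (q + 1)) →ₗ[ℂ] ℂ}
    (hT : IsPositive T) {P : TestFun} (hP0 : ∀ x, 0 ≤ P x) :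
    Monotone fun i => (T (omegaTest n q (cutPos i P))).re := by
  intro i j hij
  have h := (hT.2 (omegaTest n q (cutPos j P - cutPos i P))
    (stronglyPositive_omegaTest fun x hx => ?_)).1
  · rw [map_sub, map_sub, Complex.sub_re] at h
    exact sub_nonneg.1 h
  · show 0 ≤ cutoff j x * P x - cutoff i x * P x
    rw [← sub_mul]
    exact mul_nonneg (sub_nonneg.2 (cutoff_mono hij hx)) (hP0 x)

/-- Points of the `j`-th chart with coordinates of modulus at most `1`, except for the `j`-th. -/
theorem norm_le_of_chartProj {n : ℕ} {j : Fin n} {w : Cn n} {R : ℝ} (hw : ∀ l, l ≠ j → ‖w l‖ ≤ 1)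
    (hR : ‖chartProj j w‖ ≤ R) : ‖w‖ ≤ √(n * (R + 1) ^ 2) := by
  have hR0 := (norm_nonneg _).trans hR
  have h1 : ‖w j‖ ≤ R := by
    have := (PiLp.norm_apply_le (chartProj j w) j).trans hR
    rwa [chartProj, PiLp.smul_apply, dir_self, smul_eq_mul, mul_one] at this
  have h2 : ∀ l ∈ (Finset.univ : Finset (Fin n)), ‖w l‖ ^ 2 ≤ (R + 1) ^ 2 := by
    intro l _
    refine pow_le_pow_left₀ (norm_nonneg _) ?_ 2
    by_cases hl : l = j
    · subst hl; linarith
    · linarith [hw l hl]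
  refine Real.le_sqrt_of_sq_le ?_
  rw [EuclideanSpace.norm_sq_eq]
  simpa using Finset.sum_le_card_nsmul _ _ _ h2

theorem exists_bound {n k : ℕ} (η : BlowupTestForm n k) {L : Set (Cn n)} (hL : IsCompact L) :
    ∃ b : ℝ, 0 ≤ b ∧ ∀ j, ∀ w ∈ L, ‖η.1 j w‖ ≤ b := by
  choose b hb using fun j => hL.exists_bound_of_continuousOn (η.2.1 j).continuous.continuousOn
  refine ⟨∑ j, |b j|, by positivity, fun j w hw => (hb j w hw).trans ((le_abs_self _).trans ?_)⟩
  exact Finset.single_le_sum (f := fun j => |b j|) (fun i _ => abs_nonneg _) (Finset.mem_univ j)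

/-- A form with constant coefficients bounded by `M` is dominated by `C M β^m`. -/
theorem exists_dominating_beta (n m : ℕ) : ∃ C : ℝ, 0 ≤ C ∧ ∀ (η : Alt n (2 * m)) (M : ℝ), ‖η‖ ≤ M →
    StronglyPositive (((C * M : ℝ) : ℂ) • betaPow n m + realAvg n m η) := by
  obtain ⟨C, hC, h⟩ := exists_dominating n m
  refine ⟨C * (2 * Real.pi) ^ m, by positivity, fun η M hM => ?_⟩
  have h1 := h (bExt n) 1 one_pos (by
    rw [Complex.ofReal_one, one_smul, sub_self]; exact (posCone n).zero_mem) η M hM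
  convert h1 using 2
  rw [betaPow, map_smul, smul_smul]
  congr 1
  rw [← Complex.ofReal_mul]
  congr 1
  have := Real.pi_ne_zero
  rw [one_pow, one_div, inv_pow]
  field_simp



/-! ### Construction of the blow-up -/

theorem exists_norm_le_of_isCompact {n : ℕ} {K : Set (Cn n)} (hK : IsCompact K) :
    ∃ R : ℝ, 0 ≤ R ∧ ∀ z ∈ K, ‖z‖ ≤ R := by
  obtain ⟨R, hR⟩ := hK.isBounded.exists_norm_le
  exact ⟨|R|, abs_nonneg R, fun z hz => (hR z hz).trans (le_abs_self R)⟩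

/-- A test function with values in `[0, 1]`, equal to `1` on `[0, a]` and to `0` on `[b, ∞)`. -/
theorem exists_testFun {a b : ℝ} (ha : 0 ≤ a) (hab : a < b) : ∃ P : TestFun, (∀ x, 0 ≤ P x) ∧
    (∀ x, P x ≤ 1) ∧ (∀ x, 0 ≤ x → x ≤ a → P x = 1) ∧ ∀ x, b ≤ x → P x = 0 := by
  have hδ : 0 < b - a := sub_pos.2 hab
  refine ⟨plateau 0 b hδ, plateau_nonneg hδ (ha.trans hab.le), plateau_le_one 0 b hδ,
    fun x h0 hx => plateau_eq_one hδ h0 (by linarith), fun x hx =>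
    plateau_eq_zero_of_ge hδ (ha.trans hab.le) hx⟩

section

variable {n q : ℕ} {T : TestForm n (2 * (q + 1)) →ₗ[ℂ] ℂ}

/-- Forms supported over the ball of radius `R`: the cut-off forms are controlled by the mass. -/
theorem exists_uniform_bound (hT : IsPositive T)
    {B : ℝ → ℝ} (hB : ∀ r : ℝ, 0 < r → ∀ ψ : PosFun, (∀ x, 0 ≤ ψ x) → (∀ x, ψ x ≤ 1) →
      ∀ R' < r ^ 2, (∀ x, R' ≤ x → ψ x = 0) → (T (omegaTest n q ψ)).re ≤ B r)
    {K : Set (Cn n)} (hK : IsCompact K) :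
    ∃ (L : Set (Cn n)) (C : ℝ) (a : ℕ → ℝ) (A : ℝ), IsCompact L ∧ L.Nonempty ∧ 0 ≤ C ∧ Monotone a ∧
      (∀ i, a i ≤ A) ∧ ∀ η : BlowupTestForm n (2 * (q + 1)),
        (∀ j w, chartProj j w ∉ K → η.1 j w = 0) → ∀ b, 0 ≤ b → (∀ j, ∀ w ∈ L, ‖η.1 j w‖ ≤ b) →
          (∀ i, ‖T (cutForm i η)‖ ≤ 2 * (C * b * a i)) ∧
          ∀ i j, i ≤ j → ‖T (cutForm j η) - T (cutForm i η)‖ ≤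
            2 * (C * b * a j) - 2 * (C * b * a i) := by
  obtain ⟨C, hC, hdom⟩ := exists_dominating_downForm n (q + 1)
  obtain ⟨R, hR0, hR⟩ := exists_norm_le_of_isCompact hK
  -- The cut-off P equals 1 over the ball of radius R containing K and vanishes for u ≥ R² + 1 < (R
  -- + 2)²; hence the uniform bound is B (R + 2).
  have hR1 : R ^ 2 < R ^ 2 + 1 := by linarith
  have hR2 : R ^ 2 + 1 < (R + 2) ^ 2 := by nlinarith
  obtain ⟨P, hP0, hP1, hPK, hPR⟩ := exists_testFun (sq_nonneg R) hR1
  have hPK' : ∀ z ∈ K, P (‖z‖ ^ 2) = 1 := fun z hz =>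
    hPK _ (by positivity) (pow_le_pow_left₀ (norm_nonneg z) (hR z hz) 2)
  refine ⟨Metric.closedBall 0 (√(n * (R + 1) ^ 2)), C, _, B (R + 2), isCompact_closedBall _ _,
    ⟨0, Metric.mem_closedBall_self (by positivity)⟩, hC, hT.omegaTest_cutPos_mono hP0, fun i => ?_,
    fun η hη b hb0 hb => ?_⟩
  · refine hB (R + 2) (by positivity) _ (fun x => mul_nonneg (cutoff_nonneg i x) (hP0 x))
      (fun x => mul_le_one₀ (cutoff_le_one i x) (hP0 x) (hP1 x)) _ hR2 fun x hx => ?_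
    rw [cutPos_apply, hPR x hx, mul_zero]
  · have hb' : ∀ z, z ≠ 0 → ∀ c : ℂ, ‖c‖ = 1 → StronglyPositive
        (((C * b : ℝ) : ℂ) • omegaPow (q + 1) z + realAvg n (q + 1) (c • downForm η z)) := by
      intro z hz
      refine hdom η b z hz fun j w hw hwz => ?_
      by_cases hzK : z ∈ K
      · refine hb j w ?_
        rw [mem_closedBall_zero_iff]
        exact norm_le_of_chartProj hw (by rw [hwz]; exact hR z hzK)
      · rw [hη j w (by rwa [hwz]), norm_zero]
        exact hb0
    exact ⟨fun i => hT.norm_cutForm_le hb' (by positivity) hη hP0 hPK' i, fun i j hij =>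
      hT.norm_cutForm_sub_le hb' (by positivity) hη hP0 hPK' hij⟩

/-- The cut-off forms of a form on the blow-up converge weakly. -/
theorem exists_lim_cutForm (hT : IsPositive T)
    {B : ℝ → ℝ} (hB : ∀ r : ℝ, 0 < r → ∀ ψ : PosFun, (∀ x, 0 ≤ ψ x) → (∀ x, ψ x ≤ 1) →
      ∀ R' < r ^ 2, (∀ x, R' ≤ x → ψ x = 0) → (T (omegaTest n q ψ)).re ≤ B r) :
    ∃ S : BlowupTestForm n (2 * (q + 1)) →ₗ[ℂ] ℂ,
      ∀ η, Tendsto (fun i => T (cutForm i η)) atTop (𝓝 (S η)) := by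
  have hlim : ∀ η : BlowupTestForm n (2 * (q + 1)), ∃ l,
      Tendsto (fun i => T (cutForm i η)) atTop (𝓝 l) := by
    intro η
    obtain ⟨K, hKc, hK⟩ := η.2.2.2
    obtain ⟨L, C, a, A, hL, -, hC, ha, haA, hbd⟩ := exists_uniform_bound hT hB hKc
    obtain ⟨b, hb0, hb⟩ := exists_bound η hL
    have h := (hbd η hK b hb0 hb).2
    have hconv : Tendsto a atTop (𝓝 (⨆ i, a i)) :=
      tendsto_atTop_ciSup ha ⟨A, by rintro _ ⟨i, rfl⟩; exact haA i⟩
    -- The pairings are Cauchy because their increments are bounded by those of this convergent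
    -- sequence.
    have hc := ((hconv.const_mul (C * b)).const_mul 2).cauchySeq
    refine cauchySeq_tendsto_of_complete (Metric.cauchySeq_iff'.2 fun ε hε => ?_)
    obtain ⟨N, hN⟩ := Metric.cauchySeq_iff'.1 hc ε hε
    refine ⟨N, fun k hk => ?_⟩
    rw [dist_eq_norm]
    refine (h N k hk).trans_lt ((le_abs_self _).trans_lt ?_)
    exact hN k hk
  choose s hs using hlim
  exact ⟨{
    toFun := s
    map_add' := fun η ξ => tendsto_nhds_unique (hs (η + ξ)) (by
      simpa only [map_add] using (hs η).add (hs ξ))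
    map_smul' := fun c η => tendsto_nhds_unique (hs (c • η)) (by
      rw [RingHom.id_apply]
      simpa only [map_smul] using (hs η).const_smul c) }, hs⟩

theorem isBlowupCurrent_of_tendsto (hn : 0 < n) (hT : IsPositive T)
    {B : ℝ → ℝ} (hB : ∀ r : ℝ, 0 < r → ∀ ψ : PosFun, (∀ x, 0 ≤ ψ x) → (∀ x, ψ x ≤ 1) →
      ∀ R' < r ^ 2, (∀ x, R' ≤ x → ψ x = 0) → (T (omegaTest n q ψ)).re ≤ B r)
    {S : BlowupTestForm n (2 * (q + 1)) →ₗ[ℂ] ℂ}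
    (hS : ∀ η, Tendsto (fun i => T (cutForm i η)) atTop (𝓝 (S η))) : IsBlowupCurrent S := by
  intro K hK
  obtain ⟨L, C, a, A, hL, ⟨w₀, hw₀⟩, hC, ha, haA, hbd⟩ := exists_uniform_bound hT hB hK
  -- A positive functional is of order zero: bounds on the coefficients suffice, without
  -- derivatives.
  refine ⟨L, 0, 2 * (C * A), hL, fun η hη b hb => ?_⟩
  have hb' : ∀ j, ∀ w ∈ L, ‖η.1 j w‖ ≤ b := fun j w hw => by
    have := hb j w hw 0 le_rfl
    rwa [norm_iteratedFDeriv_zero] at this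
  have hb0 : 0 ≤ b := (norm_nonneg _).trans (hb' ⟨0, hn⟩ w₀ hw₀)
  refine le_of_tendsto (hS η).norm (Eventually.of_forall fun i => ?_)
  refine ((hbd η hη b hb0 hb').1 i).trans ?_
  have : C * b * a i ≤ C * b * A := mul_le_mul_of_nonneg_left (haA i) (by positivity)
  linarith

theorem isPositiveBlowup_of_tendsto (hT : IsPositive T)
    {S : BlowupTestForm n (2 * (q + 1)) →ₗ[ℂ] ℂ}
    (hS : ∀ η, Tendsto (fun i => T (cutForm i η)) atTop (𝓝 (S η))) : IsPositiveBlowup S := by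
  refine ⟨fun a b hab ha η hη => ?_, fun η hη => ?_⟩
  · refine tendsto_nhds_unique (hS η) (tendsto_const_nhds.congr fun i => ?_)
    refine (hT.1 a b hab ha _ fun z t v => ?_).symm
    have := isOfType_downForm hη z t v
    rw [cutForm_apply, ContinuousAlternatingMap.smul_apply, ContinuousAlternatingMap.smul_apply,
      this, smul_eq_mul, smul_eq_mul]
    ring
  · have h := fun i => hT.2 (cutForm i η) fun z =>
      (stronglyPositive_downForm hη z).smul (cutoff_nonneg i _)
    exact ⟨ge_of_tendsto ((Complex.continuous_re.tendsto _).comp (hS η))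
      (Eventually.of_forall fun i => (h i).1),
      tendsto_nhds_unique ((Complex.continuous_im.tendsto _).comp (hS η))
        (tendsto_const_nhds.congr fun i => (h i).2.symm)⟩

/-- The cut-off changes η only where u < 2 · 2⁻ⁱ. There η is dominated by a multiple of β^{q+1}, so
the error is at most a constant times the trace mass of this ball, which tends to 0. -/
theorem pushBlowup_of_tendsto (hT : IsPositive T) {μ : Measure ℝ} (hμ : ∀ v, μ (Iio v) < ⊤)
    (hm : ∀ g : TestFun, (T (betaTest n (q + 1) g)).re = ∫ x, g x ∂μ)
    (hlim : Tendsto (cdfL μ) (𝓝[>] 0) (𝓝 0)) {S : BlowupTestForm n (2 * (q + 1)) →ₗ[ℂ] ℂ}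
    (hS : ∀ η, Tendsto (fun i => T (cutForm i η)) atTop (𝓝 (S η))) : pushBlowup S = T := by
  obtain ⟨C, hC, hdom⟩ := exists_dominating_beta n (q + 1)
  ext η
  refine tendsto_nhds_unique (hS (pullBlowup n _ η)) ?_
  obtain ⟨R, hR0, hR⟩ := exists_norm_le_of_isCompact η.hasCompactSupport.isCompact
  obtain ⟨P, hP0, hP1, hPK, -⟩ := exists_testFun (sq_nonneg R) (lt_add_one (R ^ 2))
  obtain ⟨M, hM⟩ := η.hasCompactSupport.isCompact.exists_bound_of_continuousOn
    η.continuous.continuousOn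
  have hM' : ∀ z, ‖η z‖ ≤ |M| := fun z => by
    by_cases hz : z ∈ tsupport η
    · exact (hM z hz).trans (le_abs_self M)
    · rw [image_eq_zero_of_notMem_tsupport hz, norm_zero]
      exact abs_nonneg M
  let g : ℕ → TestFun := fun i => mkTest (fun x => (1 - cutoff i x) * P x)
    ((contDiff_const.sub (contDiff_cutoff i)).mul P.contDiff) P.hasCompactSupport.mul_left
  have hg0 : ∀ i x, 0 ≤ g i x := fun i x =>
    mul_nonneg (sub_nonneg.2 (cutoff_le_one i x)) (hP0 x)
  have hbound : ∀ i, ‖T η - T (cutForm i (pullBlowup n _ η))‖ ≤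
      2 * (C * |M| * cdfL μ (2 * (2 ^ i)⁻¹)) := by
    intro i
    have h := hT.norm_le (η - cutForm i (pullBlowup n _ η))
      (((C * |M| : ℝ) : ℂ) • betaTest n (q + 1) (g i)) fun c z hc => ?_
    · rw [map_sub, map_smul, smul_eq_mul, Complex.re_ofReal_mul, hm] at h
      refine h.trans ?_
      have hint : ∫ x, g i x ∂μ ≤ cdfL μ (2 * (2 ^ i)⁻¹) := by
        have e : cdfL μ (2 * (2 ^ i)⁻¹) =
            ∫ x, (Iio (2 * ((2 : ℝ) ^ i)⁻¹)).indicator (fun _ => (1 : ℝ)) x ∂μ := by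
          rw [integral_indicator measurableSet_Iio]
          simp [cdfL]
        rw [e]
        refine integral_mono_of_nonneg (Eventually.of_forall (hg0 i))
          ((integrable_indicator_iff measurableSet_Iio).2 (integrableOn_const (hμ _).ne))
          (Eventually.of_forall fun x => ?_)
        show (1 - cutoff i x) * P x ≤ _
        by_cases hx : x ∈ Iio (2 * ((2 : ℝ) ^ i)⁻¹)
        · rw [indicator_of_mem hx]
          exact mul_le_one₀ (sub_le_self _ (cutoff_nonneg i x)) (hP0 x) (hP1 x)
        · rw [indicator_of_notMem hx, cutoff_eq_one (not_lt.1 hx), sub_self, zero_mul]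
      gcongr
    · have e1 : (η - cutForm i (pullBlowup n _ η)) z = ((1 - cutoff i (‖z‖ ^ 2) : ℝ) : ℂ) • η z := by
        show η z - cutForm i (pullBlowup n _ η) z = _
        rw [cutForm_apply]
        rcases eq_or_ne z 0 with rfl | hz
        · rw [downForm_zero, cutoff_eq_zero (by simp)]
          ext v
          simp
        · rw [downForm_pullBlowup η hz]
          ext v
          simp only [ContinuousAlternatingMap.smul_apply, ContinuousAlternatingMap.sub_apply,
            smul_eq_mul, Complex.ofReal_sub, Complex.ofReal_one]
          ring
      have e2 : ((1 - cutoff i (‖z‖ ^ 2) : ℝ) : ℂ) • η z = ((g i (‖z‖ ^ 2) : ℝ) : ℂ) • η z := by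
        by_cases hz : z ∈ tsupport η
        · have : g i (‖z‖ ^ 2) = 1 - cutoff i (‖z‖ ^ 2) := by
            show _ * P _ = _
            rw [hPK _ (by positivity) (pow_le_pow_left₀ (norm_nonneg z) (hR z hz) 2), mul_one]
          rw [this]
        · rw [image_eq_zero_of_notMem_tsupport hz]
          ext v
          simp
      have h1 := (hdom (c • η z) |M| (by rw [norm_smul, hc, one_mul]; exact hM' z)).smul
        (hg0 i (‖z‖ ^ 2))
      have e3 : c • ((g i (‖z‖ ^ 2) : ℝ) : ℂ) • η z = (g i (‖z‖ ^ 2) : ℝ) • (c • η z) := by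
        ext v
        simp only [ContinuousAlternatingMap.smul_apply, smul_eq_mul, Complex.real_smul]
        ring
      rw [e1, e2, e3, map_smul]
      show StronglyPositive (((C * |M| : ℝ) : ℂ) • (((g i (‖z‖ ^ 2) : ℝ) : ℂ) • betaPow n (q + 1)) + _)
      convert h1 using 1
      ext v
      simp only [ContinuousAlternatingMap.smul_apply, ContinuousAlternatingMap.add_apply,
        smul_eq_mul, Complex.real_smul]
      ring
  have h2 : Tendsto (fun i : ℕ => 2 * ((2 : ℝ) ^ i)⁻¹) atTop (𝓝[>] 0) := by
    refine tendsto_nhdsWithin_iff.2 ⟨?_, Eventually.of_forall fun i => ?_⟩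
    · have := (tendsto_inv_atTop_zero.comp
        (tendsto_pow_atTop_atTop_of_one_lt (one_lt_two (α := ℝ)))).const_mul 2
      simpa using this
    · show (0 : ℝ) < _
      positivity
  have h3 := ((hlim.comp h2).const_mul (C * |M|)).const_mul 2
  rw [mul_zero, mul_zero] at h3
  refine tendsto_iff_norm_sub_tendsto_zero.2 (squeeze_zero (fun _ => norm_nonneg _) (fun i => ?_) h3)
  rw [norm_sub_rev]
  exact hbound i

/-- A density Φ ≤ 1 supported over a compact subset of the ball is dominated by a radial P that
vanishes before u = r². By positivity, each cut-off of Φ times the Kähler power has T-value at most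
that of the corresponding Kähler test form, which is at most B r, and the bound passes to the limit.
-/
theorem massOver_le_of_tendsto (hT : IsPositive T)
    {B : ℝ → ℝ} (hB : ∀ r : ℝ, 0 < r → ∀ ψ : PosFun, (∀ x, 0 ≤ ψ x) → (∀ x, ψ x ≤ 1) →
      ∀ R' < r ^ 2, (∀ x, R' ≤ x → ψ x = 0) → (T (omegaTest n q ψ)).re ≤ B r)
    {S : BlowupTestForm n (2 * (q + 1)) →ₗ[ℂ] ℂ}
    (hS : ∀ η, Tendsto (fun i => T (cutForm i η)) atTop (𝓝 (S η))) {r : ℝ} (hr : 0 < r) :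
    massOver S (Metric.ball 0 r) ≤ ENNReal.ofReal (B r) := by
  refine iSup₂_le fun η hη => ENNReal.ofReal_le_ofReal ?_
  obtain ⟨Φ, hΦ, ⟨K, hK, hKU, hΦK⟩, hηΦ⟩ := hη
  obtain ⟨a, ha0, har, haK⟩ : ∃ a : ℝ, 0 ≤ a ∧ a < r ^ 2 ∧ ∀ z ∈ K, ‖z‖ ^ 2 ≤ a := by
    rcases K.eq_empty_or_nonempty with rfl | hne
    · exact ⟨0, le_rfl, by positivity, fun z hz => hz.elim⟩
    · obtain ⟨z₀, hz₀, hmax⟩ := hK.exists_isMaxOn hne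
        (f := fun z : Cn n => ‖z‖) continuous_norm.continuousOn
      refine ⟨‖z₀‖ ^ 2, by positivity, ?_, fun z hz =>
        pow_le_pow_left₀ (norm_nonneg z) (hmax hz) 2⟩
      have := hKU hz₀
      rw [mem_ball_zero_iff] at this
      exact pow_lt_pow_left₀ this (norm_nonneg _) two_ne_zero
  obtain ⟨b, hab, hbr⟩ := exists_between har
  obtain ⟨P, hP0, hP1, hPa, hPb⟩ := exists_testFun ha0 hab
  refine le_of_tendsto ((Complex.continuous_re.tendsto _).comp (hS η))
    (Eventually.of_forall fun i => ?_)
  have h1 : (T (omegaTest n q (cutPos i P))).re ≤ B r := by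
    refine hB r hr _ (fun x => mul_nonneg (cutoff_nonneg i x) (hP0 x))
      (fun x => mul_le_one₀ (cutoff_le_one i x) (hP0 x) (hP1 x)) _ hbr fun x hx => ?_
    rw [cutPos_apply, hPb x hx, mul_zero]
  refine le_trans ?_ h1
  have h2 := (hT.2 (omegaTest n q (cutPos i P) - cutForm i η) fun z => ?_).1
  · rw [map_sub, Complex.sub_re] at h2
    exact sub_nonneg.1 h2
  · show StronglyPositive (omegaTest n q (cutPos i P) z - cutForm i η z)
    rw [omegaTest_apply, cutForm_apply, cutPos_apply]
    rcases eq_or_ne z 0 with rfl | hz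
    · rw [cutoff_eq_zero (by simp)]
      convert StronglyPositive.zero using 1
      ext v
      simp
    · obtain ⟨j, hj⟩ := exists_coord_ne hz
      rw [downForm_massTest hηΦ hj]
      set Φz := Φ (chart j (chartCoord j z)) with hΦz
      have hle : Φz ≤ P (‖z‖ ^ 2) := by
        by_cases hzK : z ∈ K
        · rw [hPa _ (by positivity) (haK z hzK)]
          exact (hΦ _).2
        · have : Φz = 0 := by
            refine hΦK _ ?_
            show chartProj j (chartCoord j z) ∉ K
            rwa [chartProj_chartCoord j hj]
          rw [this]
          exact hP0 _
      convert alt_smul_nonneg_sub (stronglyPositive_omegaPow hz)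
        (mul_le_mul_of_nonneg_left hle (cutoff_nonneg i (‖z‖ ^ 2))) using 2
      rw [smul_smul, Complex.ofReal_mul]

/-- A positive current whose mass near the exceptional divisor is controlled has a blow-up. -/
theorem exists_blowup (hn : 0 < n)
    (hT : IsPositive T) {μ : Measure ℝ} (hμ : ∀ v, μ (Iio v) < ⊤)
    (hm : ∀ g : TestFun, (T (betaTest n (q + 1) g)).re = ∫ x, g x ∂μ)
    (hlim : Tendsto (cdfL μ) (𝓝[>] 0) (𝓝 0)) {B : ℝ → ℝ}
    (hB : ∀ r : ℝ, 0 < r → ∀ ψ : PosFun, (∀ x, 0 ≤ ψ x) → (∀ x, ψ x ≤ 1) →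
      ∀ R' < r ^ 2, (∀ x, R' ≤ x → ψ x = 0) → (T (omegaTest n q ψ)).re ≤ B r) :
    ∃ S : BlowupTestForm n (2 * (q + 1)) →ₗ[ℂ] ℂ, IsBlowupOf S T ∧ ∀ r : ℝ, 0 < r →
      massOver S (Metric.ball 0 r) ≠ ⊤ ∧ (massOver S (Metric.ball 0 r)).toReal ≤ B r := by
  obtain ⟨S, hS⟩ := exists_lim_cutForm hT hB
  refine ⟨S, ⟨isBlowupCurrent_of_tendsto hn hT hB hS, isPositiveBlowup_of_tendsto hT hS,
    pushBlowup_of_tendsto hT hμ hm hlim hS⟩, fun r hr => ?_⟩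
  have h := massOver_le_of_tendsto hT hB hS hr
  -- The test function ψ = 0 gives B r ≥ 0, which is needed to pass from `ENNReal.ofReal (B r)` back
  -- to the real bound.
  have hB0 : 0 ≤ B r := by
    have := hB r hr 0 (fun _ => le_rfl) (fun _ => zero_le_one) 0 (by positivity) fun _ _ => rfl
    rwa [map_zero, map_zero] at this
  exact ⟨(h.trans_lt ENNReal.ofReal_lt_top).ne, ENNReal.toReal_le_of_le_ofReal hB0 h⟩

end

end PshCurrent

end

/-- `p = q + 1`, so that `0 < p < n`. `T` is a positive current of bidimension `(p, p)` on `ℂⁿ`. -/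
theorem proposition1 (n q : ℕ) (hq : q + 1 < n)
    (T : PshCurrent.TestForm n (2 * (q + 1)) →L[ℂ] ℂ)
    (hT : PshCurrent.IsPositive T.toLinearMap) :
    -- `T` plurisubharmonic
    (PshCurrent.IsPositive (PshCurrent.ddc T.toLinearMap) →
      ∃ ν₀ : ℝ, Tendsto (PshCurrent.nu T.toLinearMap) (𝓝[>] 0) (𝓝 ν₀) ∧
        ∃ S : PshCurrent.BlowupTestForm n (2 * (q + 1)) →ₗ[ℂ] ℂ,
          PshCurrent.IsBlowupOf S T.toLinearMap ∧
          ∀ r : ℝ, 0 < r →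
            PshCurrent.massOver S (Metric.ball 0 r) ≠ ⊤ ∧
            (PshCurrent.massOver S (Metric.ball 0 r)).toReal ≤
              PshCurrent.nu T.toLinearMap r - ν₀ +
                (∑ k ∈ Finset.Icc 1 (q + 1), ((q + 1).choose k : ℝ) * r ^ (2 * k)) *
                  PshCurrent.nu T.toLinearMap r) ∧
    -- `T` plurisuperharmonic with the integrability condition at `0`
    (PshCurrent.IsPositive (-PshCurrent.ddc T.toLinearMap) →
      (∃ r₀ : ℝ, 0 < r₀ ∧
        IntegrableOn (fun t => PshCurrent.nu (PshCurrent.ddc T.toLinearMap) t / t)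
          (Ioo 0 r₀)) →
      ∃ ν₀ : ℝ, Tendsto (PshCurrent.nu T.toLinearMap) (𝓝[>] 0) (𝓝 ν₀) ∧
        ∃ S : PshCurrent.BlowupTestForm n (2 * (q + 1)) →ₗ[ℂ] ℂ,
          PshCurrent.IsBlowupOf S T.toLinearMap ∧
          ∀ r : ℝ, 0 < r →
            PshCurrent.massOver S (Metric.ball 0 r) ≠ ⊤ ∧
            (PshCurrent.massOver S (Metric.ball 0 r)).toReal ≤
              |PshCurrent.nu T.toLinearMap r - ν₀| +
                (∑ k ∈ Finset.Icc 1 (q + 1), ((q + 1).choose k : ℝ) * r ^ (2 * k)) *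
                  PshCurrent.nu T.toLinearMap r -
                2 * (∑ k ∈ Finset.Icc 1 (q + 1),
                  ((q + 1).choose k : ℝ) / (2 * k) * r ^ (2 * k)) *
                  PshCurrent.nu (PshCurrent.ddc T.toLinearMap) r +
                2 * ∫ t in (0 : ℝ)..r, (t ^ (2 * (q + 1)) / r ^ (2 * (q + 1)) - 1) *
                  (PshCurrent.nu (PshCurrent.ddc T.toLinearMap) t / t)) := by
  constructor
  · intro hdd
    obtain ⟨ν₀, μ, hμ, hν, hm, hlim, hest⟩ := PshCurrent.estimates_of_psh hT hdd
    exact ⟨ν₀, hν, PshCurrent.exists_blowup (by omega) hT hμ hm hlim (B := fun r => _) hest⟩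
  · rintro hdd ⟨r₀, hr₀, hint⟩
    obtain ⟨ν₀, μ, hμ, hν, hm, hlim, hest⟩ :=
      PshCurrent.estimates_of_superharmonic hT hdd hr₀ hint
    exact ⟨ν₀, hν, PshCurrent.exists_blowup (by omega) hT hμ hm hlim (B := fun r => _) hest⟩
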